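/- Let $k$ be a commutative ring and let $A$ be a ribbon Hopf algebra over $k$: a Hopf algebra $(A,m,\Delta,i,\epsilon,S)$ with an invertible element $\mathcal R=\sum_i\alpha_i\otimes\beta_i\in A\otimes A$ such that $\mathcal R\Delta(x)\mathcal R^{-1}=\Delta^{\mathrm{op}}(x)$ for all $x\in A$, $(\Delta\otimes\mathrm{id})(\mathcal R)=\mathcal R_{13}\mathcal R_{23}$, $(\mathrm{id}\otimes\Delta)(\mathcal R)=\mathcal R_{13}\mathcal R_{12}$, and with a central element $v$ such that $v^2=S(u)u$, $\Delta(v)=(v\otimes v)(\mathcal R_{21}\mathcal R)^{-1}$, $S(v)=v$, $\epsilon(v)=1$, where $u=\sum_i S(\beta_i)\alpha_i$. Write $\mathcal R^{-1}=\sum_i\alpha_i'\otimes\beta_i'$. A biframed planar knotoid diagram is a smooth immersion $\phi:[0,1]\to\mathbb R^2$ whose only singularities are finitely many transversal double points, which carry over/under data and are different from the leg $\phi(0)$ and the head $\phi(1)$, such that the tangent vectors at leg and head are directed vertically downwards. It is oriented from leg to head. An (oriented) biframed planar knotoid is an equivalence class of such diagrams under the equivalence generated by orientation preserving reparametrizations,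 ambient isotopies of $\mathbb R^2$ during which the tangent vectors at leg and head keep their directions, the Reidemeister moves $R2$ and $R3$, and the weakened move $R1'$, which replaces a curl by the curl that turns the other way and whose crossing has the same sign. The moves take place away from the leg and the head. A diagram is decomposed into elementary pieces (vertical strands, crossings of two non-horizontal strands, caps, cups, leg, head) when all critical points of its height function are non-degenerate (there are then finitely many) and no tangent at a crossing is horizontal. For such a diagram $K$ place elements of $A$ on the strand as follows. * At a crossing whose over-strand runs, as an unoriented line, from the top right to the bottom left, place $\alpha_i$ on the over-strand and $\beta_i$ on the under-strand; at a crossing whose over-strand runs from the top left to the bottom right, place $\alpha'_i$ on the over-strand and $\beta_i'$ on the under-strand, with a separate index $i$ for each crossing. On a strand that is directed upwards place the image under $S$ instead. * Place $uv^{-1}$ on each cap (local maximum) that is run through from right to left, $vu^{-1}$ on each cup (local minimum) that is run through from right to left, and $1$ on all other caps and cups. Let $Q^{A;\star}(K)\in A$ be the product of these elements, multiplied from left to right in the order in which they are met from the leg to the head, and summed over the indices of all copies of $\mathcal R$ and $\mathcal R^{-1}$. Then $Q^{A;\star}$ is an invariant of oriented biframed planar knotoids: there is exactly one map $Q$ from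 the set of oriented biframed planar knotoids to $A$ such that $Q([K])=Q^{A;\star}(K)$ for every decomposed biframed planar knotoid diagram $K$ and for every choice of the expressions of $\mathcal R$ and $\mathcal R^{-1}$ as finite sums of pure tensors. In particular every biframed planar knotoid has its value determined by decomposed diagrams, and equivalent decomposed diagrams have the same value. -/

import Mathlib

open scoped ContDiff TensorProduct

noncomputable section

/-! ## Ribbon Hopf algebras -/

/-- `R₁₂ = R ⊗ 1` in `A ⊗ A ⊗ A`. -/
def leg12 (k : Type*) {A : Type*} [CommRing k] [Ring A] [Algebra k A]
    (R : A ⊗[k] A) : A ⊗[k] (A ⊗[k] A) :=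
  TensorProduct.assoc k A A A (R ⊗ₜ[k] (1 : A))

/-- `R₁₃`: if `R = ∑ αᵢ ⊗ βᵢ` then `R₁₃ = ∑ αᵢ ⊗ 1 ⊗ βᵢ`. -/
def leg13 (k : Type*) {A : Type*} [CommRing k] [Ring A] [Algebra k A]
    (R : A ⊗[k] A) : A ⊗[k] (A ⊗[k] A) :=
  (TensorProduct.mk k A A 1).lTensor A R

/-- `R₂₃ = 1 ⊗ R`. -/
def leg23 (k : Type*) {A : Type*} [CommRing k] [Ring A] [Algebra k A]
    (R : A ⊗[k] A) : A ⊗[k] (A ⊗[k] A) :=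
  (1 : A) ⊗ₜ[k] R

/-- A quasitriangular structure on a Hopf algebra: an invertible element `R` of `A ⊗ A` with
`R Δ(x) R⁻¹ = Δᵒᵖ(x)`, `(Δ ⊗ id)(R) = R₁₃ R₂₃` and `(id ⊗ Δ)(R) = R₁₃ R₁₂`. -/
structure QuasitriangularStructure (k A : Type*) [CommRing k] [Ring A] [HopfAlgebra k A] where
  /-- the universal R-matrix -/
  R : (A ⊗[k] A)ˣ
  conj_comul : ∀ x : A, (R : A ⊗[k] A) * Coalgebra.comul (R := k) x * (R⁻¹ : (A ⊗[k] A)ˣ) =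
    TensorProduct.comm k A A (Coalgebra.comul (R := k) x)
  comul_left : TensorProduct.assoc k A A A
      ((Coalgebra.comul (R := k) (A := A)).rTensor A (R : A ⊗[k] A)) =
    leg13 k (R : A ⊗[k] A) * leg23 k (R : A ⊗[k] A)
  comul_right : (Coalgebra.comul (R := k) (A := A)).lTensor A (R : A ⊗[k] A) =
    leg13 k (R : A ⊗[k] A) * leg12 k (R : A ⊗[k] A)

namespace QuasitriangularStructure

variable {k A : Type*} [CommRing k] [Ring A] [HopfAlgebra k A]

/-- `R₂₁ = ∑ βᵢ ⊗ αᵢ`, as a unit. -/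
def R21 (H : QuasitriangularStructure k A) : (A ⊗[k] A)ˣ :=
  Units.map ((Algebra.TensorProduct.comm k A A : A ⊗[k] A →ₐ[k] A ⊗[k] A) :
    A ⊗[k] A →* A ⊗[k] A) H.R

/-- The element `u = ∑ S(βᵢ) αᵢ`. -/
def u (H : QuasitriangularStructure k A) : A :=
  LinearMap.mul' k A
    ((HopfAlgebra.antipode k (A := A)).rTensor A (H.R21 : A ⊗[k] A))

end QuasitriangularStructure

/-- A ribbon structure on a Hopf algebra: a quasitriangular structure and a central element `v`
with `v² = S(u) u`, `Δ(v) = (v ⊗ v) (R₂₁ R)⁻¹`, `S(v) = v` and `ε(v) = 1`. -/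
structure RibbonStructure (k A : Type*) [CommRing k] [Ring A] [HopfAlgebra k A]
    extends QuasitriangularStructure k A where
  /-- the ribbon element -/
  v : A
  v_central : ∀ x : A, v * x = x * v
  v_sq : v ^ 2 = HopfAlgebra.antipode k toQuasitriangularStructure.u *
    toQuasitriangularStructure.u
  comul_v : Coalgebra.comul (R := k) v =
    (v ⊗ₜ[k] v) * (((toQuasitriangularStructure.R21 * R)⁻¹ : (A ⊗[k] A)ˣ) : A ⊗[k] A)
  antipode_v : HopfAlgebra.antipode k v = v
  counit_v : Coalgebra.counit (R := k) v = 1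

/-- A way of writing `x ∈ A ⊗ A` as a finite sum `∑ᵢ fst i ⊗ snd i`. -/
structure TensorExpansion {k A : Type*} [CommRing k] [Ring A] [Algebra k A]
    (x : A ⊗[k] A) where
  size : ℕ
  fst : Fin size → A
  snd : Fin size → A
  sum_eq : ∑ i, fst i ⊗ₜ[k] snd i = x

/-! ## Biframed planar knotoid diagrams

The plane is `ℂ`.  Curves are functions on `ℝ` of which only the restriction to `[0,1]` matters;
they are oriented from the leg (time `0`) to the head (time `1`). -/

/-- The determinant of the pair of plane vectors `(z, w)`. -/
def planeDet (z w : ℂ) : ℝ := z.re * w.im - z.im * w.re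

/-- `z` is a positive multiple of the downward unit vector. -/
def PointsDown (z : ℂ) : Prop := z.re = 0 ∧ z.im < 0

/-- A planar knotoid diagram: a smooth immersion of `[0,1]` in the plane whose only singularities
are finitely many transversal double points, none of them at the end-points, with over/under
data. -/
structure KnotoidDiagram where
  curve : ℝ → ℂ
  /-- `isOver t` says, when `curve` passes through a double point at time `t`, whether it is
  then on the over-strand (values at other times are irrelevant). -/
  isOver : ℝ → Bool
  smooth : ContDiffOn ℝ ∞ curve (Set.Icc 0 1)
  immersed : ∀ t ∈ Set.Icc (0 : ℝ) 1, derivWithin curve (Set.Icc 0 1) t ≠ 0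
  transverse : ∀ s ∈ Set.Icc (0 : ℝ) 1, ∀ t ∈ Set.Icc (0 : ℝ) 1, s ≠ t → curve s = curve t →
    planeDet (derivWithin curve (Set.Icc 0 1) s) (derivWithin curve (Set.Icc 0 1) t) ≠ 0
  no_triple : ∀ r ∈ Set.Icc (0 : ℝ) 1, ∀ s ∈ Set.Icc (0 : ℝ) 1, ∀ t ∈ Set.Icc (0 : ℝ) 1,
    curve r = curve s → curve s = curve t → r = s ∨ s = t ∨ r = t
  finite_double : {p : ℝ × ℝ | p.1 ∈ Set.Icc (0 : ℝ) 1 ∧ p.2 ∈ Set.Icc (0 : ℝ) 1 ∧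
    p.1 ≠ p.2 ∧ curve p.1 = curve p.2}.Finite
  leg_simple : ∀ t ∈ Set.Icc (0 : ℝ) 1, curve t = curve 0 → t = 0
  head_simple : ∀ t ∈ Set.Icc (0 : ℝ) 1, curve t = curve 1 → t = 1
  over_under : ∀ s ∈ Set.Icc (0 : ℝ) 1, ∀ t ∈ Set.Icc (0 : ℝ) 1, s ≠ t → curve s = curve t →
    isOver s ≠ isOver t

namespace KnotoidDiagram

/-- The tangent vector at time `t`. -/
def velocity (K : KnotoidDiagram) (t : ℝ) : ℂ := derivWithin K.curve (Set.Icc 0 1) t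

/-- The second derivative at time `t`. -/
def acceleration (K : KnotoidDiagram) (t : ℝ) : ℂ := derivWithin K.velocity (Set.Icc 0 1) t

/-- The diagram passes through a double point at time `t`. -/
def IsCrossingTime (K : KnotoidDiagram) (t : ℝ) : Prop :=
  t ∈ Set.Icc (0 : ℝ) 1 ∧ ∃ s ∈ Set.Icc (0 : ℝ) 1, s ≠ t ∧ K.curve s = K.curve t

/-- The crossings, each given as the pair (time on the over-strand, time on the
under-strand). -/
def crossings (K : KnotoidDiagram) : Finset (ℝ × ℝ) :=
  (K.finite_double.subset (fun _ hp => hp.1) :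
    {p : ℝ × ℝ | (p.1 ∈ Set.Icc (0 : ℝ) 1 ∧ p.2 ∈ Set.Icc (0 : ℝ) 1 ∧
      p.1 ≠ p.2 ∧ K.curve p.1 = K.curve p.2) ∧ K.isOver p.1 = true}.Finite).toFinset

end KnotoidDiagram

/-- A biframed planar knotoid diagram: the tangent vectors at the leg and the head are directed
vertically downwards. -/
structure BiframedDiagram extends KnotoidDiagram where
  leg_down : PointsDown (toKnotoidDiagram.velocity 0)
  head_down : PointsDown (toKnotoidDiagram.velocity 1)

/-! ## Equivalence of biframed diagrams -/

/-- `K'` is obtained from `K` by an ambient isotopy of the plane during which the tangent vectors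
at the leg and the head keep their direction. -/
def AmbientIsotopic (K K' : BiframedDiagram) : Prop :=
  ∃ F : ℝ → ℂ → ℂ,
    ContDiffOn ℝ ∞ (fun p : ℝ × ℂ => F p.1 p.2) (Set.Icc 0 1 ×ˢ Set.univ) ∧
    (∀ z, F 0 z = z) ∧
    (∀ s ∈ Set.Icc (0 : ℝ) 1, ∃ G : ℂ → ℂ, ContDiff ℝ ∞ G ∧
      Function.LeftInverse G (F s) ∧ Function.RightInverse G (F s)) ∧
    (∀ s ∈ Set.Icc (0 : ℝ) 1,
      PointsDown (derivWithin (fun t => F s (K.curve t)) (Set.Icc 0 1) 0) ∧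
      PointsDown (derivWithin (fun t => F s (K.curve t)) (Set.Icc 0 1) 1)) ∧
    (∀ t ∈ Set.Icc (0 : ℝ) 1, K'.curve t = F 1 (K.curve t)) ∧
    (∀ t, K.IsCrossingTime t → K'.isOver t = K.isOver t)

/-- `K'` is `K` with another (orientation preserving) parametrization. -/
def Reparametrized (K K' : BiframedDiagram) : Prop :=
  ∃ ρ : ℝ → ℝ, ContDiffOn ℝ ∞ ρ (Set.Icc 0 1) ∧
    (∀ t ∈ Set.Icc (0 : ℝ) 1, 0 < derivWithin ρ (Set.Icc 0 1) t) ∧ ρ 0 = 0 ∧ ρ 1 = 1 ∧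
    (∀ t ∈ Set.Icc (0 : ℝ) 1, K'.curve t = K.curve (ρ t)) ∧
    (∀ t, K'.IsCrossingTime t → K'.isOver t = K.isOver (ρ t))

/-- A window: a closed square in the plane, of any position, size and direction, with its own
coordinates, in which it is `[-1,1] × [-1,1]`. -/
structure Window where
  center : ℂ
  scale : ℂ
  scale_ne_zero : scale ≠ 0

namespace Window

/-- The coordinate of a point of the plane with respect to the window. -/
def coord (W : Window) (z : ℂ) : ℂ := (z - W.center) / W.scale

/-- The components of a vector with respect to the window. -/
def direction (W : Window) (z : ℂ) : ℂ := z / W.scale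

/-- The closed square itself. -/
def region (W : Window) : Set ℂ := {z | |(W.coord z).re| ≤ 1 ∧ |(W.coord z).im| ≤ 1}

/-- `K` and `K'` differ at most inside the window `W`, in which each of them is exactly during the
times in `J`.  As `J` will be in the open interval `(0,1)`, the end-points are not in `W`. -/
def DifferOnlyIn (W : Window) (J : Set ℝ) (K K' : BiframedDiagram) : Prop :=
  (∀ t ∈ Set.Icc (0 : ℝ) 1, t ∈ J ↔ K.curve t ∈ W.region) ∧
  (∀ t ∈ Set.Icc (0 : ℝ) 1, t ∈ J ↔ K'.curve t ∈ W.region) ∧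
  (∀ t ∈ Set.Icc (0 : ℝ) 1, t ∉ J → K'.curve t = K.curve t) ∧
  (∀ t, t ∉ J → K.IsCrossingTime t → K'.isOver t = K.isOver t)

/-- During `[a,b]` the diagram enters the window through the top side and leaves it through the
bottom side. -/
def Descends (W : Window) (K : BiframedDiagram) (a b : ℝ) : Prop :=
  0 < a ∧ a < b ∧ b < 1 ∧ (∀ t ∈ Set.Icc a b, |(W.coord (K.curve t)).re| < 1) ∧
  (W.coord (K.curve a)).im = 1 ∧ (W.coord (K.curve b)).im = -1

/-- During `[a,b]` the diagram enters the window through the bottom side and leaves it through the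
top side. -/
def Ascends (W : Window) (K : BiframedDiagram) (a b : ℝ) : Prop :=
  0 < a ∧ a < b ∧ b < 1 ∧ (∀ t ∈ Set.Icc a b, |(W.coord (K.curve t)).re| < 1) ∧
  (W.coord (K.curve a)).im = -1 ∧ (W.coord (K.curve b)).im = 1

/-- During `[a,b]` the diagram runs through the window from top to bottom, or from bottom to top,
as a strand without horizontal tangents (with respect to the window). -/
def IsStrand (W : Window) (K : BiframedDiagram) (a b : ℝ) : Prop :=
  (W.Descends K a b ∧ ∀ t ∈ Set.Icc a b, (W.direction (K.velocity t)).im < 0) ∨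
  (W.Ascends K a b ∧ ∀ t ∈ Set.Icc a b, 0 < (W.direction (K.velocity t)).im)

end Window

/-- The crossings between the part `[a,b]` and the part `[c,d]` of the diagram. -/
def crossingsBetween (K : BiframedDiagram) (a b c d : ℝ) : Set (ℝ × ℝ) :=
  {p | p.1 ∈ Set.Icc a b ∧ p.2 ∈ Set.Icc c d ∧ K.curve p.1 = K.curve p.2}

/-- During `[a,b]` the diagram runs through the window from top to bottom and makes one curl:
it goes down until time `p`, up until time `q` and down again, and its only crossing with itself is
between the first and the third of these pieces.  The curl turns clockwise or counterclockwise
according to `clockwise`, and its first passage through the crossing is over or under according to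
`firstOver`. -/
def Window.IsCurl (W : Window) (K : BiframedDiagram) (a b : ℝ) (clockwise firstOver : Bool) :
    Prop :=
  W.Descends K a b ∧ ∃ p q s t : ℝ,
    a ≤ s ∧ s < p ∧ p < q ∧ q < t ∧ t ≤ b ∧
    (∀ r ∈ Set.Ico a p, (W.direction (K.velocity r)).im < 0) ∧
    (W.direction (K.velocity p)).im = 0 ∧
    (∀ r ∈ Set.Ioo p q, 0 < (W.direction (K.velocity r)).im) ∧
    (W.direction (K.velocity q)).im = 0 ∧
    (∀ r ∈ Set.Ioc q b, (W.direction (K.velocity r)).im < 0) ∧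
    K.curve s = K.curve t ∧
    (∀ s' ∈ Set.Icc a b, ∀ t' ∈ Set.Icc a b, s' < t' → K.curve s' = K.curve t' →
      s' = s ∧ t' = t) ∧
    K.isOver s = firstOver ∧
    (if clockwise then
      (W.direction (K.velocity p)).re < 0 ∧ 0 < (W.direction (K.velocity q)).re ∧
        0 < planeDet (K.velocity s) (K.velocity t)
    else
      0 < (W.direction (K.velocity p)).re ∧ (W.direction (K.velocity q)).re < 0 ∧
        planeDet (K.velocity s) (K.velocity t) < 0)

/-- The weakened first Reidemeister move `R1'`: a clockwise curl is replaced by the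
counterclockwise curl whose crossing has the same sign. -/
def MoveR1' (K K' : BiframedDiagram) : Prop :=
  ∃ (W : Window) (a b : ℝ) (o : Bool), W.DifferOnlyIn (Set.Icc a b) K K' ∧
    W.IsCurl K a b true o ∧ W.IsCurl K' a b false (!o)

/-- The second Reidemeister move: two strands, of which the first lies over the second at two
crossings of opposite signs, are pulled apart.  Both strands may have either orientation. -/
def MoveR2 (K K' : BiframedDiagram) : Prop :=
  ∃ (W : Window) (a b c d : ℝ), Disjoint (Set.Icc a b) (Set.Icc c d) ∧
    W.DifferOnlyIn (Set.Icc a b ∪ Set.Icc c d) K K' ∧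
    W.IsStrand K a b ∧ W.IsStrand K c d ∧ W.IsStrand K' a b ∧ W.IsStrand K' c d ∧
    (∃ s t s' t' : ℝ, crossingsBetween K a b c d = {(s, t), (s', t')} ∧
      0 < planeDet (K.velocity s) (K.velocity t) ∧
      planeDet (K.velocity s') (K.velocity t') < 0 ∧
      K.isOver s = true ∧ K.isOver s' = true) ∧
    crossingsBetween K' a b c d = ∅

/-- The strand `[a,b]` has exactly one crossing with the strand `[c,d]`, and lies over it. -/
def CrossesOnceOver (K : BiframedDiagram) (a b c d : ℝ) : Prop :=
  ∃ s t : ℝ, crossingsBetween K a b c d = {(s, t)} ∧ K.isOver s = true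

/-- The third Reidemeister move: in a window there are three strands, of any orientations, a top
one, a middle one and a bottom one, that cross pairwise exactly once, both before and after the
move. -/
def MoveR3 (K K' : BiframedDiagram) : Prop :=
  ∃ (W : Window) (a b c d e f : ℝ), Disjoint (Set.Icc a b) (Set.Icc c d) ∧
    Disjoint (Set.Icc a b) (Set.Icc e f) ∧ Disjoint (Set.Icc c d) (Set.Icc e f) ∧
    W.DifferOnlyIn (Set.Icc a b ∪ Set.Icc c d ∪ Set.Icc e f) K K' ∧
    ∀ L ∈ ({K, K'} : Set BiframedDiagram),
      W.IsStrand L a b ∧ W.IsStrand L c d ∧ W.IsStrand L e f ∧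
      CrossesOnceOver L a b c d ∧ CrossesOnceOver L a b e f ∧ CrossesOnceOver L c d e f

/-- One step in the equivalence of biframed planar knotoid diagrams. -/
inductive BiframedStep : BiframedDiagram → BiframedDiagram → Prop
  | isotopy {K K' : BiframedDiagram} : AmbientIsotopic K K' → BiframedStep K K'
  | reparam {K K' : BiframedDiagram} : Reparametrized K K' → BiframedStep K K'
  | r1' {K K' : BiframedDiagram} : MoveR1' K K' → BiframedStep K K'
  | r2 {K K' : BiframedDiagram} : MoveR2 K K' → BiframedStep K K'
  | r3 {K K' : BiframedDiagram} : MoveR3 K K' → BiframedStep K K'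

/-- The equivalence relation generated by the steps. -/
instance biframedSetoid : Setoid BiframedDiagram := Relation.EqvGen.setoid BiframedStep

/-- Oriented biframed planar knotoids. -/
def BiframedKnotoid : Type := Quotient biframedSetoid

/-! ## The universal quantum invariant on decomposed diagrams -/

/-- A diagram is decomposed (by horizontal lines and vertical cuts) into compositions and tensor
products of the elementary pieces -- vertical strands, crossings of two non-horizontal strands,
caps, cups, the leg and the head -- when its height function is Morse and no tangent at a crossing
is horizontal. -/
structure BiframedDiagram.IsDecomposed (K : BiframedDiagram) : Prop where
  finite_bends : {t | t ∈ Set.Icc (0 : ℝ) 1 ∧ (K.velocity t).im = 0}.Finite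
  nondegenerate : ∀ t ∈ Set.Icc (0 : ℝ) 1, (K.velocity t).im = 0 → (K.acceleration t).im ≠ 0
  crossing_not_horizontal : ∀ t, K.IsCrossingTime t → (K.velocity t).im ≠ 0

open Classical in
/-- The times at which the diagram runs through a crossing, a cap or a cup. -/
def BiframedDiagram.eventTimes (K : BiframedDiagram) (hK : K.IsDecomposed) : Finset ℝ :=
  K.crossings.image Prod.fst ∪ K.crossings.image Prod.snd ∪ hK.finite_bends.toFinset

/-- The vector or its opposite, whichever points downwards. -/
def turnedDown (z : ℂ) : ℂ := if z.im < 0 then z else -z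

open Classical in
/-- The picture of a crossing, regardless of orientations: `true` if the over-strand goes from the
top right to the bottom left (this is the positive crossing if both strands are directed downwards),
`false` if it goes from the top left to the bottom right. -/
def BiframedDiagram.crossingType (K : BiframedDiagram) (c : ℝ × ℝ) : Bool :=
  decide (0 < planeDet (turnedDown (K.velocity c.1)) (turnedDown (K.velocity c.2)))

namespace RibbonStructure

variable {k A : Type*} [CommRing k] [Ring A] [HopfAlgebra k A]

/-- The tensor placed on a crossing: `R` or `R⁻¹` according to the type. -/
def crossingTensor (H : RibbonStructure k A) (type : Bool) : A ⊗[k] A :=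
  if type then (H.R : A ⊗[k] A) else ((H.R⁻¹ : (A ⊗[k] A)ˣ) : A ⊗[k] A)

/-- The element `x` is placed on a strand at a crossing as it is if the strand is directed
downwards, and as `S(x)` if it is directed upwards. -/
def strandValue (_H : RibbonStructure k A) (velocity : ℂ) (x : A) : A :=
  if velocity.im < 0 then x else HopfAlgebra.antipode k x

/-- The element placed on a cap or cup: `u v⁻¹` on a cap (maximum) that is run through from right
to left, `v u⁻¹` on a cup (minimum) that is run through from right to left, and `1` on caps and
cups that are run through from left to right. -/
def bendValue (H : RibbonStructure k A) (velocity acceleration : ℂ) : A :=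
  if velocity.re < 0 then
    if acceleration.im < 0 then H.u * Ring.inverse H.v else H.v * Ring.inverse H.u
  else 1

open Classical in
/-- The element of `A` met at time `t`, once a summand `σ c` of the tensor at each crossing `c` has
been selected.  The first factor of the tensor is on the over-strand, the second one on the
under-strand. -/
def label (H : RibbonStructure k A) (E : ∀ type : Bool, TensorExpansion (H.crossingTensor type))
    (K : BiframedDiagram)
    (σ : ∀ c : K.crossings, Fin (E (K.crossingType c)).size) (t : ℝ) : A :=
  if h : ∃ c : K.crossings, c.1.1 = t then
    H.strandValue (K.velocity t) ((E (K.crossingType h.choose)).fst (σ h.choose))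
  else if h : ∃ c : K.crossings, c.1.2 = t then
    H.strandValue (K.velocity t) ((E (K.crossingType h.choose)).snd (σ h.choose))
  else H.bendValue (K.velocity t) (K.acceleration t)

/-- The value of the universal quantum invariant on a decomposed diagram, computed with given
expansions of `R` and `R⁻¹` as sums of pure tensors: the elements placed on the diagram are
multiplied in the order in which they are met from the leg to the head, and the result is summed
over all the indices of the copies of `R` and `R⁻¹`. -/
def evaluate (H : RibbonStructure k A)
    (E : ∀ type : Bool, TensorExpansion (H.crossingTensor type))
    (K : BiframedDiagram) (hK : K.IsDecomposed) : A :=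
  ∑ σ : (∀ c : K.crossings, Fin (E (K.crossingType c)).size),
    (((K.eventTimes hK).sort (· ≤ ·)).map (H.label E K σ)).prod

end RibbonStructure

end

/-! The definition of the invariant refers to caps and cups, and these are created and destroyed by
isotopies. The proof replaces them by data that exist for every diagram, in general position or not.
The direction of the velocity is lifted to a continuous `angle` starting at -π/2. The angle from the
over-strand to the under-strand of a crossing, rounded down to a multiple of π, is an integer, the
`level`; the angle at the head gives an integer, the `rotation`. With G = u v⁻¹, the `value` of a
diagram puts αᵢ on each over-passage and S^level(βᵢ) on each under-passage, multiplies in the order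
of time, sums over the indices, and multiplies by G^rotation at the end.

Two facts about the algebra identify `value` with the invariant on decomposed diagrams
(`evaluate_eq_value`). First, S² is conjugation with the unit u (Drinfeld), hence also with G, as v
is central; in particular S is bijective and has integral powers. When the factors G, G⁻¹ of the
bends are pushed to the end of the product (`ordProd_bends`), they conjugate the beads that they
pass, and the S⁰ or S¹ given by the orientation of a strand becomes Sⁿ, where n counts the
half-turns made so far. Second, (S ⊗ S)R = R and R⁻¹ = (S ⊗ id)R. So (Sᵃ ⊗ Sᵇ)R depends only on b -
a, the tensor R⁻¹ is the case b - a = -1 (`map_levelTensor`, `levelTensor_neg_one`), and the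
exponents at a crossing may be changed to 0 and the level (`floor_sub_div_pi`). A state sum is
linear in the tensor at each crossing, so the chosen expansions do not matter
(`sum_congr_of_bilinear`).

It remains to see that `value` is invariant. Under an ambient isotopy the two tangents at a crossing
stay independent and the tangent at the head stays vertical, so the integers `level` and `rotation`
are constant by continuity. For R2 and R3, half-turns are counted relative to the window. On each
strand one power Sⁿ can be taken out of the product; for an upward strand n is odd, and the reversal
of products by Sⁿ cancels the reversed order of time. Orientations disappear in this way: R2 becomes
R R⁻¹ = 1 and R3 becomes the Yang-Baxter equation with some of its factors inverted
(`exists_braidTensor_eq`). Elementary plane geometry (`Window.IsStrand.re_lt_re_iff`,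
`Window.IsStrand.relations`) shows which signs and orders of the three crossings can occur together.
For R1', the two curls have the values u and S(u), or the inverses of these, and u S(u)⁻¹ = G²
because v² = S(u)u. After the curl the two angles differ by 4π, which conjugates all later beads
with G² and changes the rotation by 2; these three changes cancel.

Uniqueness holds because every diagram is isotopic to a decomposed one: by Sard's theorem almost
every shear that keeps the vertical direction will do (`exists_shear_isDecomposed`). -/

noncomputable section

/-! ### Quasitriangular Hopf algebras: antipode and R-matrix, the element u, Yang-Baxter. -/

open HopfAlgebra Coalgebra

namespace QuasitriangularStructure

variable {k A : Type*} [CommRing k] [Ring A] [HopfAlgebra k A]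

lemma leg13_eq_map (x : A ⊗[k] A) :
    leg13 k x = Algebra.TensorProduct.map (AlgHom.id k A)
      (Algebra.TensorProduct.includeRight : A →ₐ[k] A ⊗[k] A) x := by
  induction x with
  | zero => simp [leg13]
  | tmul a b => simp [leg13]
  | add x y hx hy => rw [map_add, ← hx, ← hy]; simp [leg13]

lemma leg12_mul (x y : A ⊗[k] A) : leg12 k (x * y) = leg12 k x * leg12 k y := by
  have : ∀ z : A ⊗[k] A, leg12 k z = Algebra.TensorProduct.assoc k k k A A A
      ((Algebra.TensorProduct.includeLeft : A ⊗[k] A →ₐ[k] (A ⊗[k] A) ⊗[k] A) z) := fun z => rfl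
  simp only [this, map_mul]

lemma leg12_one : leg12 k (1 : A ⊗[k] A) = 1 := by
  simp [leg12, Algebra.TensorProduct.one_def]

lemma leg13_mul (x y : A ⊗[k] A) : leg13 k (x * y) = leg13 k x * leg13 k y := by
  simp only [leg13_eq_map, map_mul]

lemma leg13_one : leg13 k (1 : A ⊗[k] A) = 1 := by
  simp only [leg13_eq_map, map_one]

lemma leg23_mul (x y : A ⊗[k] A) : leg23 k (x * y) = leg23 k x * leg23 k y := by
  simp [leg23]

lemma leg23_one : leg23 k (1 : A ⊗[k] A) = 1 := rfl

variable (H : QuasitriangularStructure k A)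

/-- `(ε ⊗ id) R = 1`. -/
lemma counit_left : TensorProduct.lid k A ((counit (R := k) (A := A)).rTensor A (H.R : A ⊗[k] A)) = 1 := by
  set f : A ⊗[k] A →ₐ[k] A := (Algebra.TensorProduct.lid k A : k ⊗[k] A →ₐ[k] A).comp
    (Algebra.TensorProduct.map (Bialgebra.counitAlgHom k A) (AlgHom.id k A)) with hf
  set F : A ⊗[k] (A ⊗[k] A) →ₐ[k] A ⊗[k] A :=
    (Algebra.TensorProduct.lid k (A ⊗[k] A) : k ⊗[k] (A ⊗[k] A) →ₐ[k] A ⊗[k] A).comp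
    (Algebra.TensorProduct.map (Bialgebra.counitAlgHom k A) (AlgHom.id k (A ⊗[k] A))) with hF
  have hfe : ∀ x : A ⊗[k] A,
      TensorProduct.lid k A ((counit (R := k) (A := A)).rTensor A x) = f x := by
    intro x
    induction x with
    | zero => simp
    | tmul a b => simp [hf]
    | add x y hx hy => simp only [map_add, hx, hy]
  have h1 : ∀ x : A ⊗[k] A, F (leg13 k x) = 1 ⊗ₜ f x := by
    intro x
    induction x with
    | zero => simp [leg13]
    | tmul a b => simp [leg13, hF, hf]
    | add x y hx hy =>
      rw [map_add, TensorProduct.tmul_add, ← hx, ← hy, ← map_add]; simp [leg13]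
  have h2 : ∀ x : A ⊗[k] A, F (leg23 k x) = x := by
    intro x; simp [leg23, hF]
  have h3 : ∀ x : A ⊗[k] A, F (TensorProduct.assoc k A A A
      ((comul (R := k) (A := A)).rTensor A x)) = x := by
    intro x
    induction x with
    | zero => simp
    | tmul a b =>
      have : ∀ y : A ⊗[k] A, F (TensorProduct.assoc k A A A (y ⊗ₜ b)) =
          (TensorProduct.lid k A ((counit (R := k) (A := A)).rTensor A y)) ⊗ₜ b := by
        intro y
        induction y with
        | zero => simp
        | tmul c d => simp [hF, TensorProduct.smul_tmul']
        | add x y hx hy => simp only [TensorProduct.add_tmul, map_add, hx, hy]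
      simp only [LinearMap.rTensor_tmul]
      rw [this]
      simp
    | add x y hx hy => simp only [map_add, hx, hy]
  -- Applying ε ⊗ id ⊗ id to (Δ ⊗ id)R = R₁₃R₂₃ gives R = (1 ⊗ f(R)) R, and R can be cancelled.
  have h := congrArg F H.comul_left
  rw [h3, map_mul, h1, h2] at h
  have h4 : (1 : A) ⊗ₜ[k] f (H.R : A ⊗[k] A) = 1 := by
    have := congrArg (· * ((H.R⁻¹ : (A ⊗[k] A)ˣ) : A ⊗[k] A)) h
    simp only [mul_assoc, Units.mul_inv, mul_one] at this
    exact this.symm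
  have h5 := congrArg f h4
  rw [map_one] at h5
  rw [hfe]
  simpa [hf] using h5

/-- `(id ⊗ ε) R = 1`. -/
lemma counit_right : TensorProduct.rid k A ((counit (R := k) (A := A)).lTensor A (H.R : A ⊗[k] A)) = 1 := by
  set f : A ⊗[k] A →ₐ[k] A := (Algebra.TensorProduct.rid k k A : A ⊗[k] k →ₐ[k] A).comp
    (Algebra.TensorProduct.map (AlgHom.id k A) (Bialgebra.counitAlgHom k A)) with hf
  set F : A ⊗[k] (A ⊗[k] A) →ₐ[k] A ⊗[k] A :=
    (Algebra.TensorProduct.map (AlgHom.id k A) f) with hF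
  have hfe : ∀ x : A ⊗[k] A,
      TensorProduct.rid k A ((counit (R := k) (A := A)).lTensor A x) = f x := by
    intro x
    induction x with
    | zero => simp
    | tmul a b => simp [hf]
    | add x y hx hy => simp only [map_add, hx, hy]
  have h1 : ∀ x : A ⊗[k] A, F (leg13 k x) = f x ⊗ₜ 1 := by
    intro x
    induction x with
    | zero => simp [leg13]
    | tmul a b => simp [leg13, hF, hf, TensorProduct.smul_tmul]
    | add x y hx hy =>
      rw [map_add, TensorProduct.add_tmul, ← hx, ← hy, ← map_add]; simp [leg13]
  have h2 : ∀ x : A ⊗[k] A, F (leg12 k x) = x := by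
    intro x
    induction x with
    | zero => simp [leg12]
    | tmul a b => simp [leg12, hF, hf]
    | add x y hx hy => nth_rw 2 [← hx, ← hy]; rw [← map_add]; simp [leg12, TensorProduct.add_tmul]
  have h3 : ∀ x : A ⊗[k] A, F ((comul (R := k) (A := A)).lTensor A x) = x := by
    intro x
    induction x with
    | zero => simp
    | tmul a b =>
      simp only [LinearMap.lTensor_tmul, hF, Algebra.TensorProduct.map_tmul, AlgHom.id_apply]
      rw [← hfe]; simp
    | add x y hx hy => simp only [map_add, hx, hy]
  have h := congrArg F H.comul_right
  rw [h3, map_mul, h1, h2] at h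
  have h4 : f (H.R : A ⊗[k] A) ⊗ₜ[k] (1 : A) = 1 := by
    have := congrArg (· * ((H.R⁻¹ : (A ⊗[k] A)ˣ) : A ⊗[k] A)) h
    simp only [mul_assoc, Units.mul_inv, mul_one] at this
    exact this.symm
  have h5 := congrArg f h4
  rw [map_one] at h5
  rw [hfe]
  simpa [hf] using h5

/-- `(S ⊗ id) R = R⁻¹`. -/
lemma antipode_rTensor_R : (antipode k (A := A)).rTensor A (H.R : A ⊗[k] A) =
    ((H.R⁻¹ : (A ⊗[k] A)ˣ) : A ⊗[k] A) := by
  set μ : A ⊗[k] (A ⊗[k] A) →ₗ[k] A ⊗[k] A :=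
    (LinearMap.mul' k A).rTensor A ∘ₗ (TensorProduct.assoc k A A A).symm.toLinearMap ∘ₗ
      (antipode k (A := A)).rTensor (A ⊗[k] A) with hμ
  have h1 : ∀ x y : A ⊗[k] A, μ (leg13 k x * leg23 k y) =
      (antipode k (A := A)).rTensor A x * y := by
    intro x y
    induction x with
    | zero => simp [leg13]
    | tmul a b =>
      induction y with
      | zero => simp [leg23]
      | tmul c d => simp [leg13, leg23, hμ]
      | add x y hx hy => rw [mul_add, ← hx, ← hy, ← map_add, ← mul_add]; simp [leg23, TensorProduct.tmul_add]
    | add x y hx hy =>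
      rw [map_add, add_mul, ← hx, ← hy, ← map_add, ← add_mul]; simp [leg13]
  have h2 : ∀ x : A ⊗[k] A, μ (TensorProduct.assoc k A A A
      ((comul (R := k) (A := A)).rTensor A x)) =
      1 ⊗ₜ (TensorProduct.lid k A ((counit (R := k) (A := A)).rTensor A x)) := by
    intro x
    induction x with
    | zero => simp
    | tmul a b =>
      have : ∀ y : A ⊗[k] A, μ (TensorProduct.assoc k A A A (y ⊗ₜ b)) =
          (LinearMap.mul' k A ((antipode k (A := A)).rTensor A y)) ⊗ₜ b := by
        intro y
        induction y with
        | zero => simp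
        | tmul c d => simp [hμ]
        | add x y hx hy => simp only [TensorProduct.add_tmul, map_add, hx, hy]
      simp only [LinearMap.rTensor_tmul]
      rw [this]
      simp [Algebra.algebraMap_eq_smul_one, TensorProduct.smul_tmul]
    | add x y hx hy => simp only [map_add, hx, hy, TensorProduct.tmul_add]
  -- The map μ is a ⊗ b ⊗ c ↦ S(a)b ⊗ c. The antipode axiom and `counit_left` collapse (Δ ⊗ id)R to
  -- 1, while R₁₃R₂₃ goes to ((S ⊗ id)R) R.
  have h := congrArg μ H.comul_left
  rw [h1, h2, counit_left] at h
  exact (Units.mul_eq_one_iff_eq_inv (u := H.R)).1 h.symm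

/-- The antipode as an algebra homomorphism to the opposite algebra. -/
def antipodeOp (k A : Type*) [CommRing k] [Ring A] [HopfAlgebra k A] : A →ₐ[k] Aᵐᵒᵖ :=
  AlgHom.ofLinearMap ((MulOpposite.opLinearEquiv k).toLinearMap ∘ₗ antipode k (A := A))
    (by simp) (fun x y => by simp [antipode_mul_antidistrib])

lemma antipodeOp_apply (x : A) : antipodeOp k A x = MulOpposite.op (antipode k x) := rfl

/-- `id ⊗ S` as an algebra homomorphism `A ⊗ A → A ⊗ Aᵒᵖ`. -/
def idAntipodeOp (k A : Type*) [CommRing k] [Ring A] [HopfAlgebra k A] :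
    A ⊗[k] A →ₐ[k] A ⊗[k] Aᵐᵒᵖ :=
  Algebra.TensorProduct.map (AlgHom.id k A) (antipodeOp k A)

/-- The linear identification of `A ⊗ A` with `A ⊗ Aᵒᵖ`. -/
def idOp (k A : Type*) [CommRing k] [Ring A] [Algebra k A] : A ⊗[k] A ≃ₗ[k] A ⊗[k] Aᵐᵒᵖ :=
  LinearEquiv.lTensor A (MulOpposite.opLinearEquiv k)

lemma idAntipodeOp_eq (x : A ⊗[k] A) :
    idAntipodeOp k A x = idOp k A ((antipode k (A := A)).lTensor A x) := by
  induction x with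
  | zero => simp
  | tmul a b => simp [idAntipodeOp, idOp, antipodeOp_apply]
  | add x y hx hy => simp only [map_add, hx, hy]

/-- Applying a ⊗ b ⊗ c ↦ a ⊗ S(b)c to (id ⊗ Δ)R = R₁₃R₁₂ gives ∑ αᵢαⱼ ⊗ S(βⱼ)βᵢ = 1. The second
factors appear in the reversed order, so this is a product in A ⊗ Aᵒᵖ and not in A ⊗ A. -/
lemma idOp_mul_idAntipodeOp :
    idOp k A (H.R : A ⊗[k] A) * idAntipodeOp k A (H.R : A ⊗[k] A) = 1 := by
  set μ : A ⊗[k] (A ⊗[k] A) →ₗ[k] A ⊗[k] A :=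
    (LinearMap.mul' k A ∘ₗ (antipode k (A := A)).rTensor A).lTensor A with hμ
  have h1 : ∀ x y : A ⊗[k] A, idOp k A (μ (leg13 k x * leg12 k y)) =
      idOp k A x * idAntipodeOp k A y := by
    intro x y
    induction x with
    | zero => simp [leg13]
    | tmul a b =>
      induction y with
      | zero => simp [leg12]
      | tmul c d => simp [leg13, leg12, hμ, idOp, idAntipodeOp, antipodeOp_apply]
      | add x y hx hy =>
        rw [map_add, mul_add, ← hx, ← hy, ← map_add, ← map_add, ← mul_add]
        simp [leg12, TensorProduct.add_tmul]
    | add x y hx hy =>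
      rw [map_add, add_mul, ← hx, ← hy, ← map_add, ← map_add, ← add_mul]; simp [leg13]
  have h2 : ∀ x : A ⊗[k] A, μ ((comul (R := k) (A := A)).lTensor A x) =
      (TensorProduct.rid k A ((counit (R := k) (A := A)).lTensor A x)) ⊗ₜ 1 := by
    intro x
    induction x with
    | zero => simp
    | tmul a b =>
      simp [hμ, Algebra.algebraMap_eq_smul_one, TensorProduct.smul_tmul]
    | add x y hx hy => simp only [map_add, hx, hy, TensorProduct.add_tmul]
  have h := congrArg (fun z => idOp k A (μ z)) H.comul_right
  simp only [h1, h2, counit_right] at h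
  rw [← h]; simp [idOp, Algebra.TensorProduct.one_def]

/-- Since `idAntipodeOp` is multiplicative, R⁻¹ goes to a right inverse of the image of R, and this
coincides with the left inverse found before. The bijectivity of S, which is not available yet, is
avoided. -/
lemma idAntipodeOp_R_inv :
    idAntipodeOp k A ((H.R⁻¹ : (A ⊗[k] A)ˣ) : A ⊗[k] A) = idOp k A (H.R : A ⊗[k] A) := by
  have h1 : idAntipodeOp k A (H.R : A ⊗[k] A) *
      idAntipodeOp k A ((H.R⁻¹ : (A ⊗[k] A)ˣ) : A ⊗[k] A) = 1 := by
    rw [← map_mul, Units.mul_inv, map_one]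
  exact (left_inv_eq_right_inv H.idOp_mul_idAntipodeOp h1).symm

/-- `(id ⊗ S) R⁻¹ = R`. -/
lemma antipode_lTensor_R_inv : (antipode k (A := A)).lTensor A
    ((H.R⁻¹ : (A ⊗[k] A)ˣ) : A ⊗[k] A) = (H.R : A ⊗[k] A) := by
  apply (idOp k A).injective
  rw [← idAntipodeOp_eq, idAntipodeOp_R_inv]

/-- `(S ⊗ S) R = R`. -/
lemma antipode_map_R : TensorProduct.map (antipode k (A := A)) (antipode k (A := A))
    (H.R : A ⊗[k] A) = (H.R : A ⊗[k] A) := by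
  conv_rhs => rw [← H.antipode_lTensor_R_inv, ← H.antipode_rTensor_R]
  rw [← LinearMap.comp_apply, LinearMap.lTensor_comp_rTensor]

lemma idAntipodeOp_mul_idOp :
    idAntipodeOp k A (H.R : A ⊗[k] A) * idOp k A (H.R : A ⊗[k] A) = 1 := by
  rw [← H.idAntipodeOp_R_inv, ← map_mul, Units.mul_inv, map_one]

/-- `∑ S(βᵢ) αᵢ`, for an arbitrary tensor `∑ αᵢ ⊗ βᵢ`. -/
def drinfeld (k A : Type*) [CommRing k] [Ring A] [HopfAlgebra k A] : A ⊗[k] A →ₗ[k] A :=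
  LinearMap.mul' k A ∘ₗ (antipode k (A := A)).rTensor A ∘ₗ (TensorProduct.comm k A A).toLinearMap

lemma drinfeld_tmul (a b : A) : drinfeld k A (a ⊗ₜ b) = antipode k b * a := by
  simp [drinfeld]

lemma u_eq : H.u = drinfeld k A (H.R : A ⊗[k] A) := rfl

/-- The linear map `(p ⊗ q) ⊗ r ↦ S²(r) S(q) p`. -/
def twistedDrinfeld (k A : Type*) [CommRing k] [Ring A] [HopfAlgebra k A] :
    (A ⊗[k] A) ⊗[k] A →ₗ[k] A :=
  LinearMap.mul' k A ∘ₗ (TensorProduct.comm k A A).toLinearMap ∘ₗ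
    TensorProduct.map (drinfeld k A) (antipode k (A := A) ∘ₗ antipode k (A := A))

lemma twistedDrinfeld_tmul (y : A ⊗[k] A) (c : A) : twistedDrinfeld k A (y ⊗ₜ c) =
    antipode k (antipode k c) * drinfeld k A y := by
  simp [twistedDrinfeld]

/-- First half of Drinfeld's computation: for P = p ⊗ q the expression is S²(x₃) S(q x₂) p x₁ = S(x₂
S(x₃)) S(q) p x₁, and x₂ S(x₃) collapses to a counit. -/
lemma twistedDrinfeld_left (P : A ⊗[k] A) (x : A) :
    twistedDrinfeld k A ((P ⊗ₜ[k] (1 : A)) * (TensorProduct.assoc k A A A).symm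
      ((comul (R := k) (A := A)).lTensor A (comul (R := k) x))) = drinfeld k A P * x := by
  have h1 : ∀ (a : A) (y : A ⊗[k] A), twistedDrinfeld k A ((P ⊗ₜ[k] (1 : A)) *
      (TensorProduct.assoc k A A A).symm (a ⊗ₜ y)) =
      antipode k (LinearMap.mul' k A ((antipode k (A := A)).lTensor A y)) * drinfeld k A P * a := by
    intro a y
    induction y with
    | zero => simp
    | tmul b c =>
      induction P with
      | zero => simp
      | tmul p q => simp [twistedDrinfeld_tmul, drinfeld_tmul, antipode_mul_antidistrib, mul_assoc]
      | add x y hx hy =>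
        simp only [TensorProduct.add_tmul, add_mul, map_add, hx, hy, mul_add]
    | add x y hx hy => simp only [TensorProduct.tmul_add, map_add, mul_add, hx, hy, add_mul]
  have h2 : ∀ z : A ⊗[k] A, twistedDrinfeld k A ((P ⊗ₜ[k] (1 : A)) *
      (TensorProduct.assoc k A A A).symm ((comul (R := k) (A := A)).lTensor A z)) =
      drinfeld k A P * TensorProduct.rid k A ((counit (R := k) (A := A)).lTensor A z) := by
    intro z
    induction z with
    | zero => simp
    | tmul a b =>
      rw [LinearMap.lTensor_tmul, h1]
      simp [Algebra.algebraMap_eq_smul_one]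
    | add x y hx hy => simp only [map_add, mul_add, hx, hy]
  rw [h2]; simp

/-- Second half: with the opposite coproduct the expression is S²(x₃) S(β) S(x₁) x₂ α, and now S(x₁)
x₂ collapses. For P = R both halves evaluate the same element, by R Δ = Δᵒᵖ R and coassociativity.
-/
lemma twistedDrinfeld_right (P : A ⊗[k] A) (x : A) :
    twistedDrinfeld k A (
      ((TensorProduct.comm k A A).toLinearMap ∘ₗ comul (R := k) (A := A)).rTensor A
        (comul (R := k) x) * (P ⊗ₜ[k] (1 : A))) = antipode k (antipode k x) * drinfeld k A P := by
  have h1 : ∀ (α β c : A) (y : A ⊗[k] A), drinfeld k A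
      ((TensorProduct.comm k A A y) * (α ⊗ₜ[k] β)) =
      antipode k β * LinearMap.mul' k A ((antipode k (A := A)).rTensor A y) * α := by
    intro α β c y
    induction y with
    | zero => simp
    | tmul p q => simp [drinfeld_tmul, antipode_mul_antidistrib, mul_assoc]
    | add x y hx hy => simp only [map_add, mul_add, hx, hy, add_mul]
  induction P with
  | zero => simp
  | tmul α β =>
    have h2 : ∀ z : A ⊗[k] A, twistedDrinfeld k A (
        ((TensorProduct.comm k A A).toLinearMap ∘ₗ comul (R := k) (A := A)).rTensor A z *
          ((α ⊗ₜ[k] β) ⊗ₜ[k] (1 : A))) = antipode k (antipode k (TensorProduct.lid k A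
            ((counit (R := k) (A := A)).rTensor A z))) * (antipode k β * α) := by
      intro z
      induction z with
      | zero => simp
      | tmul a b =>
        simp only [LinearMap.rTensor_tmul, LinearMap.comp_apply, LinearEquiv.coe_coe,
          Algebra.TensorProduct.tmul_mul_tmul, mul_one, twistedDrinfeld_tmul, h1 α β b]
        simp [Algebra.algebraMap_eq_smul_one]
      | add x y hx hy => simp only [map_add, add_mul, hx, hy]
    rw [h2, drinfeld_tmul]; simp
  | add x y hx hy => simp only [TensorProduct.add_tmul, mul_add, map_add, hx, hy]

/-- `u x = S²(x) u`. -/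
lemma u_mul (x : A) : H.u * x = antipode k (antipode k x) * H.u := by
  rw [u_eq, ← twistedDrinfeld_left, ← twistedDrinfeld_right]
  congr 1
  have h1 : ∀ z : A ⊗[k] A, ((H.R : A ⊗[k] A) ⊗ₜ[k] (1 : A)) *
      (comul (R := k) (A := A)).rTensor A z =
      ((TensorProduct.comm k A A).toLinearMap ∘ₗ comul (R := k) (A := A)).rTensor A z *
        ((H.R : A ⊗[k] A) ⊗ₜ[k] (1 : A)) := by
    intro z
    induction z with
    | zero => simp
    | tmul a b =>
      simp only [LinearMap.rTensor_tmul, Algebra.TensorProduct.tmul_mul_tmul, one_mul, mul_one,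
        LinearMap.comp_apply, LinearEquiv.coe_coe, ← H.conj_comul, Units.inv_mul_cancel_right]
    | add x y hx hy => simp only [map_add, add_mul, mul_add, hx, hy]
  rw [← h1, ← Coalgebra.coassoc_apply, LinearEquiv.symm_apply_apply]

/-- The element `∑ βᵢ S²(αᵢ)`, which turns out to be the inverse of `u`. -/
def uInv (H : QuasitriangularStructure k A) : A :=
  LinearMap.mul' k A (TensorProduct.comm k A A
    ((antipode k (A := A) ∘ₗ antipode k (A := A)).rTensor A (H.R : A ⊗[k] A)))

/-- The linear map `a ⊗ b ↦ b a` on `A ⊗ Aᵒᵖ`. -/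
def mulFlip (k A : Type*) [CommRing k] [Ring A] [Algebra k A] : A ⊗[k] Aᵐᵒᵖ →ₗ[k] A :=
  LinearMap.mul' k A ∘ₗ (TensorProduct.comm k A A).toLinearMap ∘ₗ (idOp k A).symm.toLinearMap

lemma mulFlip_tmul (a : A) (b : Aᵐᵒᵖ) : mulFlip k A (a ⊗ₜ b) = b.unop * a := by
  simp [mulFlip, idOp]

/-- For x = a ⊗ b and y = c ⊗ d both sides are b S(d) c a. With x = y = R the product in A ⊗ Aᵒᵖ is
1, so this is what makes u invertible. -/
lemma mul_drinfeld_mul (x y : A ⊗[k] A) :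
    LinearMap.mul' k A (TensorProduct.comm k A A
      ((LinearMap.mulLeft k (drinfeld k A y)).rTensor A x)) =
    mulFlip k A (idAntipodeOp k A y * idOp k A x) := by
  induction x with
  | zero => simp
  | tmul a b =>
    induction y with
    | zero => simp
    | tmul c d =>
      simp [drinfeld_tmul, idOp, idAntipodeOp, mulFlip_tmul, antipodeOp_apply, mul_assoc]
    | add x y hx hy =>
      simp only [map_add, add_mul, ← hx, ← hy]
      simp [mul_add, add_mul]
  | add x y hx hy => simp only [map_add, mul_add, hx, hy]

/-- By `u_mul`, ∑ βᵢ S²(αᵢ) u = ∑ βᵢ u αᵢ, and `mul_drinfeld_mul` evaluates the latter. -/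
lemma uInv_mul_u : H.uInv * H.u = 1 := by
  have h1 : ∀ x : A ⊗[k] A, LinearMap.mul' k A (TensorProduct.comm k A A
    ((antipode k (A := A) ∘ₗ antipode k (A := A)).rTensor A x)) * H.u =
      LinearMap.mul' k A (TensorProduct.comm k A A
      ((LinearMap.mulLeft k (H.u)).rTensor A x)) := by
    intro x
    induction x with
    | zero => simp
    | tmul a b => simp [mul_assoc, H.u_mul]
    | add x y hx hy => simp only [map_add, add_mul, hx, hy]
  rw [uInv, h1, u_eq, mul_drinfeld_mul, idAntipodeOp_mul_idOp,
    Algebra.TensorProduct.one_def, mulFlip_tmul]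
  simp

/-- Moving u to the right past βᵢ turns the sum into ∑ S²(βᵢ) u S²(αᵢ). As S² ⊗ S² fixes R, this is
again ∑ βᵢ u αᵢ. -/
lemma u_mul_uInv : H.u * H.uInv = 1 := by
  have h1 : ∀ x : A ⊗[k] A, H.u * LinearMap.mul' k A (TensorProduct.comm k A A
      ((antipode k (A := A) ∘ₗ antipode k (A := A)).rTensor A x)) =
      LinearMap.mul' k A (TensorProduct.comm k A A
      ((LinearMap.mulLeft k (H.u)).rTensor A (TensorProduct.map (antipode k (A := A))
        (antipode k (A := A)) (TensorProduct.map (antipode k (A := A))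
        (antipode k (A := A)) x)))) := by
    intro x
    induction x with
    | zero => simp
    | tmul a b => simp [← mul_assoc, H.u_mul, antipode_mul_antidistrib]
    | add x y hx hy => simp only [map_add, mul_add, hx, hy]
  rw [uInv, h1, antipode_map_R, antipode_map_R, u_eq, mul_drinfeld_mul, idAntipodeOp_mul_idOp,
    Algebra.TensorProduct.one_def, mulFlip_tmul]
  simp

/-- `u` as a unit. -/
def uUnit (H : QuasitriangularStructure k A) : Aˣ := ⟨H.u, H.uInv, H.u_mul_uInv, H.uInv_mul_u⟩

@[simp] lemma coe_uUnit : (H.uUnit : A) = H.u := rfl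

lemma antipode_antipode (x : A) :
    antipode k (antipode k x) = H.u * x * ((H.uUnit⁻¹ : Aˣ) : A) := by
  rw [u_mul]
  exact (Units.mul_inv_cancel_right _ H.uUnit).symm

/-- The square of S is conjugation with a unit, hence bijective, and so S itself is. -/
lemma antipode_bijective (H : QuasitriangularStructure k A) :
    Function.Bijective (antipode k (A := A)) := by
  constructor
  · intro x y hxy
    have := congrArg (antipode k) hxy
    rw [H.antipode_antipode, H.antipode_antipode] at this
    exact H.uUnit.isUnit.mul_left_cancel ((H.uUnit⁻¹).isUnit.mul_right_cancel this)
  · intro y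
    refine ⟨antipode k (((H.uUnit⁻¹ : Aˣ) : A) * y * H.u), ?_⟩
    have h := H.uUnit.mul_inv
    rw [coe_uUnit] at h
    rw [H.antipode_antipode, mul_assoc, mul_assoc, h, mul_one, ← mul_assoc, h, one_mul]

/-- The antipode as a linear automorphism. -/
def antipodeEquiv (H : QuasitriangularStructure k A) : A ≃ₗ[k] A :=
  LinearEquiv.ofBijective (antipode k (A := A)) H.antipode_bijective

@[simp] lemma antipodeEquiv_apply (x : A) : H.antipodeEquiv x = antipode k x := rfl

/-- The Yang--Baxter equation. -/
lemma yang_baxter : leg12 k (H.R : A ⊗[k] A) * leg13 k (H.R : A ⊗[k] A) * leg23 k (H.R : A ⊗[k] A) =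
    leg23 k (H.R : A ⊗[k] A) * leg13 k (H.R : A ⊗[k] A) * leg12 k (H.R : A ⊗[k] A) := by
  set σ : A ⊗[k] (A ⊗[k] A) →ₐ[k] A ⊗[k] (A ⊗[k] A) :=
    ((Algebra.TensorProduct.assoc k k k A A A : _ →ₐ[k] _).comp
      (Algebra.TensorProduct.map (Algebra.TensorProduct.comm k A A : A ⊗[k] A →ₐ[k] A ⊗[k] A)
        (AlgHom.id k A))).comp
      ((Algebra.TensorProduct.assoc k k k A A A).symm : _ →ₐ[k] _) with hσ
  have h13 : ∀ x : A ⊗[k] A, σ (leg13 k x) = leg23 k x := by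
    intro x
    induction x with
    | zero => simp [leg13, leg23]
    | tmul a b => simp [leg13, leg23, hσ]
    | add x y hx hy =>
      simp only [leg13, leg23, map_add, TensorProduct.tmul_add] at *; rw [hx, hy]
  have h23 : ∀ x : A ⊗[k] A, σ (leg23 k x) = leg13 k x := by
    intro x
    induction x with
    | zero => simp [leg13, leg23]
    | tmul a b => simp [leg13, leg23, hσ]
    | add x y hx hy =>
      simp only [leg13, leg23, map_add, TensorProduct.tmul_add] at *; rw [hx, hy]
  have h1 : ∀ z : A ⊗[k] A, leg12 k (H.R : A ⊗[k] A) * TensorProduct.assoc k A A A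
      ((comul (R := k) (A := A)).rTensor A z) = σ (TensorProduct.assoc k A A A
      ((comul (R := k) (A := A)).rTensor A z)) * leg12 k (H.R : A ⊗[k] A) := by
    intro z
    induction z with
    | zero => simp
    | tmul a b =>
      have e : σ (TensorProduct.assoc k A A A (comul (R := k) a ⊗ₜ[k] b)) =
          TensorProduct.assoc k A A A (TensorProduct.comm k A A (comul (R := k) a) ⊗ₜ[k] b) := by
        change TensorProduct.assoc k A A A (Algebra.TensorProduct.map
          (Algebra.TensorProduct.comm k A A : A ⊗[k] A →ₐ[k] A ⊗[k] A) (AlgHom.id k A)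
          ((TensorProduct.assoc k A A A).symm (TensorProduct.assoc k A A A _))) = _
        rw [LinearEquiv.symm_apply_apply]
        rfl
      have m : ∀ x y : (A ⊗[k] A) ⊗[k] A, TensorProduct.assoc k A A A x *
          TensorProduct.assoc k A A A y = TensorProduct.assoc k A A A (x * y) := fun x y =>
        (map_mul (Algebra.TensorProduct.assoc k k k A A A) x y).symm
      rw [LinearMap.rTensor_tmul, e, leg12, m, m, ← H.conj_comul]
      simp only [Algebra.TensorProduct.tmul_mul_tmul, one_mul, mul_one, Units.inv_mul_cancel_right]
    | add x y hx hy => simp only [map_add, mul_add, add_mul, hx, hy]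
  -- This is R₁₂ (Δ ⊗ id)R = (Δᵒᵖ ⊗ id)R R₁₂. Expanding with `comul_left`, where σ exchanges the
  -- first two tensor factors and so turns R₁₃R₂₃ into R₂₃R₁₃, gives the equation.
  have h := h1 (H.R : A ⊗[k] A)
  rw [H.comul_left, map_mul, h13, h23] at h
  rw [mul_assoc, h]

end QuasitriangularStructure

end

/-! ### Powers of the antipode, the tensors (id ⊗ Sʲ)R, and the balancing element. -/

noncomputable section

open HopfAlgebra Coalgebra

namespace QuasitriangularStructure

variable {k A : Type*} [CommRing k] [Ring A] [HopfAlgebra k A] (H : QuasitriangularStructure k A)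

/-- The integral powers of the antipode. -/
def antipodePow (n : ℤ) : A ≃ₗ[k] A := H.antipodeEquiv ^ n

lemma antipodePow_zero (x : A) : H.antipodePow 0 x = x := by simp [antipodePow]

lemma antipodePow_one (x : A) : H.antipodePow 1 x = antipode k x := by simp [antipodePow]

lemma antipodePow_add (m n : ℤ) (x : A) :
    H.antipodePow (m + n) x = H.antipodePow m (H.antipodePow n x) := by
  simp [antipodePow, zpow_add]

lemma antipodePow_apply_one (n : ℤ) : H.antipodePow n (1 : A) = 1 := by
  have h : ∀ m : ℕ, H.antipodePow m (1 : A) = 1 := by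
    intro m
    induction m with
    | zero => exact H.antipodePow_zero 1
    | succ m ih =>
      rw [Nat.cast_succ, add_comm, antipodePow_add, ih, antipodePow_one, antipode_one]
  rcases Int.eq_nat_or_neg n with ⟨m, rfl | rfl⟩
  · exact h m
  · nth_rw 1 [← h m]
    rw [← antipodePow_add, neg_add_cancel, antipodePow_zero]

lemma antipodePow_even_odd_mul (m : ℕ) : ∀ x y : A,
    H.antipodePow (2 * m : ℤ) (x * y) = H.antipodePow (2 * m : ℤ) x * H.antipodePow (2 * m : ℤ) y := by
  induction m with
  | zero => intro x y; simp [antipodePow_zero]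
  | succ m ih =>
    intro x y
    have : (2 * ((m + 1 : ℕ) : ℤ)) = 1 + (1 + 2 * m) := by push_cast; ring
    simp only [this, antipodePow_add, ih, antipodePow_one, antipode_mul_antidistrib]

lemma antipodePow_mul_of_even {n : ℤ} (hn : Even n) (x y : A) :
    H.antipodePow n (x * y) = H.antipodePow n x * H.antipodePow n y := by
  obtain ⟨m, rfl⟩ := hn
  rw [← two_mul]
  rcases Int.eq_nat_or_neg m with ⟨m, rfl | rfl⟩
  · exact H.antipodePow_even_odd_mul m x y
  · have h := H.antipodePow_even_odd_mul m (H.antipodePow (2 * -(m : ℤ)) x)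
      (H.antipodePow (2 * -(m : ℤ)) y)
    have e : (2 * (m : ℤ)) + 2 * -(m : ℤ) = 0 := by ring
    apply (H.antipodePow (2 * (m : ℤ))).injective
    simp only [h, ← antipodePow_add, e, antipodePow_zero]

lemma antipodePow_mul_of_odd {n : ℤ} (hn : Odd n) (x y : A) :
    H.antipodePow n (x * y) = H.antipodePow n y * H.antipodePow n x := by
  obtain ⟨m, rfl⟩ := hn
  rw [antipodePow_add, antipodePow_add, antipodePow_add, antipodePow_one, antipodePow_one,
    antipodePow_one, antipode_mul_antidistrib, H.antipodePow_mul_of_even (even_two_mul m)]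

/-- The tensor `(id ⊗ Sʲ) R`. -/
def levelTensor (j : ℤ) : A ⊗[k] A := (H.antipodePow j).toLinearMap.lTensor A (H.R : A ⊗[k] A)

lemma levelTensor_zero : H.levelTensor 0 = (H.R : A ⊗[k] A) := by
  have : (H.antipodePow 0).toLinearMap = LinearMap.id := by ext x; exact H.antipodePow_zero x
  rw [levelTensor, this, LinearMap.lTensor_id, LinearMap.id_apply]

lemma map_one_one_levelTensor (j : ℤ) : TensorProduct.map (H.antipodePow 1).toLinearMap
    (H.antipodePow 1).toLinearMap (H.levelTensor j) = H.levelTensor j := by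
  have h1 : (H.antipodePow 1).toLinearMap = antipode k (A := A) := by
    ext x; exact H.antipodePow_one x
  have h2 : (H.antipodePow 1).toLinearMap ∘ₗ (H.antipodePow j).toLinearMap =
      (H.antipodePow j).toLinearMap ∘ₗ (H.antipodePow 1).toLinearMap := by
    ext x
    simp only [LinearMap.comp_apply, LinearEquiv.coe_coe, ← antipodePow_add, add_comm]
  rw [levelTensor, ← LinearMap.comp_apply, LinearMap.map_comp_lTensor, h2,
    ← LinearMap.lTensor_comp_map, LinearMap.comp_apply, h1, antipode_map_R]

/-- S ⊗ S fixes R and commutes with id ⊗ Sʲ. Negative a are reached by first writing the tensor as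
its own image under S ⊗ S. -/
lemma map_same_levelTensor (a j : ℤ) : TensorProduct.map (H.antipodePow a).toLinearMap
    (H.antipodePow a).toLinearMap (H.levelTensor j) = H.levelTensor j := by
  have key : ∀ (a b : ℤ) (x : A ⊗[k] A), TensorProduct.map (H.antipodePow (a + b)).toLinearMap
      (H.antipodePow (a + b)).toLinearMap x = TensorProduct.map (H.antipodePow a).toLinearMap
      (H.antipodePow a).toLinearMap (TensorProduct.map (H.antipodePow b).toLinearMap
      (H.antipodePow b).toLinearMap x) := by
    intro a b x
    rw [← LinearMap.comp_apply, ← TensorProduct.map_comp]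
    congr 2 <;> (ext y; exact H.antipodePow_add a b y)
  have h0 : ∀ x : A ⊗[k] A, TensorProduct.map (H.antipodePow 0).toLinearMap
      (H.antipodePow 0).toLinearMap x = x := by
    have : (H.antipodePow 0).toLinearMap = LinearMap.id := by ext x; exact H.antipodePow_zero x
    intro x; rw [this, TensorProduct.map_id, LinearMap.id_apply]
  induction a with
  | zero => exact h0 _
  | succ a ih => rw [key, map_one_one_levelTensor, ih]
  | pred a ih =>
    conv_lhs => rw [← H.map_one_one_levelTensor j]
    rw [← key, sub_add_cancel, ih]

/-- `(Sᵃ ⊗ Sᵇ) (id ⊗ Sʲ) R = (id ⊗ S^(j + b - a)) R`. -/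
lemma map_levelTensor (a b j : ℤ) : TensorProduct.map (H.antipodePow a).toLinearMap
    (H.antipodePow b).toLinearMap (H.levelTensor j) = H.levelTensor (j + b - a) := by
  conv_rhs => rw [← H.map_same_levelTensor a, levelTensor]
  rw [levelTensor, ← LinearMap.comp_apply, ← LinearMap.comp_apply, LinearMap.map_comp_lTensor,
    LinearMap.map_comp_lTensor]
  congr 2
  ext x
  simp only [LinearMap.comp_apply, LinearEquiv.coe_coe, ← antipodePow_add]
  congr 2; ring

/-- R⁻¹ = (S ⊗ id)R has exponents with difference 0 - 1. This lets one integer per crossing record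
both the type of the crossing and the directions of its strands. -/
lemma levelTensor_neg_one : H.levelTensor (-1) = ((H.R⁻¹ : (A ⊗[k] A)ˣ) : A ⊗[k] A) := by
  have h1 : (H.antipodePow 1).toLinearMap = antipode k (A := A) := by
    ext x; exact H.antipodePow_one x
  have h0 : (H.antipodePow 0).toLinearMap = LinearMap.id := by ext x; exact H.antipodePow_zero x
  have h := H.map_levelTensor 1 0 0
  rw [levelTensor_zero, h1, h0] at h
  rw [← antipode_rTensor_R]
  exact h.symm

end QuasitriangularStructure

namespace RibbonStructure

variable {k A : Type*} [CommRing k] [Ring A] [HopfAlgebra k A] (H : RibbonStructure k A)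

/-- The rule u x = S²(x) u with x = u gives S²(u) = u; with x = S(u) it then gives the claim. -/
lemma antipode_u_mul_u : antipode k H.u * H.u = H.u * antipode k H.u := by
  rw [H.u_mul]
  congr 1
  have h := H.u_mul H.u
  have : antipode k (antipode k H.u) = H.u := (H.uUnit.isUnit.mul_right_cancel h).symm
  rw [this]

lemma isUnit_antipode_u : IsUnit (antipode k H.u) := by
  refine ⟨⟨antipode k H.u, antipode k H.uInv, ?_, ?_⟩, rfl⟩
  · rw [← antipode_mul_antidistrib, H.uInv_mul_u, antipode_one]
  · rw [← antipode_mul_antidistrib, H.u_mul_uInv, antipode_one]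

lemma isUnit_v : IsUnit H.v := by
  have h : IsUnit (H.v * H.v) := by
    rw [← sq, H.v_sq]; exact H.isUnit_antipode_u.mul H.uUnit.isUnit
  exact ((Commute.refl H.v).isUnit_mul_iff.1 h).1

/-- `v` as a unit. -/
def vUnit : Aˣ := H.isUnit_v.unit

@[simp] lemma coe_vUnit : (H.vUnit : A) = H.v := rfl

/-- The balancing element `u v⁻¹`. -/
def balancing : Aˣ := H.uUnit * H.vUnit⁻¹

lemma coe_balancing : (H.balancing : A) = H.u * Ring.inverse H.v := by
  rw [balancing, ← H.coe_vUnit, Ring.inverse_unit]; rfl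

lemma coe_balancing_inv : ((H.balancing⁻¹ : Aˣ) : A) = H.v * Ring.inverse H.u := by
  rw [balancing, ← H.coe_uUnit, Ring.inverse_unit, mul_inv_rev, inv_inv]; rfl

lemma vUnit_mul (x : Aˣ) : H.vUnit * x = x * H.vUnit := Units.ext (H.v_central x)

/-- Conjugation with u and with u v⁻¹ agree, as v is central. -/
lemma antipodePow_two (x : A) :
    H.antipodePow 2 x = H.balancing * x * ((H.balancing⁻¹ : Aˣ) : A) := by
  have : (2 : ℤ) = 1 + 1 := rfl
  rw [this, H.antipodePow_add, H.antipodePow_one, H.antipodePow_one, H.antipode_antipode, balancing,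
    mul_inv_rev, inv_inv]
  have h : ((H.vUnit⁻¹ : Aˣ) : A) * x * (H.vUnit : A) = x := by
    rw [mul_assoc, H.coe_vUnit, ← H.v_central, ← H.coe_vUnit, Units.inv_mul_cancel_left]
  conv_lhs => rw [← h]
  simp [mul_assoc]

/-- `S^(2m)` is conjugation with the `m`-th power of the balancing element. -/
lemma antipodePow_two_mul (m : ℤ) (x : A) :
    H.antipodePow (2 * m) x = ((H.balancing ^ m : Aˣ) : A) * x * ((H.balancing ^ (-m) : Aˣ) : A) := by
  have h : ∀ (m : ℕ) (x : A), H.antipodePow (2 * m : ℤ) x =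
      ((H.balancing ^ (m : ℤ) : Aˣ) : A) * x * ((H.balancing ^ (-(m : ℤ)) : Aˣ) : A) := by
    intro m
    induction m with
    | zero => intro x; simp [H.antipodePow_zero]
    | succ m ih =>
      intro x
      have : (2 * ((m + 1 : ℕ) : ℤ)) = 2 * m + 2 := by push_cast; ring
      rw [this, H.antipodePow_add, ih, antipodePow_two]
      have e1 : ((m + 1 : ℕ) : ℤ) = (m : ℤ) + 1 := by push_cast; ring
      have e2 : (-((m : ℤ) + 1)) = -1 + -(m : ℤ) := by ring
      rw [e1, e2, zpow_add, zpow_add]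
      simp [mul_assoc]
  rcases Int.eq_nat_or_neg m with ⟨m, rfl | rfl⟩
  · exact h m x
  · apply (H.antipodePow (2 * (m : ℤ))).injective
    have e : (2 * (m : ℤ)) + 2 * -(m : ℤ) = 0 := by ring
    have e1 : H.balancing ^ (m : ℤ) * H.balancing ^ (-(m : ℤ)) = 1 := by
      rw [← zpow_add, add_neg_cancel, zpow_zero]
    rw [← H.antipodePow_add, e, H.antipodePow_zero, h, neg_neg, ← mul_assoc, ← mul_assoc,
      ← Units.val_mul, e1, mul_assoc, ← Units.val_mul, e1, Units.val_one, one_mul, mul_one]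

end RibbonStructure

end

noncomputable section

/-! ## Time-ordered products -/

section OrdProd

variable {A : Type*}

/-- The product of the values of `b` at the elements of `T`, in increasing order. -/
def ordProd [Monoid A] (T : Finset ℝ) (b : ℝ → A) : A := ((T.sort (· ≤ ·)).map b).prod

variable [Monoid A]

@[simp] lemma ordProd_empty (b : ℝ → A) : ordProd ∅ b = 1 := by simp [ordProd]

@[simp] lemma ordProd_singleton (a : ℝ) (b : ℝ → A) : ordProd {a} b = b a := by simp [ordProd]

lemma ordProd_congr {T : Finset ℝ} {b b' : ℝ → A} (h : ∀ t ∈ T, b t = b' t) :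
    ordProd T b = ordProd T b' := by
  unfold ordProd
  congr 1
  exact List.map_congr_left fun t ht => h t ((Finset.mem_sort _).1 ht)

lemma ordProd_insert_min {T : Finset ℝ} {a : ℝ} (h : ∀ t ∈ T, a < t) (b : ℝ → A) :
    ordProd (insert a T) b = b a * ordProd T b := by
  unfold ordProd
  rw [Finset.sort_insert _ (fun t ht => (h t ht).le) (fun ha => lt_irrefl _ (h a ha))]
  simp

lemma ordProd_union {T₁ T₂ : Finset ℝ} (h : ∀ s ∈ T₁, ∀ t ∈ T₂, s < t) (b : ℝ → A) :
    ordProd (T₁ ∪ T₂) b = ordProd T₁ b * ordProd T₂ b := by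
  induction T₁ using Finset.induction_on_min with
  | empty => simp
  | insert a s hs ih =>
    rw [Finset.insert_union, ordProd_insert_min, ordProd_insert_min hs, mul_assoc, ih]
    · exact fun s' hs' t ht => h s' (Finset.mem_insert_of_mem hs') t ht
    · intro t ht
      rcases Finset.mem_union.1 ht with ht | ht
      · exact hs t ht
      · exact h a (Finset.mem_insert_self _ _) t ht

lemma ordProd_pair {s t : ℝ} (h : s < t) (b : ℝ → A) : ordProd {s, t} b = b s * b t := by
  rw [ordProd_insert_min (by simpa using h), ordProd_singleton]

lemma ordProd_image {T : Finset ℝ} {φ : ℝ → ℝ} (hφ : StrictMonoOn φ T) (b : ℝ → A) :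
    ordProd (T.image φ) b = ordProd T (b ∘ φ) := by
  induction T using Finset.induction_on_min with
  | empty => simp
  | insert a s hs ih =>
    rw [Finset.image_insert, ordProd_insert_min, ordProd_insert_min hs, ih]
    · rfl
    · exact hφ.mono (by simp)
    · intro t ht
      obtain ⟨r, hr, rfl⟩ := Finset.mem_image.1 ht
      exact hφ (by simp) (by simp [hr]) (hs r hr)

/-- Splitting off the part of an ordered product in an interval. -/
lemma ordProd_split {T₀ T₁ : Finset ℝ} {a b : ℝ} (h₀ : ∀ t ∈ T₀, t ∉ Set.Icc a b)
    (h₁ : ∀ t ∈ T₁, t ∈ Set.Icc a b) (hab : a ≤ b) (x : ℝ → A) :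
    ordProd (T₀ ∪ T₁) x =
      ordProd (T₀.filter (· < a)) x * ordProd T₁ x * ordProd (T₀.filter (b < ·)) x := by
  have : T₀ ∪ T₁ = (T₀.filter (· < a) ∪ T₁) ∪ T₀.filter (b < ·) := by
    ext t
    simp only [Finset.mem_union, Finset.mem_filter]
    constructor
    · rintro (ht | ht)
      · have := h₀ t ht
        simp only [Set.mem_Icc, not_and_or, not_le] at this
        tauto
      · tauto
    · tauto
  rw [this, ordProd_union, ordProd_union]
  · intro s hs t ht
    exact (Finset.mem_filter.1 hs).2.trans_le (h₁ t ht).1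
  · intro s hs t ht
    have ht := (Finset.mem_filter.1 ht).2
    rcases Finset.mem_union.1 hs with hs | hs
    · exact ((Finset.mem_filter.1 hs).2.trans_le hab).trans ht
    · exact (h₁ s hs).2.trans_lt ht

/-- The part of an ordered product in an interval may be contracted to one factor. -/
lemma ordProd_collapse {T₀ T₁ : Finset ℝ} {a b : ℝ} (h₀ : ∀ t ∈ T₀, t ∉ Set.Icc a b)
    (h₁ : ∀ t ∈ T₁, t ∈ Set.Icc a b) (hab : a ≤ b) (x : ℝ → A) :
    ordProd (T₀ ∪ T₁) x = ordProd (insert a T₀) (Function.update x a (ordProd T₁ x)) := by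
  have ha : ∀ t ∈ T₀, t ≠ a := fun t ht h => h₀ t ht (by simp [h, hab])
  -- The contracted product is split in the same way, with the single time a as its middle block;
  -- only the middle blocks have to be compared.
  have h := ordProd_split (T₁ := {a}) h₀ (by simpa using hab) hab
    (Function.update x a (ordProd T₁ x))
  rw [Finset.union_comm, ← Finset.insert_eq] at h
  rw [h, ordProd_split h₀ h₁ hab, ordProd_singleton, Function.update_self]
  congr 1
  · congr 1
    exact ordProd_congr fun t ht => by
      rw [Function.update_of_ne (ha t (Finset.mem_filter.1 ht).1)]
  · exact ordProd_congr fun t ht => by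
      rw [Function.update_of_ne (ha t (Finset.mem_filter.1 ht).1)]

/-- An ordered product as a function of one of its factors. -/
lemma ordProd_update {T : Finset ℝ} {a : ℝ} (ha : a ∈ T) (b : ℝ → A) (x : A) :
    ordProd T (Function.update b a x) =
      ordProd (T.filter (· < a)) b * x * ordProd (T.filter (a < ·)) b := by
  have : T = (T.erase a) ∪ {a} := by
    ext t; by_cases h : t = a <;> simp [h, ha]
  have h := ordProd_split (T₀ := T.erase a) (T₁ := {a}) (a := a) (b := a)
    (by simpa using fun t h _ => h) (by simp) le_rfl
    (Function.update b a x)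
  rw [← this, ordProd_singleton, Function.update_self] at h
  rw [h]
  congr 1
  · congr 1
    rw [ordProd_congr (b' := b)]
    · congr 1; ext t; simp only [Finset.mem_filter, Finset.mem_erase]
      exact ⟨fun h => ⟨h.1.2, h.2⟩, fun h => ⟨⟨h.2.ne, h.1⟩, h.2⟩⟩
    · intro t ht
      rw [Function.update_of_ne (Finset.mem_filter.1 ht).2.ne]
  · rw [ordProd_congr (b' := b)]
    · congr 1; ext t; simp only [Finset.mem_filter, Finset.mem_erase]
      exact ⟨fun h => ⟨h.1.2, h.2⟩, fun h => ⟨⟨h.2.ne', h.1⟩, h.2⟩⟩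
    · intro t ht
      rw [Function.update_of_ne (Finset.mem_filter.1 ht).2.ne']

end OrdProd

/-! ## State sums -/

section Beads

variable {A : Type*}

/-- The function on the time axis with the values `x c` at `o c`, `y c` at `u c` and `bg`
elsewhere. -/
def beads {ι : Type} (o u : ι → ℝ) (bg : ℝ → A) (x y : ι → A) : ℝ → A :=
  Function.extend (Sum.elim o u) (Sum.elim x y) bg

lemma beads_over {ι : Type} {o u : ι → ℝ} (h : Function.Injective (Sum.elim o u)) (bg : ℝ → A)
    (x y : ι → A) (c : ι) : beads o u bg x y (o c) = x c :=
  h.extend_apply _ _ (Sum.inl c)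

lemma beads_under {ι : Type} {o u : ι → ℝ} (h : Function.Injective (Sum.elim o u)) (bg : ℝ → A)
    (x y : ι → A) (c : ι) : beads o u bg x y (u c) = y c :=
  h.extend_apply _ _ (Sum.inr c)

lemma beads_of_forall_ne {ι : Type} {o u : ι → ℝ} (bg : ℝ → A)
    (x y : ι → A) {t : ℝ} (h : ∀ c, o c ≠ t) (h' : ∀ c, u c ≠ t) : beads o u bg x y t = bg t := by
  apply Function.extend_apply'
  rintro ⟨c | c, hc⟩
  · exact h c hc
  · exact h' c hc

lemma beads_update {ι : Type} [DecidableEq ι] {o u : ι → ℝ}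
    (h : Function.Injective (Sum.elim o u)) (bg : ℝ → A)
    (p : ι → A × A) (c : ι) (x : A × A) :
    beads o u bg (fun d => (Function.update p c x d).1) (fun d => (Function.update p c x d).2) =
    Function.update (Function.update
      (beads o u bg (fun d => (p d).1) (fun d => (p d).2)) (o c) x.1) (u c) x.2 := by
  have ou : ∀ c d, o c ≠ u d := fun c d e => by simpa using @h (Sum.inl c) (Sum.inr d) e
  have oo : ∀ c d, o c = o d → c = d := fun c d e => by simpa using @h (Sum.inl c) (Sum.inl d) e
  have uu : ∀ c d, u c = u d → c = d := fun c d e => by simpa using @h (Sum.inr c) (Sum.inr d) e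
  ext t
  by_cases h1 : ∃ d, o d = t
  · obtain ⟨d, rfl⟩ := h1
    rw [beads_over h, Function.update_of_ne (ou d c)]
    by_cases hd : d = c
    · subst hd; simp
    · rw [Function.update_of_ne hd, Function.update_of_ne (fun e => hd (oo _ _ e)), beads_over h]
  by_cases h2 : ∃ d, u d = t
  · obtain ⟨d, rfl⟩ := h2
    rw [beads_under h]
    by_cases hd : d = c
    · subst hd; simp
    · rw [Function.update_of_ne hd, Function.update_of_ne (fun e => hd (uu _ _ e)),
        Function.update_of_ne (ou c d).symm, beads_under h]
  push Not at h1 h2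
  rw [beads_of_forall_ne _ _ _ h1 h2, Function.update_of_ne (h2 c).symm,
    Function.update_of_ne (h1 c).symm, beads_of_forall_ne _ _ _ h1 h2]

end Beads

section StateSum

variable {k A : Type*} [CommRing k] [Ring A] [Algebra k A]

lemma ordProd_update_add {T : Finset ℝ} {a : ℝ} (ha : a ∈ T) (b : ℝ → A) (x y : A) :
    ordProd T (Function.update b a (x + y)) =
      ordProd T (Function.update b a x) + ordProd T (Function.update b a y) := by
  simp only [ordProd_update ha, mul_add, add_mul]

lemma ordProd_update_smul {T : Finset ℝ} {a : ℝ} (ha : a ∈ T) (b : ℝ → A) (r : k) (x : A) :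
    ordProd T (Function.update b a (r • x)) = r • ordProd T (Function.update b a x) := by
  simp only [ordProd_update ha, mul_smul_comm, smul_mul_assoc]

/-- The two beads of a crossing are met at times that may be far apart, but the product is linear in
each of them. It therefore factors through the tensor product, and identities between tensors can be
applied to it. -/
lemma exists_ordProd_update_two {T : Finset ℝ} {a a' : ℝ} (ha : a ∈ T) (ha' : a' ∈ T)
    (hne : a ≠ a') (b : ℝ → A) : ∃ Z : A ⊗[k] A →ₗ[k] A, ∀ x y,
      ordProd T (Function.update (Function.update b a x) a' y) = Z (x ⊗ₜ y) := by
  refine ⟨TensorProduct.lift (LinearMap.mk₂ k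
    (fun x y => ordProd T (Function.update (Function.update b a x) a' y)) ?_ ?_ ?_ ?_), ?_⟩
  · intro x y z
    simp only [Function.update_comm hne, ordProd_update_add ha]
  · intro r x z
    simp only [Function.update_comm hne, ordProd_update_smul ha]
  · intro x y z
    simp only [ordProd_update_add ha']
  · intro r x z
    simp only [ordProd_update_smul ha']
  · intro x y; simp

lemma exists_ordProd_update_three {T : Finset ℝ} {a a' a'' : ℝ} (ha : a ∈ T) (ha' : a' ∈ T)
    (ha'' : a'' ∈ T) (hne : a ≠ a') (hne' : a ≠ a'') (hne'' : a' ≠ a'') (b : ℝ → A) :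
    ∃ Z : A ⊗[k] (A ⊗[k] A) →ₗ[k] A, ∀ x y z,
      ordProd T (Function.update (Function.update (Function.update b a x) a' y) a'' z) =
        Z (x ⊗ₜ (y ⊗ₜ z)) := by
  have hZ := fun x => exists_ordProd_update_two (k := k) ha' ha'' hne'' (Function.update b a x)
  choose Z hZ using hZ
  refine ⟨TensorProduct.lift (LinearMap.mk₂ k (fun x w => Z x w) ?_ ?_ ?_ ?_), ?_⟩
  · intro x y w
    induction w with
    | zero => simp
    | tmul p q =>
      simp only [← hZ, Function.update_comm hne, Function.update_comm hne', ordProd_update_add ha]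
    | add w w' h h' => simp only [map_add, h, h']; abel
  · intro r x w
    induction w with
    | zero => simp
    | tmul p q =>
      simp only [← hZ, Function.update_comm hne, Function.update_comm hne', ordProd_update_smul ha]
    | add w w' h h' => simp only [map_add, h, h', smul_add]
  · intro x y w; simp
  · intro r x w; simp
  · intro x y z; simp [hZ]

/-- A sum of values of a function that is bilinear in each of its arguments in `A × A` depends only
on the tensors over which the arguments range. -/
lemma sum_congr_of_bilinear {ι : Type} [Finite ι] : ∀ [Fintype ι] [DecidableEq ι] {κ κ' : ι → Type}
    [∀ c, Fintype (κ c)] [∀ c, Fintype (κ' c)]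
    (X : ∀ c, κ c → A × A) (X' : ∀ c, κ' c → A × A)
    (_ : ∀ c, ∑ i, (X c i).1 ⊗ₜ[k] (X c i).2 = ∑ i, (X' c i).1 ⊗ₜ[k] (X' c i).2)
    (f : (ι → A × A) → A)
    (_ : ∀ c p, ∃ B : A ⊗[k] A →ₗ[k] A, ∀ x, f (Function.update p c x) = B (x.1 ⊗ₜ x.2)),
    ∑ σ : ∀ c, κ c, f (fun c => X c (σ c)) = ∑ σ : ∀ c, κ' c, f (fun c => X' c (σ c)) := by
  induction ι using Finite.induction_empty_option with
  | @of_equiv α β e ih =>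
    intro _ _ κ κ' _ _ X X' hX f hf
    classical
    let _ : Fintype α := Fintype.ofEquiv β e.symm
    have h := ih (κ := fun a => κ (e a)) (κ' := fun a => κ' (e a)) (fun a => X (e a))
      (fun a => X' (e a)) (fun a => hX (e a)) (fun p => f (p ∘ e.symm)) (by
        intro c p
        obtain ⟨B, hB⟩ := hf (e c) (p ∘ e.symm)
        refine ⟨B, fun x => ?_⟩
        rw [← hB, Function.update_comp_equiv, Equiv.symm_symm])
    rw [← (Equiv.piCongrLeft κ e).sum_comp, ← (Equiv.piCongrLeft κ' e).sum_comp]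
    refine (Finset.sum_congr rfl fun σ _ => congrArg f ?_).trans
      (h.trans (Finset.sum_congr rfl fun σ _ => congrArg f ?_))
    all_goals
      funext b
      obtain ⟨a, rfl⟩ := e.surjective b
      simp only [Equiv.piCongrLeft_apply_apply, Function.comp_apply]
      rw [e.symm_apply_apply]
  | h_empty =>
    intro _ _ κ κ' _ _ X X' hX f hf
    simp only [Finset.univ_unique, Finset.sum_singleton]
    congr 1
    ext c : 1
    exact PEmpty.elim c
  | @h_option α _ ih =>
    intro _ _ κ κ' _ _ X X' hX f hf
    classical
    let cons : A × A → (α → A × A) → (Option α → A × A) := fun x p c => c.elim x p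
    have hcons : ∀ x y p, Function.update (cons x p) none y = cons y p := by
      intro x y p; ext c : 1; cases c <;> simp [cons]
    have hcons' : ∀ x y p (c : α), Function.update (cons x p) (some c) y =
        cons x (Function.update p c y) := by
      intro x y p c; ext d : 1
      cases d with
      | none => simp [cons]
      | some d =>
        by_cases h : d = c
        · subst h; simp [cons]
        · simp [cons, h]
    have key : ∀ {κ : Option α → Type} [∀ c, Fintype (κ c)] (X : ∀ c, κ c → A × A),
        ∑ σ : ∀ c, κ c, f (fun c => X c (σ c)) = ∑ i : κ none, ∑ σ : ∀ c : α, κ (some c),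
          f (cons (X none i) (fun c => X (some c) (σ c))) := by
      intro κ _ X
      rw [← (Equiv.piOptionEquivProd (β := κ)).symm.sum_comp, Fintype.sum_prod_type]
      refine Finset.sum_congr rfl fun i _ => Finset.sum_congr rfl fun σ _ => ?_
      congr 1
      ext c : 1
      cases c <;> rfl
    rw [key X, key X']
    have h1 : ∀ x : A × A, ∑ σ : ∀ c : α, κ (some c), f (cons x (fun c => X (some c) (σ c))) =
        ∑ σ : ∀ c : α, κ' (some c), f (cons x (fun c => X' (some c) (σ c))) := by
      intro x
      refine ih (fun c => X (some c)) (fun c => X' (some c)) (fun c => hX (some c))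
        (fun p => f (cons x p)) ?_
      intro c p
      obtain ⟨B, hB⟩ := hf (some c) (cons x p)
      exact ⟨B, fun y => by rw [← hB, hcons']⟩
    simp only [h1]
    rw [Finset.sum_comm, Finset.sum_comm (γ := κ' none)]
    refine Finset.sum_congr rfl fun σ _ => ?_
    obtain ⟨B, hB⟩ := hf none (cons 0 (fun c => X' (some c) (σ c)))
    simp only [hcons] at hB
    simp only [hB, ← map_sum, hX]

/-- A sum of ordered products of beads depends only on the tensors placed on the crossings. -/
lemma sum_ordProd_congr {ι : Type} [Fintype ι] [DecidableEq ι] {κ κ' : ι → Type} [∀ c, Fintype (κ c)]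
    [∀ c, Fintype (κ' c)] {o u : ι → ℝ} (h : Function.Injective (Sum.elim o u)) (bg : ℝ → A)
    {T : Finset ℝ} (hoT : ∀ c, o c ∈ T) (huT : ∀ c, u c ∈ T)
    (X Y : ∀ c, κ c → A) (X' Y' : ∀ c, κ' c → A)
    (hX : ∀ c, ∑ i, X c i ⊗ₜ[k] Y c i = ∑ i, X' c i ⊗ₜ[k] Y' c i) :
    ∑ σ : ∀ c, κ c, ordProd T (beads o u bg (fun c => X c (σ c)) (fun c => Y c (σ c))) =
    ∑ σ : ∀ c, κ' c, ordProd T (beads o u bg (fun c => X' c (σ c)) (fun c => Y' c (σ c))) := by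
  refine sum_congr_of_bilinear (k := k) (fun c i => (X c i, Y c i)) (fun c i => (X' c i, Y' c i)) hX
    (fun p => ordProd T (beads o u bg (fun c => (p c).1) (fun c => (p c).2))) ?_
  intro c p
  have hne : o c ≠ u c := fun e => by simpa using @h (Sum.inl c) (Sum.inr c) e
  obtain ⟨B, hB⟩ := exists_ordProd_update_two (k := k) (hoT c) (huT c) hne
    (beads o u bg (fun c => (p c).1) (fun c => (p c).2))
  exact ⟨B, fun x => by rw [beads_update h, hB]⟩

end StateSum

end

/-! ### State sums with beads Sᵖ(αᵢ) and S^q(βᵢ), and their local parts. -/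

noncomputable section

open HopfAlgebra

lemma TensorExpansion.nonempty {k A : Type*} [CommRing k] [Ring A] [Algebra k A] (x : A ⊗[k] A) :
    Nonempty (TensorExpansion x) := by
  induction x with
  | zero => exact ⟨⟨0, Fin.elim0, Fin.elim0, by simp⟩⟩
  | tmul a b => exact ⟨⟨1, fun _ => a, fun _ => b, by simp⟩⟩
  | add x y hx hy =>
    obtain ⟨E⟩ := hx
    obtain ⟨F⟩ := hy
    refine ⟨⟨E.size + F.size, Fin.append E.fst F.fst, Fin.append E.snd F.snd, ?_⟩⟩
    rw [Fin.sum_univ_add]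
    simp [E.sum_eq, F.sum_eq]

/-- The set of the values of two functions. -/
def siteTimes {ι : Type} [Fintype ι] (o u : ι → ℝ) : Finset ℝ :=
  Finset.univ.image o ∪ Finset.univ.image u

lemma mem_siteTimes {ι : Type} [Fintype ι] {o u : ι → ℝ} {t : ℝ} :
    t ∈ siteTimes o u ↔ ∃ c, o c = t ∨ u c = t := by
  simp [siteTimes, exists_or]

lemma over_mem_siteTimes {ι : Type} [Fintype ι] (o u : ι → ℝ) (c : ι) : o c ∈ siteTimes o u :=
  mem_siteTimes.2 ⟨c, Or.inl rfl⟩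

lemma under_mem_siteTimes {ι : Type} [Fintype ι] (o u : ι → ℝ) (c : ι) : u c ∈ siteTimes o u :=
  mem_siteTimes.2 ⟨c, Or.inr rfl⟩

lemma siteTimes_sum {ι ι' : Type} [Fintype ι] [Fintype ι'] (o u : ι → ℝ) (o' u' : ι' → ℝ) :
    siteTimes (Sum.elim o o') (Sum.elim u u') = siteTimes o u ∪ siteTimes o' u' := by
  ext t
  simp [mem_siteTimes, Sum.exists]

lemma injective_sum_sites {ι ι' : Type} [Fintype ι] [Fintype ι'] {o u : ι → ℝ} {o' u' : ι' → ℝ}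
    (h : Function.Injective (Sum.elim o u)) (h' : Function.Injective (Sum.elim o' u'))
    (hd : Disjoint (siteTimes o u) (siteTimes o' u')) :
    Function.Injective (Sum.elim (Sum.elim o o') (Sum.elim u u')) := by
  have hd : ∀ c d, ∀ x ∈ ({o c, u c} : Set ℝ), ∀ y ∈ ({o' d, u' d} : Set ℝ), x ≠ y := by
    rintro c d x hx y hy rfl
    refine Finset.disjoint_left.1 hd (?_ : x ∈ _) ?_
    · rcases hx with rfl | rfl
      exacts [over_mem_siteTimes _ _ _, under_mem_siteTimes _ _ _]
    · rcases hy with rfl | rfl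
      exacts [over_mem_siteTimes _ _ _, under_mem_siteTimes _ _ _]
  have h1 := fun x y => @h x y
  have h2 := fun x y => @h' x y
  rintro ((c | c) | (c | c)) ((d | d) | (d | d)) e <;>
    simp only [Sum.elim_inl, Sum.elim_inr] at e
  · simpa using h1 (Sum.inl c) (Sum.inl d) e
  · exact absurd e (hd c d _ (by simp) _ (by simp))
  · simpa using h1 (Sum.inl c) (Sum.inr d) e
  · exact absurd e (hd c d _ (by simp) _ (by simp))
  · exact absurd e.symm (hd d c _ (by simp) _ (by simp))
  · simpa using h2 (Sum.inl c) (Sum.inl d) e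
  · exact absurd e.symm (hd d c _ (by simp) _ (by simp))
  · simpa using h2 (Sum.inl c) (Sum.inr d) e
  · simpa using h1 (Sum.inr c) (Sum.inl d) e
  · exact absurd e (hd c d _ (by simp) _ (by simp))
  · simpa using h1 (Sum.inr c) (Sum.inr d) e
  · exact absurd e (hd c d _ (by simp) _ (by simp))
  · exact absurd e.symm (hd d c _ (by simp) _ (by simp))
  · simpa using h2 (Sum.inr c) (Sum.inl d) e
  · exact absurd e.symm (hd d c _ (by simp) _ (by simp))
  · simpa using h2 (Sum.inr c) (Sum.inr d) e

namespace QuasitriangularStructure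

variable {k A : Type*} [CommRing k] [Ring A] [HopfAlgebra k A] (H : QuasitriangularStructure k A)

/-- An expansion of the R-matrix. -/
def expansion : TensorExpansion (H.R : A ⊗[k] A) := (TensorExpansion.nonempty _).some

lemma sum_expansion (a b : ℤ) :
    ∑ i, H.antipodePow a (H.expansion.fst i) ⊗ₜ[k] H.antipodePow b (H.expansion.snd i) =
      H.levelTensor (b - a) := by
  have h := H.map_levelTensor a b 0
  rw [levelTensor_zero, ← H.expansion.sum_eq, map_sum, zero_add] at h
  simpa using h

variable {ι ι' : Type}

/-- The beads `Sᵖ(αᵢ)` and `S^q(βᵢ)` on the two strands of each crossing, where the exponents and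
the index depend on the crossing. -/
def powBeads (o u : ι → ℝ) (p q : ι → ℤ) (σ : ι → Fin H.expansion.size) : ℝ → A :=
  beads o u 1 (fun c => H.antipodePow (p c) (H.expansion.fst (σ c)))
    (fun c => H.antipodePow (q c) (H.expansion.snd (σ c)))

variable {H} in
lemma powBeads_over {o u : ι → ℝ} (h : Function.Injective (Sum.elim o u)) (p q : ι → ℤ)
    (σ : ι → Fin H.expansion.size) (c : ι) :
    H.powBeads o u p q σ (o c) = H.antipodePow (p c) (H.expansion.fst (σ c)) :=
  beads_over h _ _ _ c

variable {H} in
lemma powBeads_under {o u : ι → ℝ} (h : Function.Injective (Sum.elim o u)) (p q : ι → ℤ)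
    (σ : ι → Fin H.expansion.size) (c : ι) :
    H.powBeads o u p q σ (u c) = H.antipodePow (q c) (H.expansion.snd (σ c)) :=
  beads_under h _ _ _ c

/-- The sum over all indices of the ordered products of the beads. -/
def powSum [Fintype ι] [DecidableEq ι] (o u : ι → ℝ) (p q : ι → ℤ) : A :=
  ∑ σ, ordProd (siteTimes o u) (H.powBeads o u p q σ)

/-- The tensor at a crossing sees only the difference of its exponents. This freedom allows the
exponents 0 and level to be traded for exponents adapted to the strands, so that a power of S is
common to all beads of a strand. -/
lemma powSum_congr [Fintype ι] [DecidableEq ι] {o u : ι → ℝ}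
    (h : Function.Injective (Sum.elim o u)) {p q p' q' : ι → ℤ}
    (hpq : ∀ c, q c - p c = q' c - p' c) : H.powSum o u p q = H.powSum o u p' q' := by
  refine sum_ordProd_congr (k := k) (κ := fun _ => Fin H.expansion.size)
    (κ' := fun _ => Fin H.expansion.size) h 1 (over_mem_siteTimes o u) (under_mem_siteTimes o u)
    (fun c i => H.antipodePow (p c) (H.expansion.fst i))
    (fun c i => H.antipodePow (q c) (H.expansion.snd i))
    (fun c i => H.antipodePow (p' c) (H.expansion.fst i))
    (fun c i => H.antipodePow (q' c) (H.expansion.snd i)) ?_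
  intro c
  simp only [sum_expansion, hpq]

lemma powSum_comp_equiv [Fintype ι] [DecidableEq ι] [Fintype ι'] [DecidableEq ι'] (e : ι' ≃ ι)
    {o u : ι → ℝ} (h : Function.Injective (Sum.elim o u)) (p q : ι → ℤ) :
    H.powSum (o ∘ e) (u ∘ e) (p ∘ e) (q ∘ e) = H.powSum o u p q := by
  have h' : Function.Injective (Sum.elim (o ∘ e) (u ∘ e)) := by
    have : Sum.elim (o ∘ e) (u ∘ e) = Sum.elim o u ∘ (e.sumCongr e) := by
      ext (c | c) <;> rfl
    rw [this]
    exact h.comp (e.sumCongr e).injective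
  have hT : siteTimes (o ∘ e) (u ∘ e) = siteTimes o u := by
    ext t
    simp only [mem_siteTimes, Function.comp_apply]
    exact e.exists_congr_left.trans (by simp)
  unfold powSum
  rw [← (e.symm.arrowCongr (Equiv.refl (Fin H.expansion.size))).sum_comp, hT]
  refine Finset.sum_congr rfl fun σ _ => ordProd_congr fun t ht => ?_
  obtain ⟨c, rfl | rfl⟩ := mem_siteTimes.1 ht
  all_goals obtain ⟨c, rfl⟩ := e.surjective c
  · rw [powBeads, powBeads, beads_over h]
    exact (beads_over h' _ _ _ c).trans (by simp)
  · rw [powBeads, powBeads, beads_under h]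
    exact (beads_under h' _ _ _ c).trans (by simp)

lemma powSum_comp_strictMono [Fintype ι] [DecidableEq ι] {φ : ℝ → ℝ}
    {o u : ι → ℝ} (h : Function.Injective (Sum.elim o u)) (p q : ι → ℤ)
    (hφ : StrictMonoOn φ (siteTimes o u)) :
    H.powSum (φ ∘ o) (φ ∘ u) p q = H.powSum o u p q := by
  have hmem : ∀ c, Sum.elim o u c ∈ siteTimes o u := by
    rintro (c | c)
    exacts [over_mem_siteTimes _ _ _, under_mem_siteTimes _ _ _]
  have h' : Function.Injective (Sum.elim (φ ∘ o) (φ ∘ u)) := by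
    rw [← Sum.comp_elim]
    exact fun x y hxy => h (hφ.injOn (hmem x) (hmem y) hxy)
  have hT : siteTimes (φ ∘ o) (φ ∘ u) = (siteTimes o u).image φ := by
    simp [siteTimes, Finset.image_union, Finset.image_image]
  unfold powSum
  rw [hT]
  refine Finset.sum_congr rfl fun σ _ => ?_
  rw [ordProd_image hφ]
  refine ordProd_congr fun t ht => ?_
  obtain ⟨c, rfl | rfl⟩ := mem_siteTimes.1 ht
  · rw [powBeads, powBeads, beads_over h]
    exact beads_over h' _ _ _ c
  · rw [powBeads, powBeads, beads_under h]
    exact beads_under h' _ _ _ c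

variable {H} in
lemma powBeads_sum_left {o u : ι → ℝ} {o' u' : ι' → ℝ} [Fintype ι] [Fintype ι']
    (h : Function.Injective (Sum.elim o u))
    (ht : Function.Injective (Sum.elim (Sum.elim o o') (Sum.elim u u')))
    {p q : ι → ℤ} {p' q' : ι' → ℤ} {σ : ι → Fin H.expansion.size}
    {σ' : ι' → Fin H.expansion.size} {t : ℝ} (hT : t ∈ siteTimes o u) :
    H.powBeads (Sum.elim o o') (Sum.elim u u') (Sum.elim p p') (Sum.elim q q') (Sum.elim σ σ') t =
      H.powBeads o u p q σ t := by
  obtain ⟨c, rfl | rfl⟩ := mem_siteTimes.1 hT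
  · exact (powBeads_over ht _ _ _ (Sum.inl c)).trans (powBeads_over h _ _ _ c).symm
  · exact (powBeads_under ht _ _ _ (Sum.inl c)).trans (powBeads_under h _ _ _ c).symm

variable {H} in
lemma powBeads_sum_right {o u : ι → ℝ} {o' u' : ι' → ℝ} [Fintype ι] [Fintype ι']
    (h : Function.Injective (Sum.elim o' u'))
    (ht : Function.Injective (Sum.elim (Sum.elim o o') (Sum.elim u u')))
    {p q : ι → ℤ} {p' q' : ι' → ℤ} {σ : ι → Fin H.expansion.size}
    {σ' : ι' → Fin H.expansion.size} {t : ℝ} (hT : t ∈ siteTimes o' u') :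
    H.powBeads (Sum.elim o o') (Sum.elim u u') (Sum.elim p p') (Sum.elim q q') (Sum.elim σ σ') t =
      H.powBeads o' u' p' q' σ' t := by
  obtain ⟨c, rfl | rfl⟩ := mem_siteTimes.1 hT
  · exact (powBeads_over ht _ _ _ (Sum.inr c)).trans (powBeads_over h _ _ _ c).symm
  · exact (powBeads_under ht _ _ _ (Sum.inr c)).trans (powBeads_under h _ _ _ c).symm

lemma powSum_sum [Fintype ι] [DecidableEq ι] [Fintype ι'] [DecidableEq ι']
    (o u : ι → ℝ) (o' u' : ι' → ℝ) (p q : ι → ℤ) (p' q' : ι' → ℤ) :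
    H.powSum (Sum.elim o o') (Sum.elim u u') (Sum.elim p p') (Sum.elim q q') =
      ∑ σ, ∑ σ', ordProd (siteTimes o u ∪ siteTimes o' u') (H.powBeads (Sum.elim o o')
        (Sum.elim u u') (Sum.elim p p') (Sum.elim q q') (Sum.elim σ σ')) := by
  unfold powSum
  rw [← (Equiv.sumArrowEquivProdArrow ι ι' (Fin H.expansion.size)).symm.sum_comp,
    Fintype.sum_prod_type, siteTimes_sum]
  rfl

/-- The contribution of the crossings in three intervals, as an element of `A ⊗ A ⊗ A`. -/
def localTensor [Fintype ι] [DecidableEq ι] (o u : ι → ℝ) (p q : ι → ℤ) (I₁ I₂ I₃ : Set ℝ) :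
    A ⊗[k] (A ⊗[k] A) :=
  open Classical in
  ∑ σ, ordProd ((siteTimes o u).filter (· ∈ I₁)) (H.powBeads o u p q σ) ⊗ₜ
    (ordProd ((siteTimes o u).filter (· ∈ I₂)) (H.powBeads o u p q σ) ⊗ₜ
      ordProd ((siteTimes o u).filter (· ∈ I₃)) (H.powBeads o u p q σ))

/-- A state sum depends on the crossings in three intervals only through their local tensor. -/
lemma exists_powSum_eq_localTensor [Fintype ι] [DecidableEq ι] {o u : ι → ℝ}
    (h : Function.Injective (Sum.elim o u)) (p q : ι → ℤ)
    {a₁ b₁ a₂ b₂ a₃ b₃ : ℝ} (h₁ : a₁ ≤ b₁) (h₂ : a₂ ≤ b₂) (h₃ : a₃ ≤ b₃)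
    (h₁₂ : Disjoint (Set.Icc a₁ b₁) (Set.Icc a₂ b₂))
    (h₁₃ : Disjoint (Set.Icc a₁ b₁) (Set.Icc a₃ b₃))
    (h₂₃ : Disjoint (Set.Icc a₂ b₂) (Set.Icc a₃ b₃))
    (hout : ∀ t ∈ siteTimes o u, t ∉ Set.Icc a₁ b₁ ∪ Set.Icc a₂ b₂ ∪ Set.Icc a₃ b₃) :
    ∃ Z : A ⊗[k] (A ⊗[k] A) →ₗ[k] A, ∀ (ι' : Type) [Fintype ι'] [DecidableEq ι']
      (o' u' : ι' → ℝ) (_ : Function.Injective (Sum.elim o' u')) (p' q' : ι' → ℤ)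
      (_ : ∀ t ∈ siteTimes o' u', t ∈ Set.Icc a₁ b₁ ∪ Set.Icc a₂ b₂ ∪ Set.Icc a₃ b₃),
      H.powSum (Sum.elim o o') (Sum.elim u u') (Sum.elim p p') (Sum.elim q q') =
        Z (H.localTensor o' u' p' q' (Set.Icc a₁ b₁) (Set.Icc a₂ b₂) (Set.Icc a₃ b₃)) := by
  classical
  have m₁ : a₁ ∈ Set.Icc a₁ b₁ := ⟨le_rfl, h₁⟩
  have m₂ : a₂ ∈ Set.Icc a₂ b₂ := ⟨le_rfl, h₂⟩
  have m₃ : a₃ ∈ Set.Icc a₃ b₃ := ⟨le_rfl, h₃⟩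
  have d₁₂ := Set.disjoint_left.1 h₁₂
  have d₁₃ := Set.disjoint_left.1 h₁₃
  have d₂₃ := Set.disjoint_left.1 h₂₃
  have n₁₂ : a₁ ≠ a₂ := fun e => d₁₂ m₁ (e ▸ m₂)
  have n₁₃ : a₁ ≠ a₃ := fun e => d₁₃ m₁ (e ▸ m₃)
  have n₂₃ : a₂ ≠ a₃ := fun e => d₂₃ m₂ (e ▸ m₃)
  set T₀ := siteTimes o u with hT₀
  -- The left ends a₁, a₂, a₃ serve as the places at which the contracted contents of the three
  -- intervals are inserted. The resulting Z σ depends only on the outer crossings.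
  have hZ := fun σ => exists_ordProd_update_three (k := k) (A := A)
    (T := insert a₃ (insert a₂ (insert a₁ T₀))) (a := a₁) (a' := a₂) (a'' := a₃)
    (by simp) (by simp) (by simp) n₁₂ n₁₃ n₂₃ (H.powBeads o u p q σ)
  choose Z hZ using hZ
  refine ⟨∑ σ, Z σ, ?_⟩
  intro ι' _ _ o' u' h' p' q' hin
  have hd : Disjoint T₀ (siteTimes o' u') :=
    Finset.disjoint_left.2 fun t ht ht' => hout t ht (hin t ht')
  have ht := injective_sum_sites h h' hd
  rw [powSum_sum, LinearMap.sum_apply]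
  refine Finset.sum_congr rfl fun σ _ => ?_
  rw [localTensor, map_sum]
  refine Finset.sum_congr rfl fun σ' _ => ?_
  set b := H.powBeads (Sum.elim o o') (Sum.elim u u') (Sum.elim p p') (Sum.elim q q')
    (Sum.elim σ σ') with hb
  have hb₀ : ∀ t ∈ T₀, b t = H.powBeads o u p q σ t := fun t htt => powBeads_sum_left h ht htt
  have hb' : ∀ t ∈ siteTimes o' u', b t = H.powBeads o' u' p' q' σ' t :=
    fun t htt => powBeads_sum_right h' ht htt
  set T₁ := (siteTimes o' u').filter (· ∈ Set.Icc a₁ b₁) with hT₁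
  set T₂ := (siteTimes o' u').filter (· ∈ Set.Icc a₂ b₂) with hT₂
  set T₃ := (siteTimes o' u').filter (· ∈ Set.Icc a₃ b₃) with hT₃
  have i₁ : ∀ t ∈ T₁, t ∈ Set.Icc a₁ b₁ := fun t ht => (Finset.mem_filter.1 ht).2
  have i₂ : ∀ t ∈ T₂, t ∈ Set.Icc a₂ b₂ := fun t ht => (Finset.mem_filter.1 ht).2
  have i₃ : ∀ t ∈ T₃, t ∈ Set.Icc a₃ b₃ := fun t ht => (Finset.mem_filter.1 ht).2
  have out₁ : ∀ t ∈ T₀, t ∉ Set.Icc a₁ b₁ := fun t ht h => hout t ht (Or.inl (Or.inl h))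
  have out₂ : ∀ t ∈ T₀, t ∉ Set.Icc a₂ b₂ := fun t ht h => hout t ht (Or.inl (Or.inr h))
  have out₃ : ∀ t ∈ T₀, t ∉ Set.Icc a₃ b₃ := fun t ht h => hout t ht (Or.inr h)
  rw [← hZ]
  -- The intervals are contracted one after the other; after each contraction the times that remain
  -- are regrouped so that the next interval is split off.
  have e₁ : T₀ ∪ siteTimes o' u' = (T₀ ∪ T₂ ∪ T₃) ∪ T₁ := by
    ext t
    have := hin t
    simp only [Set.mem_union] at this
    simp only [hT₁, hT₂, hT₃, Finset.mem_union, Finset.mem_filter]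
    tauto
  rw [e₁, ordProd_collapse (a := a₁) (b := b₁) _ i₁ h₁]
  swap
  · intro t ht ht'
    simp only [Finset.mem_union] at ht
    rcases ht with (ht | ht) | ht
    exacts [out₁ t ht ht', d₁₂ ht' (i₂ t ht), d₁₃ ht' (i₃ t ht)]
  have e₂ : insert a₁ (T₀ ∪ T₂ ∪ T₃) = (insert a₁ T₀ ∪ T₃) ∪ T₂ := by
    ext t; simp only [Finset.mem_union, Finset.mem_insert]; tauto
  rw [e₂, ordProd_collapse (a := a₂) (b := b₂) _ i₂ h₂]
  swap
  · intro t ht ht'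
    simp only [Finset.mem_union, Finset.mem_insert] at ht
    rcases ht with (rfl | ht) | ht
    exacts [d₁₂ m₁ ht', out₂ t ht ht', d₂₃ ht' (i₃ t ht)]
  have e₃ : insert a₂ (insert a₁ T₀ ∪ T₃) = (insert a₂ (insert a₁ T₀)) ∪ T₃ := by
    ext t; simp only [Finset.mem_union, Finset.mem_insert]; tauto
  rw [e₃, ordProd_collapse (a := a₃) (b := b₃) _ i₃ h₃]
  swap
  · intro t ht ht'
    simp only [Finset.mem_insert] at ht
    rcases ht with rfl | rfl | ht
    exacts [d₂₃ m₂ ht', d₁₃ m₁ ht', out₃ t ht ht']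
  have P₁ : ordProd T₁ b = ordProd T₁ (H.powBeads o' u' p' q' σ') :=
    ordProd_congr fun t ht => hb' t (Finset.mem_filter.1 ht).1
  have P₂ : ∀ x, ordProd T₂ (Function.update b a₁ x) = ordProd T₂ (H.powBeads o' u' p' q' σ') := by
    intro x
    refine ordProd_congr fun t ht => ?_
    rw [Function.update_of_ne, hb' t (Finset.mem_filter.1 ht).1]
    rintro rfl
    exact d₁₂ m₁ (i₂ _ ht)
  have P₃ : ∀ x y, ordProd T₃ (Function.update (Function.update b a₁ x) a₂ y) =
      ordProd T₃ (H.powBeads o' u' p' q' σ') := by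
    intro x y
    refine ordProd_congr fun t ht => ?_
    rw [Function.update_of_ne, Function.update_of_ne, hb' t (Finset.mem_filter.1 ht).1]
    · rintro rfl
      exact d₁₃ m₁ (i₃ _ ht)
    · rintro rfl
      exact d₂₃ m₂ (i₃ _ ht)
  rw [P₂, P₃, P₁]
  refine ordProd_congr fun t ht => ?_
  by_cases ht₃ : t = a₃
  · rw [ht₃, Function.update_self, Function.update_self, hT₃]
    congr!
  rw [Function.update_of_ne ht₃, Function.update_of_ne ht₃]
  by_cases ht₂ : t = a₂
  · rw [ht₂, Function.update_self, Function.update_self, hT₂]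
    congr!
  rw [Function.update_of_ne ht₂, Function.update_of_ne ht₂]
  by_cases ht₁ : t = a₁
  · rw [ht₁, Function.update_self, Function.update_self, hT₁]
    congr!
  rw [Function.update_of_ne ht₁, Function.update_of_ne ht₁]
  simp only [Finset.mem_insert, ht₁, ht₂, ht₃, false_or] at ht
  exact hb₀ t ht

end QuasitriangularStructure

end

noncomputable section

/-! ## Angle functions -/

/-- `θ` is a continuous choice of the angles of the plane vectors `v t` for `t ∈ [0,1]`. -/
structure IsAngle (v : ℝ → ℂ) (θ : ℝ → ℝ) : Prop where
  cont : ContinuousOn θ (Set.Icc 0 1)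
  eq : ∀ t ∈ Set.Icc (0 : ℝ) 1, v t = ‖v t‖ * Complex.exp (θ t * Complex.I)

lemma PointsDown.ne_zero {z : ℂ} (h : PointsDown z) : z ≠ 0 := by
  rintro rfl
  exact lt_irrefl _ h.2

lemma PointsDown.eq_exp {z : ℂ} (h : PointsDown z) :
    z = ‖z‖ * Complex.exp ((-(Real.pi / 2) : ℝ) * Complex.I) := by
  have h1 : z = (-z.im : ℝ) * (-Complex.I) := by
    apply Complex.ext <;> simp [h.1]
  have h2 : ‖z‖ = -z.im := by
    rw [h1, norm_mul, norm_neg, Complex.norm_I, mul_one, Complex.norm_real, Real.norm_eq_abs,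
      abs_of_pos (neg_pos.2 h.2)]
    simp
  have h3 : Complex.exp ((-(Real.pi / 2) : ℝ) * Complex.I) = -Complex.I := by
    have := Complex.exp_neg_pi_div_two_mul_I
    rw [← this]; congr 1; push_cast; ring
  rw [h3, h2]
  exact h1

/-- Angle functions for a family of functions, with a common start. -/
lemma exists_isAngle_family {v : ℝ × ℝ → ℂ}
    (hv : ContinuousOn v (Set.Icc 0 1 ×ˢ Set.Icc 0 1))
    (h0 : ∀ p ∈ Set.Icc (0 : ℝ) 1 ×ˢ Set.Icc (0 : ℝ) 1, v p ≠ 0)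
    (hd : ∀ s ∈ Set.Icc (0 : ℝ) 1, PointsDown (v (s, 0))) :
    ∃ Θ : ℝ × ℝ → ℝ, ContinuousOn Θ (Set.Icc 0 1 ×ˢ Set.Icc 0 1) ∧
      ∀ s ∈ Set.Icc (0 : ℝ) 1, IsAngle (fun t => v (s, t)) (fun t => Θ (s, t)) ∧
        Θ (s, 0) = -(Real.pi / 2) := by
  have h0' : ∀ p : unitInterval × unitInterval, v (p.2, p.1) ≠ 0 := fun p => h0 _ ⟨p.2.2, p.1.2⟩
  have hn : ∀ p : unitInterval × unitInterval, ‖v (p.2, p.1) / ‖v (p.2, p.1)‖‖ = 1 := by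
    intro p
    have : ‖v (p.2, p.1)‖ ≠ 0 := norm_ne_zero_iff.2 (h0' p)
    rw [norm_div, Complex.norm_real, norm_norm, div_self this]
  have hvc : Continuous fun p : unitInterval × unitInterval => v (p.2, p.1) :=
    hv.comp_continuous (by fun_prop) fun p => ⟨p.2.2, p.1.2⟩
  let γ : C(unitInterval × unitInterval, Circle) :=
    { toFun := fun p => ⟨v (p.2, p.1) / ‖v (p.2, p.1)‖, mem_sphere_zero_iff_norm.2 (hn p)⟩
      continuous_toFun := by
        refine Continuous.subtype_mk (hvc.div (Complex.continuous_ofReal.comp hvc.norm) ?_) _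
        intro p
        exact Complex.ofReal_ne_zero.2 (norm_ne_zero_iff.2 (h0' p)) }
  have hγ0 : ∀ s : unitInterval, γ (0, s) =
      Circle.exp (ContinuousMap.const unitInterval (-(Real.pi / 2)) s) := by
    intro s
    apply Circle.ext
    have := (hd s s.2).eq_exp
    have hne : (‖v (s, 0)‖ : ℂ) ≠ 0 := by
      exact_mod_cast norm_ne_zero_iff.2 (hd s s.2).ne_zero
    rw [ContinuousMap.const_apply, Circle.coe_exp]
    change v (s, 0) / ‖v (s, 0)‖ = _
    rw [div_eq_iff hne, mul_comm]
    exact this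
  -- The homotopy is lifted along the covering of the circle by the line. The time t is the
  -- coordinate along which one lifts and s is the parameter, so the lift is jointly continuous and
  -- has the prescribed value at t = 0 for all s.
  let Γ := Circle.isCoveringMap_exp.liftHomotopy γ _ hγ0
  have hΓ : Circle.exp ∘ Γ = γ := Circle.isCoveringMap_exp.liftHomotopy_lifts γ _ hγ0
  refine ⟨fun p => Γ (Set.projIcc 0 1 zero_le_one p.2, Set.projIcc 0 1 zero_le_one p.1), ?_, ?_⟩
  · refine (Γ.continuous.comp ?_).continuousOn
    exact (continuous_projIcc.comp continuous_snd).prodMk (continuous_projIcc.comp continuous_fst)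
  · intro s hs
    refine ⟨⟨?_, ?_⟩, ?_⟩
    · refine (Γ.continuous.comp (f := fun t : ℝ => (Set.projIcc 0 1 zero_le_one t,
        Set.projIcc 0 1 zero_le_one s)) ?_).continuousOn
      exact continuous_projIcc.prodMk continuous_const
    · intro t ht
      simp only [Set.projIcc_of_mem zero_le_one ht, Set.projIcc_of_mem zero_le_one hs]
      have h1 := congrArg (fun z : Circle => (z : ℂ)) (congrFun hΓ (⟨t, ht⟩, ⟨s, hs⟩))
      have hne : (‖v (s, t)‖ : ℂ) ≠ 0 := by exact_mod_cast norm_ne_zero_iff.2 (h0 _ ⟨hs, ht⟩)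
      simp only [Function.comp_apply, Circle.coe_exp] at h1
      rw [h1]
      change v (s, t) = ‖v (s, t)‖ * (v (s, t) / ‖v (s, t)‖)
      rw [mul_div_cancel₀ _ hne]
    · simp only [Set.projIcc_left]
      exact Circle.isCoveringMap_exp.liftHomotopy_zero γ _ hγ0 _

lemma exists_isAngle {v : ℝ → ℂ} (hv : ContinuousOn v (Set.Icc 0 1))
    (h0 : ∀ t ∈ Set.Icc (0 : ℝ) 1, v t ≠ 0) (hd : PointsDown (v 0)) :
    ∃ θ, IsAngle v θ ∧ θ 0 = -(Real.pi / 2) := by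
  obtain ⟨Θ, -, h⟩ := exists_isAngle_family (v := fun p => v p.2)
    (hv.comp continuous_snd.continuousOn fun p hp => hp.2) (fun p hp => h0 _ hp.2) (fun _ _ => hd)
  exact ⟨_, h 0 (by simp)⟩

lemma IsAngle.re_mul_exp {v : ℝ → ℂ} {θ : ℝ → ℝ} (h : IsAngle v θ) {t : ℝ}
    (ht : t ∈ Set.Icc (0 : ℝ) 1) : v t = (‖v t‖ * Real.cos (θ t) : ℝ) +
      (‖v t‖ * Real.sin (θ t) : ℝ) * Complex.I := by
  nth_rw 1 [h.eq t ht]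
  rw [Complex.exp_mul_I]
  push_cast
  ring

lemma IsAngle.re_eq {v : ℝ → ℂ} {θ : ℝ → ℝ} (h : IsAngle v θ) {t : ℝ}
    (ht : t ∈ Set.Icc (0 : ℝ) 1) : (v t).re = ‖v t‖ * Real.cos (θ t) := by
  have := congrArg Complex.re (h.re_mul_exp ht)
  rw [this, Complex.add_re, Complex.re_ofReal_mul, Complex.ofReal_re]; simp

lemma IsAngle.im_eq {v : ℝ → ℂ} {θ : ℝ → ℝ} (h : IsAngle v θ) {t : ℝ}
    (ht : t ∈ Set.Icc (0 : ℝ) 1) : (v t).im = ‖v t‖ * Real.sin (θ t) := by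
  have := congrArg Complex.im (h.re_mul_exp ht)
  rw [this, Complex.add_im, Complex.im_ofReal_mul, Complex.ofReal_im]; simp

lemma eq_add_of_exp_eq {x y : ℝ} (h : Complex.exp (x * Complex.I) = Complex.exp (y * Complex.I)) :
    ∃ m : ℤ, x = y + 2 * Real.pi * m := by
  obtain ⟨m, hm⟩ := Complex.exp_eq_exp_iff_exists_int.1 h
  refine ⟨m, ?_⟩
  have h1 : ((x : ℂ) - (y + 2 * Real.pi * m)) * Complex.I = 0 := by
    rw [sub_mul, hm]; ring
  have h2 := (mul_eq_zero.1 h1).resolve_right Complex.I_ne_zero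
  have h3 : ((x - (y + 2 * Real.pi * m) : ℝ) : ℂ) = 0 := by push_cast; exact h2
  have h4 : x - (y + 2 * Real.pi * m) = 0 := by exact_mod_cast h3
  linarith

lemma IsAngle.eq_add_of_eq {v v' : ℝ → ℂ} {θ θ' : ℝ → ℝ} (h : IsAngle v θ) (h' : IsAngle v' θ')
    {t t' : ℝ} (ht : t ∈ Set.Icc (0 : ℝ) 1) (ht' : t' ∈ Set.Icc (0 : ℝ) 1) (hv : v t = v' t')
    (h0 : v t ≠ 0) : ∃ m : ℤ, θ' t' = θ t + 2 * Real.pi * m := by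
  apply eq_add_of_exp_eq
  have hne : (‖v t‖ : ℂ) ≠ 0 := by exact_mod_cast norm_ne_zero_iff.2 h0
  have h1 := h.eq t ht
  have h2 := h'.eq t' ht'
  rw [← hv, h1] at h2
  simp only [norm_mul, Complex.norm_exp_ofReal_mul_I, mul_one, Complex.norm_real, norm_norm] at h2
  exact (mul_left_cancel₀ hne h2).symm

/-- Two vectors lie in a common open half-plane. -/
def InHalfPlane (z w : ℂ) : Prop := ∃ d : ℂ, 0 < (z * d).re ∧ 0 < (w * d).re

lemma InHalfPlane.refl {z : ℂ} (h : z ≠ 0) : InHalfPlane z z := by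
  refine ⟨(starRingEnd ℂ) z, ?_⟩
  rw [Complex.mul_conj, Complex.ofReal_re, and_self]
  exact Complex.normSq_pos.2 h

/-- Angle functions with the same start of vectors that are never opposite to each other never
differ by more than `π`. -/
lemma IsAngle.abs_sub_lt {v v' : ℝ → ℂ} {θ θ' : ℝ → ℝ} (h : IsAngle v θ) (h' : IsAngle v' θ')
    {a b : ℝ} (ha : 0 ≤ a) (hb : b ≤ 1) {s : ℝ} (hs : s ∈ Set.Icc a b)
    (h0 : |θ' s - θ s| < Real.pi) (hv : ∀ t ∈ Set.Icc a b, InHalfPlane (v t) (v' t)) :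
    ∀ t ∈ Set.Icc a b, |θ' t - θ t| < Real.pi := by
  have hsub : Set.Icc a b ⊆ Set.Icc (0 : ℝ) 1 := Set.Icc_subset_Icc ha hb
  -- A difference of exactly π would make the two vectors opposite, which a common open half-plane
  -- excludes. By the intermediate value theorem the difference cannot reach π.
  have hne : ∀ t ∈ Set.Icc a b, |θ' t - θ t| ≠ Real.pi := by
    intro t ht he
    obtain ⟨d, hd, hd'⟩ := hv t ht
    have e : Complex.exp (θ' t * Complex.I) = -Complex.exp (θ t * Complex.I) := by
      rcases (abs_eq Real.pi_pos.le).1 he with he | he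
      · have : (θ' t : ℂ) * Complex.I = θ t * Complex.I + Real.pi * Complex.I := by
          rw [← add_mul, ← Complex.ofReal_add, ← he]; simp
        rw [this, Complex.exp_add, Complex.exp_pi_mul_I]; ring
      · have : (θ t : ℂ) * Complex.I = θ' t * Complex.I + Real.pi * Complex.I := by
          rw [← add_mul, ← Complex.ofReal_add]; congr 2; linarith
        rw [this, Complex.exp_add, Complex.exp_pi_mul_I]; ring
    rw [h.eq t (hsub ht), mul_assoc, Complex.re_ofReal_mul] at hd
    rw [h'.eq t (hsub ht), e, mul_assoc, Complex.re_ofReal_mul, neg_mul, Complex.neg_re] at hd'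
    have p := pos_of_mul_pos_right hd (norm_nonneg _)
    have p' := pos_of_mul_pos_right hd' (norm_nonneg _)
    linarith
  have hc : ContinuousOn (fun t => |θ' t - θ t|) (Set.Icc a b) :=
    ((h'.cont.mono hsub).sub (h.cont.mono hsub)).abs
  intro t ht
  by_contra hcon
  obtain ⟨r, hr, hr'⟩ := isPreconnected_Icc.intermediate_value hs ht hc ⟨h0.le, not_lt.1 hcon⟩
  exact hne r hr hr'

/-- Angles of the same vector differ by a multiple of 2π, and the only one smaller than π in
absolute value is 0. -/
lemma IsAngle.eq_of_abs_sub_lt {v v' : ℝ → ℂ} {θ θ' : ℝ → ℝ} (h : IsAngle v θ)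
    (h' : IsAngle v' θ') {t : ℝ} (ht : t ∈ Set.Icc (0 : ℝ) 1) (hv : v t = v' t) (h0 : v t ≠ 0)
    (hlt : |θ' t - θ t| < Real.pi) : θ' t = θ t := by
  obtain ⟨m, hm⟩ := h.eq_add_of_eq h' ht ht hv h0
  have h1 : |2 * Real.pi * m| < Real.pi := by rwa [hm, add_sub_cancel_left] at hlt
  have hm0 : m = 0 := by
    by_contra hne
    have h2 : (1 : ℝ) ≤ |(m : ℝ)| := by exact_mod_cast Int.one_le_abs hne
    rw [abs_mul, abs_of_pos (by positivity : 0 < 2 * Real.pi)] at h1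
    nlinarith [Real.pi_pos]
  rw [hm, hm0]; simp

lemma IsAngle.unique {v : ℝ → ℂ} {θ θ' : ℝ → ℝ} (h : IsAngle v θ) (h' : IsAngle v θ')
    (hv : ∀ t ∈ Set.Icc (0 : ℝ) 1, v t ≠ 0) (h0 : θ' 0 = θ 0) :
    ∀ t ∈ Set.Icc (0 : ℝ) 1, θ' t = θ t := fun t ht =>
  h.eq_of_abs_sub_lt h' ht rfl (hv t ht) (h.abs_sub_lt h' le_rfl le_rfl (s := 0) (by simp)
    (by rw [h0, sub_self, abs_zero]; exact Real.pi_pos)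
    (fun t ht => InHalfPlane.refl (hv t ht)) t ht)

/-! ### Half-turns -/

/-- The number of half-turns of an angle, counted in such a way that it is even for directions
in the lower half-plane and odd for directions in the upper one. -/
def halfTurns (x : ℝ) : ℤ := ⌊x / Real.pi⌋ + 1

lemma halfTurns_eq_iff {x : ℝ} {n : ℤ} :
    halfTurns x = n ↔ (n - 1) * Real.pi ≤ x ∧ x < n * Real.pi := by
  rw [halfTurns, ← eq_sub_iff_add_eq, Int.floor_eq_iff, le_div_iff₀ Real.pi_pos,
    div_lt_iff₀ Real.pi_pos]
  push_cast
  rw [sub_add_cancel]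

lemma halfTurns_spec (x : ℝ) : (halfTurns x - 1) * Real.pi ≤ x ∧ x < halfTurns x * Real.pi :=
  halfTurns_eq_iff.1 rfl

lemma sin_shift (x : ℝ) (n : ℤ) : Real.sin x = (-1) ^ n * Real.sin (x - n * Real.pi) := by
  rw [Real.sin_sub_int_mul_pi, ← mul_assoc, ← zpow_add₀ (by norm_num : (-1 : ℝ) ≠ 0)]
  rw [Even.neg_one_zpow (Even.add_self n), one_mul]

lemma halfTurns_even_of_sin_neg {x : ℝ} (h : Real.sin x < 0) : Even (halfTurns x) := by
  by_contra hodd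
  obtain ⟨h1, h2⟩ := halfTurns_spec x
  have h3 : 0 ≤ Real.sin (x - (halfTurns x - 1 : ℤ) * Real.pi) := by
    push_cast
    exact Real.sin_nonneg_of_nonneg_of_le_pi (by linarith) (by linarith)
  have h4 := sin_shift x (halfTurns x - 1)
  rw [Even.neg_one_zpow (by
    rw [Int.even_sub]; simp only [Int.not_even_one]
    tauto), one_mul] at h4
  linarith

lemma halfTurns_odd_of_sin_pos {x : ℝ} (h : 0 < Real.sin x) : Odd (halfTurns x) := by
  by_contra hev
  rw [Int.not_odd_iff_even] at hev
  obtain ⟨h1, h2⟩ := halfTurns_spec x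
  have h3 : 0 ≤ Real.sin (x - (halfTurns x - 1 : ℤ) * Real.pi) := by
    push_cast
    exact Real.sin_nonneg_of_nonneg_of_le_pi (by linarith) (by linarith)
  have h4 := sin_shift x (halfTurns x - 1)
  rw [Odd.neg_one_zpow (by
    rw [Int.odd_sub]; simp only [Int.odd_iff, Int.even_iff] at *; omega)] at h4
  linarith

/-- On an interval on which the sine does not vanish the number of half-turns is constant. -/
lemma halfTurns_const {f : ℝ → ℝ} {s : Set ℝ} (hs : s.OrdConnected) (hf : ContinuousOn f s)
    (h : ∀ t ∈ s, Real.sin (f t) ≠ 0) {x y : ℝ} (hx : x ∈ s) (hy : y ∈ s) :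
    halfTurns (f x) = halfTurns (f y) := by
  have key : ∀ {x y : ℝ}, x ∈ s → y ∈ s → halfTurns (f x) < halfTurns (f y) → False := by
    intro x y hx hy hlt
    have h1 : f x ≤ (halfTurns (f x) : ℝ) * Real.pi := (halfTurns_spec (f x)).2.le
    have h2 : (halfTurns (f x) : ℝ) * Real.pi ≤ f y := by
      refine le_trans ?_ (halfTurns_spec (f y)).1
      have : ((halfTurns (f x) : ℤ) : ℝ) ≤ halfTurns (f y) - 1 := by
        exact_mod_cast Int.le_sub_one_iff.2 hlt
      exact mul_le_mul_of_nonneg_right this Real.pi_pos.le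
    obtain ⟨z, hz, hz'⟩ := hs.isPreconnected.intermediate_value hx hy hf ⟨h1, h2⟩
    exact h z hz (by rw [hz']; exact Real.sin_int_mul_pi _)
  rcases lt_trichotomy (halfTurns (f x)) (halfTurns (f y)) with hlt | heq | hgt
  exacts [(key hx hy hlt).elim, heq, (key hy hx hgt).elim]

lemma floor_div_pi_const {f : ℝ → ℝ} {s : Set ℝ} (hs : s.OrdConnected) (hf : ContinuousOn f s)
    (h : ∀ t ∈ s, Real.sin (f t) ≠ 0) {x y : ℝ} (hx : x ∈ s) (hy : y ∈ s) :
    ⌊f x / Real.pi⌋ = ⌊f y / Real.pi⌋ := by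
  have := halfTurns_const hs hf h hx hy
  unfold halfTurns at this
  omega

/-- Before the zero the angle stays in one interval [(n-1)π, nπ), so its limit jπ lies in the closed
interval and must be one of the two ends: j is n or n - 1. -/
lemma sin_eq_zero_of_halfTurns_between {f : ℝ → ℝ} {x y : ℝ} (hxy : x < y)
    (hf : ContinuousOn f (Set.Icc x y)) (h0 : Real.sin (f y) = 0)
    (h : ∀ t ∈ Set.Ico x y, Real.sin (f t) ≠ 0) :
    ∃ j : ℤ, f y = j * Real.pi ∧ (halfTurns (f x) = j ∨ halfTurns (f x) = j + 1) := by
  obtain ⟨j, hj⟩ := Real.sin_eq_zero_iff.1 h0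
  refine ⟨j, hj.symm, ?_⟩
  set n := halfTurns (f x) with hn
  have hc : ∀ t ∈ Set.Ico x y, f t ∈ Set.Icc ((n - 1 : ℝ) * Real.pi) (n * Real.pi) := by
    intro t ht
    have : halfTurns (f t) = n := halfTurns_const Set.ordConnected_Ico (hf.mono Set.Ico_subset_Icc_self)
      h ht ⟨le_rfl, hxy⟩
    have := halfTurns_eq_iff.1 this
    exact ⟨this.1, this.2.le⟩
  have hmem : f y ∈ Set.Icc ((n - 1 : ℝ) * Real.pi) (n * Real.pi) := by
    have h1 : Filter.Tendsto f (nhdsWithin y (Set.Ico x y)) (nhds (f y)) :=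
      ((hf y ⟨hxy.le, le_rfl⟩).mono Set.Ico_subset_Icc_self)
    have : (nhdsWithin y (Set.Ico x y)).NeBot := by
      rw [← mem_closure_iff_nhdsWithin_neBot, closure_Ico hxy.ne]
      exact ⟨hxy.le, le_rfl⟩
    exact isClosed_Icc.mem_of_tendsto h1 (eventually_nhdsWithin_of_forall hc)
  rw [← hj] at hmem
  have h1 : ((n - 1 : ℤ) : ℝ) ≤ j := by
    push_cast; exact le_of_mul_le_mul_right hmem.1 Real.pi_pos
  have h2 : (j : ℝ) ≤ n := le_of_mul_le_mul_right hmem.2 Real.pi_pos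
  have h1' : n - 1 ≤ j := by exact_mod_cast h1
  have h2' : j ≤ n := by exact_mod_cast h2
  omega

/-- The half-turns before and after a zero of the sine. -/
lemma exists_halfTurns_around {f : ℝ → ℝ} {x m y : ℝ} (hxm : x < m) (hmy : m < y)
    (hf : ContinuousOn f (Set.Icc x y)) (h0 : Real.sin (f m) = 0)
    (h : ∀ t ∈ Set.Ico x m, Real.sin (f t) ≠ 0) (h' : ∀ t ∈ Set.Ioc m y, Real.sin (f t) ≠ 0) :
    ∃ j : ℤ, f m = j * Real.pi ∧ (halfTurns (f x) = j ∨ halfTurns (f x) = j + 1) ∧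
      (halfTurns (f y) = j ∨ halfTurns (f y) = j + 1) := by
  obtain ⟨j, hj, hjx⟩ := sin_eq_zero_of_halfTurns_between hxm
    (hf.mono (Set.Icc_subset_Icc_right hmy.le)) h0 h
  -- The side after the zero is reduced to the side before it by reversing time.
  obtain ⟨i, hi, hiy⟩ := sin_eq_zero_of_halfTurns_between (f := fun t => f (-t)) (x := -y) (y := -m)
    (by linarith) (by
      refine hf.comp continuous_neg.continuousOn ?_
      intro t ht
      exact ⟨by linarith [ht.2], by linarith [ht.1]⟩) (by simpa using h0) (by
      intro t ht
      exact h' (-t) ⟨by linarith [ht.2], by linarith [ht.1]⟩)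
  simp only [neg_neg] at hi hiy
  have : i = j := by
    have : (i : ℝ) = j := mul_right_cancel₀ Real.pi_pos.ne' (hi.symm.trans hj)
    exact_mod_cast this
  subst this
  exact ⟨i, hj, hjx, hiy⟩

lemma cos_int_mul_pi_neg_iff {j : ℤ} : Real.cos (j * Real.pi) < 0 ↔ Odd j := by
  rw [Real.cos_int_mul_pi]
  rcases Int.even_or_odd j with h | h
  · rw [h.neg_one_zpow, ← Int.not_even_iff_odd]
    exact ⟨fun h' => absurd h' (by norm_num), fun h' => absurd h h'⟩
  · rw [h.neg_one_zpow]
    exact ⟨fun _ => h, fun _ => by norm_num⟩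

lemma cos_int_mul_pi_pos_iff {j : ℤ} : 0 < Real.cos (j * Real.pi) ↔ Even j := by
  rw [Real.cos_int_mul_pi]
  rcases Int.even_or_odd j with h | h
  · rw [h.neg_one_zpow]
    exact ⟨fun _ => h, fun _ => by norm_num⟩
  · rw [h.neg_one_zpow, ← Int.not_odd_iff_even]
    exact ⟨fun h' => absurd h' (by norm_num), fun h' => absurd h h'⟩

/-- The difference of two angles, in terms of their half-turns and the relative position of the
lines. -/
lemma floor_sub_div_pi {x y : ℝ} (hxy : Real.sin (y - x) ≠ 0) :
    ⌊(y - x) / Real.pi⌋ = halfTurns y - halfTurns x -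
      (if 0 < (-1 : ℝ) ^ (halfTurns y - halfTurns x) * Real.sin (y - x) then 0 else 1) := by
  obtain ⟨x1, x2⟩ := halfTurns_spec x
  obtain ⟨y1, y2⟩ := halfTurns_spec y
  have hpi := Real.pi_pos
  -- Both x and y lie in half-open intervals of length π, so y - x differs from mπ by less than π.
  -- The floor is m or m - 1, and the sign of sin(y - x - mπ) decides.
  set m := halfTurns y - halfTurns x with hm
  have hmc : (m : ℝ) = halfTurns y - halfTurns x := by rw [hm]; push_cast; ring
  have hs := sin_shift (y - x) m
  have hsq : (-1 : ℝ) ^ m * (-1 : ℝ) ^ m = 1 := by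
    rw [← zpow_add₀ (by norm_num : (-1 : ℝ) ≠ 0), Even.neg_one_zpow (Even.add_self m)]
  have hs' : (-1 : ℝ) ^ m * Real.sin (y - x) = Real.sin (y - x - m * Real.pi) := by
    rw [hs, ← mul_assoc, hsq, one_mul]
  rw [hs']
  rw [Int.floor_eq_iff, le_div_iff₀ hpi, div_lt_iff₀ hpi]
  split_ifs with h
  · have hpos : 0 < y - x - m * Real.pi := by
      by_contra hn
      have := Real.sin_nonpos_of_nonpos_of_neg_pi_le (x := y - x - m * Real.pi) (by linarith)
        (by rw [hmc]; nlinarith)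
      linarith
    constructor
    · push_cast; linarith
    · push_cast; rw [hmc]; nlinarith
  · have hneg : y - x - m * Real.pi < 0 := by
      by_contra hn
      have h1 := Real.sin_nonneg_of_nonneg_of_le_pi (x := y - x - m * Real.pi) (by linarith)
        (by rw [hmc]; nlinarith)
      have h2 : Real.sin (y - x - m * Real.pi) = 0 := le_antisymm (not_lt.1 h) h1
      exact hxy (by rw [hs, h2, mul_zero])
    constructor
    · push_cast; rw [hmc]; nlinarith
    · push_cast; linarith

end

/-! ### Angle, levels and rotation of a diagram; removal of the bends from a product. -/

noncomputable section

open HopfAlgebra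

namespace KnotoidDiagram

variable (K : KnotoidDiagram)

lemma mem_crossings {c : ℝ × ℝ} : c ∈ K.crossings ↔ (c.1 ∈ Set.Icc (0 : ℝ) 1 ∧
    c.2 ∈ Set.Icc (0 : ℝ) 1 ∧ c.1 ≠ c.2 ∧ K.curve c.1 = K.curve c.2) ∧ K.isOver c.1 = true := by
  simp [crossings]

variable {K} in
lemma isOver_snd {c : ℝ × ℝ} (hc : c ∈ K.crossings) : K.isOver c.2 = false := by
  obtain ⟨⟨h1, h2, h3, h4⟩, h5⟩ := K.mem_crossings.1 hc
  have := K.over_under _ h1 _ h2 h3 h4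
  rw [h5] at this
  simpa using this.symm

lemma isCrossingTime_iff {t : ℝ} :
    K.IsCrossingTime t ↔ ∃ c ∈ K.crossings, c.1 = t ∨ c.2 = t := by
  constructor
  · rintro ⟨ht, s, hs, hst, h⟩
    cases ho : K.isOver t with
    | true => exact ⟨(t, s), K.mem_crossings.2 ⟨⟨ht, hs, hst.symm, h.symm⟩, ho⟩, Or.inl rfl⟩
    | false =>
      refine ⟨(s, t), K.mem_crossings.2 ⟨⟨hs, ht, hst, h⟩, ?_⟩, Or.inr rfl⟩
      have := K.over_under s hs t ht hst h
      rw [ho] at this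
      simpa using this
  · rintro ⟨c, hc, rfl | rfl⟩
    · obtain ⟨⟨h1, h2, h3, h4⟩, h5⟩ := K.mem_crossings.1 hc
      exact ⟨h1, c.2, h2, h3.symm, h4.symm⟩
    · obtain ⟨⟨h1, h2, h3, h4⟩, h5⟩ := K.mem_crossings.1 hc
      exact ⟨h2, c.1, h1, h3, h4⟩

variable {K} in
lemma isCrossingTime_fst {c : ℝ × ℝ} (hc : c ∈ K.crossings) : K.IsCrossingTime c.1 :=
  K.isCrossingTime_iff.2 ⟨c, hc, Or.inl rfl⟩

variable {K} in
lemma isCrossingTime_snd {c : ℝ × ℝ} (hc : c ∈ K.crossings) : K.IsCrossingTime c.2 :=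
  K.isCrossingTime_iff.2 ⟨c, hc, Or.inr rfl⟩

variable {K} in
lemma IsCrossingTime.mem_Ioo {t : ℝ} (h : K.IsCrossingTime t) : t ∈ Set.Ioo (0 : ℝ) 1 := by
  obtain ⟨ht, s, hs, hst, h⟩ := h
  refine ⟨lt_of_le_of_ne ht.1 ?_, lt_of_le_of_ne ht.2 ?_⟩
  · rintro rfl
    exact hst (K.leg_simple s hs h)
  · rintro rfl
    exact hst (K.head_simple s hs h)

/-- The time on the over-strand of a crossing. -/
def overTime (c : K.crossings) : ℝ := c.1.1

/-- The time on the under-strand of a crossing. -/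
def underTime (c : K.crossings) : ℝ := c.1.2

/-- As there are no triple points, one time of a crossing determines the other one; the over/under
data separate times on over-strands from times on under-strands. -/
lemma injective_times : Function.Injective (Sum.elim K.overTime K.underTime) := by
  have h1 : ∀ c d : K.crossings, c.1.1 = d.1.1 → c = d := by
    intro c d h
    obtain ⟨⟨c1, c2, c3, c4⟩, c5⟩ := K.mem_crossings.1 c.2
    obtain ⟨⟨d1, d2, d3, d4⟩, d5⟩ := K.mem_crossings.1 d.2
    refine Subtype.ext (Prod.ext h ?_)
    rcases K.no_triple _ c2 _ c1 _ d2 c4.symm (by rw [h]; exact d4) with h' | h' | h'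
    · exact absurd h'.symm c3
    · exact absurd (h.symm.trans h') d3
    · exact h'
  have h2 : ∀ c d : K.crossings, c.1.2 = d.1.2 → c = d := by
    intro c d h
    obtain ⟨⟨c1, c2, c3, c4⟩, c5⟩ := K.mem_crossings.1 c.2
    obtain ⟨⟨d1, d2, d3, d4⟩, d5⟩ := K.mem_crossings.1 d.2
    refine Subtype.ext (Prod.ext ?_ h)
    rcases K.no_triple _ c1 _ c2 _ d1 c4 (by rw [h]; exact d4.symm) with h' | h' | h'
    · exact absurd h' c3
    · exact absurd (h.symm.trans h').symm d3
    · exact h'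
  have h3 : ∀ c d : K.crossings, c.1.1 ≠ d.1.2 := by
    intro c d h
    have e1 := (K.mem_crossings.1 c.2).2
    have e2 := isOver_snd d.2
    rw [h, e2] at e1
    exact absurd e1 (by simp)
  rintro (c | c) (d | d) h
  · rw [h1 c d h]
  · exact absurd h (h3 c d)
  · exact absurd h.symm (h3 d c)
  · rw [h2 c d h]

lemma continuousOn_velocity : ContinuousOn K.velocity (Set.Icc 0 1) :=
  K.smooth.continuousOn_derivWithin (uniqueDiffOn_Icc zero_lt_one) (by simp)

lemma velocity_ne_zero {t : ℝ} (ht : t ∈ Set.Icc (0 : ℝ) 1) : K.velocity t ≠ 0 :=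
  K.immersed t ht

end KnotoidDiagram

lemma planeDet_eq_sin {v v' : ℝ → ℂ} {θ θ' : ℝ → ℝ} (h : IsAngle v θ) (h' : IsAngle v' θ')
    {s t : ℝ} (hs : s ∈ Set.Icc (0 : ℝ) 1) (ht : t ∈ Set.Icc (0 : ℝ) 1) :
    planeDet (v s) (v' t) = ‖v s‖ * ‖v' t‖ * Real.sin (θ' t - θ s) := by
  rw [planeDet, h.re_eq hs, h.im_eq hs, h'.re_eq ht, h'.im_eq ht, Real.sin_sub]
  ring

namespace BiframedDiagram

variable (K : BiframedDiagram)

lemma exists_angle : ∃ θ, IsAngle K.velocity θ ∧ θ 0 = -(Real.pi / 2) :=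
  exists_isAngle K.continuousOn_velocity (fun _ ht => K.velocity_ne_zero ht) K.leg_down

/-- The angle function of the velocity that starts with `-π/2`. -/
def angle : ℝ → ℝ := K.exists_angle.choose

lemma isAngle : IsAngle K.velocity K.angle := K.exists_angle.choose_spec.1

lemma angle_zero : K.angle 0 = -(Real.pi / 2) := K.exists_angle.choose_spec.2

variable {K} in
lemma angle_eq_of_isAngle {v : ℝ → ℂ} {θ : ℝ → ℝ} (h : IsAngle v θ)
    (hv : ∀ t ∈ Set.Icc (0 : ℝ) 1, K.velocity t = v t) (h0 : θ 0 = -(Real.pi / 2)) :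
    ∀ t ∈ Set.Icc (0 : ℝ) 1, K.angle t = θ t := by
  have h' : IsAngle K.velocity θ := ⟨h.cont, fun t ht => by rw [hv t ht]; exact h.eq t ht⟩
  exact h'.unique K.isAngle (fun t ht => K.velocity_ne_zero ht) (K.angle_zero.trans h0.symm)

/-- The level of a crossing: the angle from the over-strand to the under-strand, as a number of
half-turns. -/
def level (c : ℝ × ℝ) : ℤ := ⌊(K.angle c.2 - K.angle c.1) / Real.pi⌋

/-- The number of full turns of the diagram. -/
def rotation : ℤ := halfTurns (K.angle 1) / 2

lemma sin_angle_sub_ne_zero {c : ℝ × ℝ} (hc : c ∈ K.crossings) :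
    Real.sin (K.angle c.2 - K.angle c.1) ≠ 0 := by
  obtain ⟨⟨h1, h2, h3, h4⟩, h5⟩ := K.mem_crossings.1 hc
  have h := K.transverse _ h1 _ h2 h3 h4
  change planeDet (K.velocity _) (K.velocity _) ≠ 0 at h
  rw [planeDet_eq_sin K.isAngle K.isAngle h1 h2] at h
  exact right_ne_zero_of_mul h

lemma sin_angle_ne_zero_iff {t : ℝ} (ht : t ∈ Set.Icc (0 : ℝ) 1) :
    Real.sin (K.angle t) ≠ 0 ↔ (K.velocity t).im ≠ 0 := by
  rw [K.isAngle.im_eq ht, mul_ne_zero_iff]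
  exact ⟨fun h => ⟨norm_ne_zero_iff.2 (K.velocity_ne_zero ht), h⟩, fun h => h.2⟩

lemma halfTurns_even_iff {t : ℝ} (ht : t ∈ Set.Icc (0 : ℝ) 1) (h : (K.velocity t).im ≠ 0) :
    Even (halfTurns (K.angle t)) ↔ (K.velocity t).im < 0 := by
  have hn := norm_pos_iff.2 (K.velocity_ne_zero ht)
  rw [K.isAngle.im_eq ht] at h ⊢
  rcases lt_or_gt_of_ne (right_ne_zero_of_mul h) with h' | h'
  · exact ⟨fun _ => mul_neg_of_pos_of_neg hn h', fun _ => halfTurns_even_of_sin_neg h'⟩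
  · constructor
    · intro he
      exact absurd he (Int.not_even_iff_odd.2 (halfTurns_odd_of_sin_pos h'))
    · intro hl
      exact absurd hl (not_lt.2 (mul_pos hn h').le)

end BiframedDiagram

/-- The value of the invariant on an arbitrary diagram. -/
def RibbonStructure.value {k A : Type*} [CommRing k] [Ring A] [HopfAlgebra k A]
    (H : RibbonStructure k A) (K : BiframedDiagram) : A :=
  H.powSum K.overTime K.underTime 0 (fun c => K.level c.1) *
    ((H.balancing ^ K.rotation : Aˣ) : A)

/-- Factors that are powers of a unit may be moved to the end of an ordered product. -/
lemma ordProd_bends {A : Type*} [Ring A] (G : Aˣ) (C B : Finset ℝ) (hCB : Disjoint C B)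
    (h01 : ∀ t ∈ C ∪ B, t ∈ Set.Ioo (0 : ℝ) 1) (g : ℝ → ℤ) (g0 : g 0 = 0)
    (hg : ∀ r ∈ Set.Icc (0 : ℝ) 1, ∀ r' ∈ Set.Icc (0 : ℝ) 1, r ≤ r' →
      (∀ m ∈ B, m ∉ Set.Icc r r') → g r = g r') (f : ℝ → A)
    (hf : ∀ r ∈ Set.Icc (0 : ℝ) 1, ∀ r' ∈ Set.Icc (0 : ℝ) 1, ∀ m ∈ B, m ∈ Set.Ioo r r' →
      (∀ m' ∈ B, m' ∈ Set.Icc r r' → m' = m) → f m = ((G ^ (g r' - g r) : Aˣ) : A)) :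
    ∀ N : ℕ, ∀ r ∈ Set.Icc (0 : ℝ) 1, r ∉ C ∪ B → ((C ∪ B).filter (· < r)).card = N →
      ordProd ((C ∪ B).filter (· < r)) f = ordProd (C.filter (· < r))
        (fun t => ((G ^ g t : Aˣ) : A) * f t * ((G ^ (-g t) : Aˣ) : A)) *
          ((G ^ g r : Aˣ) : A) := by
  -- The induction runs over the number of events before r. The function g records the total
  -- exponent of the bends met so far, so each step may only involve the last event before r.
  intro N
  induction N with
  | zero =>
    intro r hr hrE hN
    have hE := Finset.card_eq_zero.1 hN
    have hC : C.filter (· < r) = ∅ := by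
      rw [← Finset.subset_empty, ← hE]
      exact Finset.filter_subset_filter _ Finset.subset_union_left
    have : g r = 0 := by
      rw [← g0]
      symm
      refine hg 0 (by simp) r hr hr.1 ?_
      intro m hm hmr
      have hmr' : m < r := lt_of_le_of_ne hmr.2 (fun e => hrE (e ▸ Finset.mem_union_right _ hm))
      have : m ∈ (C ∪ B).filter (· < r) := Finset.mem_filter.2 ⟨Finset.mem_union_right _ hm, hmr'⟩
      rw [hE] at this
      exact absurd this (Finset.notMem_empty _)
    rw [hE, hC, this]; simp
  | succ N ih =>
    intro r hr hrE hN
    have hne : ((C ∪ B).filter (· < r)).Nonempty := Finset.card_pos.1 (by omega)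
    set m := ((C ∪ B).filter (· < r)).max' hne with hm
    have hmE := Finset.max'_mem _ hne
    rw [← hm] at hmE
    have hmle : ∀ t ∈ (C ∪ B).filter (· < r), t ≤ m := fun t ht => Finset.le_max' _ _ ht
    obtain ⟨hmE', hmr⟩ := Finset.mem_filter.1 hmE
    have hm01 := h01 m hmE'
    -- The time r' is the midpoint between m and the event before it, or between m and 0 if there is
    -- none; thus m is the only event between r' and r.
    obtain ⟨r', hr'0, hr'm, hr'⟩ : ∃ r', 0 ≤ r' ∧ r' < m ∧
        ∀ t ∈ (C ∪ B), t < m → t < r' := by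
      have hne' : (insert 0 ((C ∪ B).filter (· < m))).Nonempty := by simp
      set M := (insert 0 ((C ∪ B).filter (· < m))).max' hne' with hM
      have hMm : M < m := by
        have := Finset.max'_mem _ hne'
        rw [← hM] at this
        rcases Finset.mem_insert.1 this with h | h
        · rw [h]; exact hm01.1
        · exact (Finset.mem_filter.1 h).2
      have hM0 : 0 ≤ M := Finset.le_max' _ _ (by simp)
      refine ⟨(M + m) / 2, by linarith, by linarith, ?_⟩
      intro t ht htm
      have : t ≤ M := Finset.le_max' _ _ (by simp [ht, htm] at *)
      linarith
    have hr'01 : r' ∈ Set.Icc (0 : ℝ) 1 := ⟨hr'0, by linarith [hm01.2]⟩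
    have hr'E : r' ∉ C ∪ B := fun h => lt_irrefl _ (hr' r' h hr'm)
    have honly : ∀ t ∈ C ∪ B, t ∈ Set.Icc r' r → t = m := by
      intro t ht htr
      have h1 : t < r := lt_of_le_of_ne htr.2 (fun e => hrE (e ▸ ht))
      have h2 := hmle t (Finset.mem_filter.2 ⟨ht, h1⟩)
      by_contra hne
      exact absurd (hr' t ht (lt_of_le_of_ne h2 hne)) (not_lt.2 htr.1)
    have hEsplit : (C ∪ B).filter (· < r) = (C ∪ B).filter (· < r') ∪ {m} := by
      ext t
      simp only [Finset.mem_filter, Finset.mem_union (s := (C ∪ B).filter (· < r')),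
        Finset.mem_singleton]
      constructor
      · rintro ⟨ht, htr⟩
        by_cases h : t < r'
        · exact Or.inl ⟨ht, h⟩
        · exact Or.inr (honly t ht ⟨not_lt.1 h, htr.le⟩)
      · rintro (⟨ht, htr⟩ | rfl)
        · exact ⟨ht, by linarith⟩
        · exact ⟨hmE', hmr⟩
    have hcard : ((C ∪ B).filter (· < r')).card = N := by
      have : m ∉ (C ∪ B).filter (· < r') := fun h =>
        absurd (Finset.mem_filter.1 h).2 (not_lt.2 hr'm.le)
      rw [hEsplit, Finset.card_union_of_disjoint (Finset.disjoint_singleton_right.2 this)] at hN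
      simpa using hN
    have IH := ih r' hr'01 hr'E hcard
    rw [hEsplit, ordProd_union, IH, ordProd_singleton]
    swap
    · intro s hs t ht
      rw [Finset.mem_singleton.1 ht]
      exact (Finset.mem_filter.1 hs).2.trans hr'm
    -- At a crossing g does not change, and G^g f(m) = (G^g f(m) G^(-g)) G^g. At a bend f(m) is
    -- itself a power of G and is absorbed by the last factor.
    rcases Finset.mem_union.1 hmE' with hmC | hmB
    · have hmB : m ∉ B := Finset.disjoint_left.1 hCB hmC
      have hBnone : ∀ t ∈ B, t ∉ Set.Icc r' r := fun t ht htr =>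
        hmB (honly t (Finset.mem_union_right _ ht) htr ▸ ht)
      have e1 : g r' = g m := hg r' hr'01 m ⟨hm01.1.le, hm01.2.le⟩ hr'm.le
        (fun t ht htr => hBnone t ht ⟨htr.1, htr.2.trans hmr.le⟩)
      have e2 : g m = g r := hg m ⟨hm01.1.le, hm01.2.le⟩ r hr hmr.le
        (fun t ht htr => hBnone t ht ⟨hr'm.le.trans htr.1, htr.2⟩)
      have hCsplit : C.filter (· < r) = C.filter (· < r') ∪ {m} := by
        ext t
        have := congrArg (t ∈ ·) hEsplit
        simp only [Finset.mem_filter, Finset.mem_union, Finset.mem_singleton] at this ⊢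
        have hd : t ∈ C → t ∉ B := fun h => Finset.disjoint_left.1 hCB h
        have : t = m → t ∈ C := fun h => h ▸ hmC
        tauto
      rw [hCsplit, ordProd_union, ordProd_singleton, e1, ← e2]
      · simp [mul_assoc]
      · intro s hs t ht
        rw [Finset.mem_singleton.1 ht]
        exact (Finset.mem_filter.1 hs).2.trans hr'm
    · have hmC : m ∉ C := fun h => Finset.disjoint_left.1 hCB h hmB
      have hCsplit : C.filter (· < r) = C.filter (· < r') := by
        ext t
        have := congrArg (t ∈ ·) hEsplit
        simp only [Finset.mem_filter, Finset.mem_union, Finset.mem_singleton] at this ⊢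
        have : t = m → t ∉ C := fun h => h ▸ hmC
        tauto
      rw [hCsplit, hf r' hr'01 r hr m hmB ⟨hr'm, hmr⟩
        (fun t ht htr => honly t (Finset.mem_union_right _ ht) htr), mul_assoc, ← Units.val_mul,
        ← zpow_add]
      congr 3
      ring

end

/-! ### The value computed with bends equals the value computed with levels. -/

noncomputable section

open HopfAlgebra

/-- Turning one vector around changes the sign of the determinant, and the parities of m and n tell
which vectors are turned around. -/
lemma neg_one_zpow_mul_planeDet {z w : ℂ} {m n : ℤ} (hz : Even m ↔ z.im < 0)
    (hw : Even n ↔ w.im < 0) :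
    planeDet (turnedDown z) (turnedDown w) = (-1 : ℝ) ^ (n - m) * planeDet z w := by
  unfold turnedDown planeDet
  split_ifs with h1 h2 h2
  · rw [Even.neg_one_zpow (Even.sub (hw.2 h2) (hz.2 h1)), one_mul]
  · rw [Odd.neg_one_zpow (Odd.sub_even (Int.not_even_iff_odd.1 (fun h => h2 (hw.1 h))) (hz.2 h1))]
    simp; ring
  · rw [Odd.neg_one_zpow (Even.sub_odd (hw.2 h2) (Int.not_even_iff_odd.1 (fun h => h1 (hz.1 h))))]
    simp; ring
  · rw [Even.neg_one_zpow (Odd.sub_odd (Int.not_even_iff_odd.1 (fun h => h2 (hw.1 h)))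
      (Int.not_even_iff_odd.1 (fun h => h1 (hz.1 h))))]
    simp

namespace BiframedDiagram

variable {K : BiframedDiagram}

/-- A difference of angles does not depend on the direction from which they are measured. The choice
w = 0 serves decomposed diagrams, the argument of the scale of a window serves the Reidemeister
moves. -/
lemma level_eq_of_frame {c : ℝ × ℝ} (hc : c ∈ K.crossings) (w : ℝ) :
    K.level c = halfTurns (K.angle c.2 - w) - halfTurns (K.angle c.1 - w) -
      (if 0 < (-1 : ℝ) ^ (halfTurns (K.angle c.2 - w) - halfTurns (K.angle c.1 - w)) *
        planeDet (K.velocity c.1) (K.velocity c.2) then 0 else 1) := by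
  have h := K.sin_angle_sub_ne_zero hc
  obtain ⟨⟨h1, h2, h3, h4⟩, h5⟩ := K.mem_crossings.1 hc
  have e : K.angle c.2 - w - (K.angle c.1 - w) = K.angle c.2 - K.angle c.1 := by ring
  have := floor_sub_div_pi (x := K.angle c.1 - w) (y := K.angle c.2 - w) (by rwa [e])
  rw [e] at this
  rw [level, this]
  have hp : 0 < ‖K.velocity c.1‖ * ‖K.velocity c.2‖ :=
    mul_pos (norm_pos_iff.2 (K.velocity_ne_zero h1)) (norm_pos_iff.2 (K.velocity_ne_zero h2))
  have hiff : ∀ a : ℝ, 0 < a * Real.sin (K.angle c.2 - K.angle c.1) ↔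
      0 < a * planeDet (K.velocity c.1) (K.velocity c.2) := by
    intro a
    rw [planeDet_eq_sin K.isAngle K.isAngle h1 h2, mul_left_comm, mul_pos_iff_of_pos_left hp]
  simp only [hiff]

lemma level_eq_of_isDecomposed (hK : K.IsDecomposed) {c : ℝ × ℝ} (hc : c ∈ K.crossings) :
    K.level c = halfTurns (K.angle c.2) - halfTurns (K.angle c.1) -
      (if K.crossingType c then 0 else 1) := by
  obtain ⟨⟨h1, h2, h3, h4⟩, h5⟩ := K.mem_crossings.1 hc
  have e := level_eq_of_frame hc 0
  simp only [sub_zero] at e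
  rw [e, crossingType, neg_one_zpow_mul_planeDet
    (K.halfTurns_even_iff h1 (hK.crossing_not_horizontal _ (K.isCrossingTime_fst hc)))
    (K.halfTurns_even_iff h2 (hK.crossing_not_horizontal _ (K.isCrossingTime_snd hc)))]
  simp

lemma hasDerivWithinAt_velocity {t : ℝ} (ht : t ∈ Set.Icc (0 : ℝ) 1) :
    HasDerivWithinAt K.velocity (K.acceleration t) (Set.Icc 0 1) t := by
  have h : ContDiffOn ℝ ∞ K.velocity (Set.Icc 0 1) :=
    K.smooth.derivWithin (uniqueDiffOn_Icc zero_lt_one) (by simp)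
  exact ((h.differentiableOn (by simp)) t ht).hasDerivWithinAt

lemma angle_zero_halfTurns : halfTurns (K.angle 0) = 0 := by
  rw [K.angle_zero, halfTurns_eq_iff]
  constructor <;> push_cast <;> linarith [Real.pi_pos]

/-- The change of the number of half-turns at a bend. -/
lemma balancing_bend {k A : Type*} [CommRing k] [Ring A] [HopfAlgebra k A]
    (H : RibbonStructure k A) (hK : K.IsDecomposed) {r r' m : ℝ} (hr : 0 ≤ r) (hr' : r' ≤ 1)
    (hm : m ∈ Set.Ioo r r') (hm0 : (K.velocity m).im = 0)
    (honly : ∀ t ∈ Set.Icc r r', (K.velocity t).im = 0 → t = m) :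
    H.bendValue (K.velocity m) (K.acceleration m) =
      ((H.balancing ^ (halfTurns (K.angle r') / 2 - halfTurns (K.angle r) / 2) : Aˣ) : A) := by
  have hsub : Set.Icc r r' ⊆ Set.Icc (0 : ℝ) 1 := Set.Icc_subset_Icc hr hr'
  have hm01 : m ∈ Set.Icc (0 : ℝ) 1 := hsub ⟨hm.1.le, hm.2.le⟩
  have hne : ∀ t ∈ Set.Icc r r', t ≠ m → Real.sin (K.angle t) ≠ 0 := fun t ht htm =>
    (K.sin_angle_ne_zero_iff (hsub ht)).2 fun h => htm (honly t ht h)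
  have hcont : ContinuousOn K.angle (Set.Icc r r') := K.isAngle.cont.mono hsub
  obtain ⟨j, hj, hjr, hjr'⟩ := exists_halfTurns_around hm.1 hm.2 hcont
    (by
      have := (K.sin_angle_ne_zero_iff hm01).not.2 (not_not.2 hm0)
      exact not_not.1 this)
    (fun t ht => hne t ⟨ht.1, ht.2.le.trans hm.2.le⟩ ht.2.ne)
    (fun t ht => hne t ⟨hm.1.le.trans ht.1.le, ht.2⟩ ht.1.ne')
  have hre : (K.velocity m).re = ‖K.velocity m‖ * Real.cos (j * Real.pi) := by
    rw [K.isAngle.re_eq hm01, hj]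
  have hnorm : 0 < ‖K.velocity m‖ := norm_pos_iff.2 (K.velocity_ne_zero hm01)
  have hacc := hK.nondegenerate m hm01 hm0
  have hder : HasDerivAt (fun t => (K.velocity t).im) (K.acceleration m).im m := by
    have h1 := hasDerivWithinAt_velocity (K := K) hm01
    have h2 := h1.hasDerivAt (Icc_mem_nhds (by linarith [hm.1]) (by linarith [hm.2]))
    exact (Complex.imCLM.hasFDerivAt.comp_hasDerivAt m h2)
  have hslope := hasDerivAt_iff_tendsto_slope.1 hder
  -- By the sign of the second derivative the strand goes up before and down after a cap, and
  -- conversely at a cup; up is odd and down is even in the count of half-turns.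
  have hpar : ((K.acceleration m).im < 0 →
        Odd (halfTurns (K.angle r)) ∧ Even (halfTurns (K.angle r'))) ∧
      (0 < (K.acceleration m).im →
        Even (halfTurns (K.angle r)) ∧ Odd (halfTurns (K.angle r'))) := by
    have hleft : ∃ t ∈ Set.Ico r m, 0 < (K.acceleration m).im *
        slope (fun t => (K.velocity t).im) m t := by
      have h1 : ∀ᶠ t in nhdsWithin m {m}ᶜ, 0 < (K.acceleration m).im *
          slope (fun t => (K.velocity t).im) m t :=
        (hslope.const_mul _).eventually (lt_mem_nhds (mul_self_pos.2 hacc))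
      have h2 := h1.filter_mono (nhdsWithin_mono m (fun t (ht : t ∈ Set.Iio m) => ne_of_lt ht))
      obtain ⟨t, ht, ht'⟩ := (h2.and (Ico_mem_nhdsLT hm.1)).exists
      exact ⟨t, ht', ht⟩
    have hright : ∃ t ∈ Set.Ioc m r', 0 < (K.acceleration m).im *
        slope (fun t => (K.velocity t).im) m t := by
      have h1 : ∀ᶠ t in nhdsWithin m {m}ᶜ, 0 < (K.acceleration m).im *
          slope (fun t => (K.velocity t).im) m t :=
        (hslope.const_mul _).eventually (lt_mem_nhds (mul_self_pos.2 hacc))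
      have h2 := h1.filter_mono (nhdsWithin_mono m (fun t (ht : t ∈ Set.Ioi m) => ne_of_gt ht))
      obtain ⟨t, ht, ht'⟩ := (h2.and (Ioc_mem_nhdsGT hm.2)).exists
      exact ⟨t, ht', ht⟩
    obtain ⟨s, hs, hs'⟩ := hleft
    obtain ⟨t, ht, ht'⟩ := hright
    have hsI : s ∈ Set.Icc r r' := ⟨hs.1, hs.2.le.trans hm.2.le⟩
    have htI : t ∈ Set.Icc r r' := ⟨hm.1.le.trans ht.1.le, ht.2⟩
    have es : halfTurns (K.angle r) = halfTurns (K.angle s) :=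
      halfTurns_const (s := Set.Ico r m) Set.ordConnected_Ico
        (hcont.mono (fun x hx => ⟨hx.1, hx.2.le.trans hm.2.le⟩))
        (fun x hx => hne x ⟨hx.1, hx.2.le.trans hm.2.le⟩ hx.2.ne) ⟨le_rfl, hm.1⟩ hs
    have et : halfTurns (K.angle r') = halfTurns (K.angle t) :=
      halfTurns_const (s := Set.Ioc m r') Set.ordConnected_Ioc
        (hcont.mono (fun x hx => ⟨hm.1.le.trans hx.1.le, hx.2⟩))
        (fun x hx => hne x ⟨hm.1.le.trans hx.1.le, hx.2⟩ hx.1.ne') ⟨hm.2, le_rfl⟩ ht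
    have is : (K.velocity s).im ≠ 0 := fun h => hs.2.ne (honly s hsI h)
    have it : (K.velocity t).im ≠ 0 := fun h => ht.1.ne' (honly t htI h)
    have ps := K.halfTurns_even_iff (hsub hsI) is
    have pt := K.halfTurns_even_iff (hsub htI) it
    rw [slope_def_field, hm0, sub_zero] at hs' ht'
    have hsm : s - m < 0 := by linarith [hs.2]
    have htm : 0 < t - m := by linarith [ht.1]
    rw [es, et]
    constructor
    · intro ha
      constructor
      · rw [← Int.not_even_iff_odd, ps, not_lt]
        have := neg_of_mul_pos_right hs' ha.le
        by_contra hcon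
        exact absurd (div_pos_of_neg_of_neg (not_le.1 hcon) hsm) (not_lt.2 this.le)
      · rw [pt]
        have := neg_of_mul_pos_right ht' ha.le
        by_contra hcon
        exact absurd (div_nonneg (not_lt.1 hcon) htm.le) (not_le.2 this)
    · intro ha
      constructor
      · rw [ps]
        have := pos_of_mul_pos_right hs' ha.le
        by_contra hcon
        exact absurd (div_nonpos_of_nonneg_of_nonpos (not_lt.1 hcon) hsm.le) (not_le.2 this)
      · rw [← Int.not_even_iff_odd, pt, not_lt]
        have := pos_of_mul_pos_right ht' ha.le
        by_contra hcon
        exact absurd (div_neg_of_neg_of_pos (not_le.1 hcon) htm) (not_lt.2 this.le)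
  have hiff : (K.velocity m).re < 0 ↔ Odd j := by
    rw [hre, ← cos_int_mul_pi_neg_iff]
    refine ⟨fun h => ?_, fun h => mul_neg_of_pos_of_neg hnorm h⟩
    by_contra hc
    exact absurd h (not_lt.2 (mul_nonneg hnorm.le (not_lt.1 hc)))
  unfold RibbonStructure.bendValue
  -- The counts before and after the bend are in {j, j + 1} and have different parities. Division by
  -- 2 separates j from j + 1 exactly if j is odd, that is, if the bend is run through from right to
  -- left; a cap then raises the quotient by 1 and a cup lowers it by 1.
  rw [← H.coe_balancing, ← H.coe_balancing_inv]
  simp only [hiff]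
  split_ifs with h1 h2
  · obtain ⟨p1, p2⟩ := hpar.1 h2
    have : halfTurns (K.angle r') / 2 - halfTurns (K.angle r) / 2 = 1 := by
      rw [Int.odd_iff] at *; rw [Int.even_iff] at *; omega
    rw [this, zpow_one]
  · obtain ⟨p1, p2⟩ := hpar.2 (lt_of_le_of_ne (not_lt.1 h2) hacc.symm)
    have : halfTurns (K.angle r') / 2 - halfTurns (K.angle r) / 2 = -1 := by
      rw [Int.odd_iff] at *; rw [Int.even_iff] at *; omega
    rw [this, zpow_neg_one]
  · have : halfTurns (K.angle r') / 2 - halfTurns (K.angle r) / 2 = 0 := by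
      rcases lt_or_gt_of_ne hacc with h2 | h2
      · obtain ⟨p1, p2⟩ := hpar.1 h2
        rw [Int.odd_iff] at *; rw [Int.even_iff] at *; omega
      · obtain ⟨p1, p2⟩ := hpar.2 h2
        rw [Int.odd_iff] at *; rw [Int.even_iff] at *; omega
    rw [this, zpow_zero, Units.val_one]

end BiframedDiagram

namespace RibbonStructure

variable {k A : Type*} [CommRing k] [Ring A] [HopfAlgebra k A] (H : RibbonStructure k A)

/-- The remainder of n modulo 2 is the antipode prescribed by the direction of the strand; the
quotient is the conjugation caused by the bends that have been moved past the bead. -/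
lemma antipodePow_eq_conj (n : ℤ) (x : A) : H.antipodePow n x =
    ((H.balancing ^ (n / 2) : Aˣ) : A) * H.antipodePow (n % 2) x *
      ((H.balancing ^ (-(n / 2)) : Aˣ) : A) := by
  rw [← H.antipodePow_two_mul, ← H.antipodePow_add, Int.mul_ediv_add_emod]

lemma crossingTensor_eq (b : Bool) :
    H.crossingTensor b = H.levelTensor (if b then 0 else -1) := by
  cases b
  · exact H.levelTensor_neg_one.symm
  · exact H.levelTensor_zero.symm

/-- The value on a decomposed diagram, computed with bends, is the general value. -/
theorem evaluate_eq_value (E : ∀ type : Bool, TensorExpansion (H.crossingTensor type))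
    (K : BiframedDiagram) (hK : K.IsDecomposed) : H.evaluate E K hK = H.value K := by
  classical
  set n : ℝ → ℤ := fun t => halfTurns (K.angle t) with hn
  set C := siteTimes K.overTime K.underTime with hC
  set B := hK.finite_bends.toFinset with hB
  have hinj := K.injective_times
  have hCt : ∀ t, t ∈ C ↔ K.IsCrossingTime t := by
    intro t
    rw [hC, mem_siteTimes, K.isCrossingTime_iff]
    exact ⟨fun ⟨c, hc⟩ => ⟨c.1, c.2, hc⟩, fun ⟨c, h, hc⟩ => ⟨⟨c, h⟩, hc⟩⟩
  have hBt : ∀ t, t ∈ B ↔ t ∈ Set.Icc (0 : ℝ) 1 ∧ (K.velocity t).im = 0 := by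
    intro t; simp [hB]
  have hE : K.eventTimes hK = C ∪ B := by
    unfold BiframedDiagram.eventTimes
    congr 1
    ext t
    rw [hCt, K.isCrossingTime_iff]
    simp only [Finset.mem_union, Finset.mem_image]
    exact ⟨by rintro (⟨c, h, rfl⟩ | ⟨c, h, rfl⟩); exacts [⟨c, h, Or.inl rfl⟩, ⟨c, h, Or.inr rfl⟩],
      by rintro ⟨c, h, rfl | rfl⟩; exacts [Or.inl ⟨c, h, rfl⟩, Or.inr ⟨c, h, rfl⟩]⟩
  have hCB : Disjoint C B := Finset.disjoint_left.2 fun t ht ht' =>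
    hK.crossing_not_horizontal t ((hCt t).1 ht) ((hBt t).1 ht').2
  have h01 : ∀ t ∈ C ∪ B, t ∈ Set.Ioo (0 : ℝ) 1 := by
    intro t ht
    rcases Finset.mem_union.1 ht with ht | ht
    · exact ((hCt t).1 ht).mem_Ioo
    · obtain ⟨h1, h2⟩ := (hBt t).1 ht
      refine ⟨lt_of_le_of_ne h1.1 ?_, lt_of_le_of_ne h1.2 ?_⟩
      · rintro rfl; exact K.leg_down.2.ne h2
      · rintro rfl; exact K.head_down.2.ne h2
  have key : ∀ σ : (∀ c : K.crossings, Fin (E (K.crossingType c)).size),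
      (((K.eventTimes hK).sort (· ≤ ·)).map (H.label E K σ)).prod =
      ordProd C (beads K.overTime K.underTime 1
        (fun c => H.antipodePow (n (K.overTime c)) ((E (K.crossingType c)).fst (σ c)))
        (fun c => H.antipodePow (n (K.underTime c)) ((E (K.crossingType c)).snd (σ c)))) *
      ((H.balancing ^ K.rotation : Aˣ) : A) := by
    intro σ
    have hstrand : ∀ t, K.IsCrossingTime t → ∀ x : A, H.strandValue (K.velocity t) x =
        H.antipodePow (n t % 2) x := by
      intro t ht x
      have := K.halfTurns_even_iff ht.1 (hK.crossing_not_horizontal t ht)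
      unfold strandValue
      split_ifs with h
      · rw [Int.even_iff.1 (this.2 h), H.antipodePow_zero]
      · rw [Int.not_even_iff.1 (fun h' => h (this.1 h')), H.antipodePow_one]
    have hlabO : ∀ c : K.crossings, H.label E K σ (K.overTime c) =
        H.antipodePow (n (K.overTime c) % 2) ((E (K.crossingType c)).fst (σ c)) := by
      intro c
      have hex : ∃ d : K.crossings, d.1.1 = K.overTime c := ⟨c, rfl⟩
      have hch : hex.choose = c := by
        have := @hinj (Sum.inl hex.choose) (Sum.inl c) hex.choose_spec
        simpa using this
      rw [label, dif_pos hex, hstrand (K.overTime c) (K.isCrossingTime_fst c.2), hch]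
    have hlabU : ∀ c : K.crossings, H.label E K σ (K.underTime c) =
        H.antipodePow (n (K.underTime c) % 2) ((E (K.crossingType c)).snd (σ c)) := by
      intro c
      have hnex : ¬ ∃ d : K.crossings, d.1.1 = K.underTime c := by
        rintro ⟨d, hd⟩
        simpa using @hinj (Sum.inl d) (Sum.inr c) hd
      have hex : ∃ d : K.crossings, d.1.2 = K.underTime c := ⟨c, rfl⟩
      have hch : hex.choose = c := by
        have := @hinj (Sum.inr hex.choose) (Sum.inr c) hex.choose_spec
        simpa using this
      rw [label, dif_neg hnex, dif_pos hex, hstrand (K.underTime c) (K.isCrossingTime_snd c.2), hch]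
    have hlabB : ∀ t ∈ B, H.label E K σ t = H.bendValue (K.velocity t) (K.acceleration t) := by
      intro t ht
      have htC : t ∉ C := fun h => Finset.disjoint_left.1 hCB h ht
      have h1 : ¬ ∃ d : K.crossings, d.1.1 = t := by
        rintro ⟨d, rfl⟩; exact htC (over_mem_siteTimes _ _ d)
      have h2 : ¬ ∃ d : K.crossings, d.1.2 = t := by
        rintro ⟨d, rfl⟩; exact htC (under_mem_siteTimes _ _ d)
      rw [label, dif_neg h1, dif_neg h2]
    -- All events lie before the time 1, where the exponent n 1 / 2 is the rotation.
    have hmain := ordProd_bends H.balancing C B hCB h01 (fun t => n t / 2)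
      (by simp only [hn, BiframedDiagram.angle_zero_halfTurns]; rfl) (by
        intro r hr r' hr' hrr' hno
        have hsub : Set.Icc r r' ⊆ Set.Icc (0 : ℝ) 1 := Set.Icc_subset_Icc hr.1 hr'.2
        have : n r = n r' := halfTurns_const (s := Set.Icc r r') Set.ordConnected_Icc
          (K.isAngle.cont.mono hsub) (fun t ht => (K.sin_angle_ne_zero_iff (hsub ht)).2
            fun h => hno t ((hBt t).2 ⟨hsub ht, h⟩) ht) ⟨le_rfl, hrr'⟩ ⟨hrr', le_rfl⟩
        simp only [this]) (H.label E K σ) (by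
        intro r hr r' hr' m hm hmr hmo
        rw [hlabB m hm, BiframedDiagram.balancing_bend H hK hr.1 hr'.2 hmr ((hBt m).1 hm).2]
        intro t ht ht0
        exact hmo t ((hBt t).2 ⟨⟨hr.1.trans ht.1, ht.2.trans hr'.2⟩, ht0⟩) ht) _ 1 (by simp)
      (fun h => lt_irrefl _ (h01 1 h).2) rfl
    have f1 : (C ∪ B).filter (· < 1) = C ∪ B := Finset.filter_true_of_mem fun t ht => (h01 t ht).2
    have f2 : C.filter (· < 1) = C := Finset.filter_true_of_mem fun t ht =>
      (h01 t (Finset.mem_union_left _ ht)).2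
    rw [f1, f2] at hmain
    rw [hE]
    refine hmain.trans ?_
    congr 1
    refine ordProd_congr fun t ht => ?_
    obtain ⟨c, rfl | rfl⟩ := mem_siteTimes.1 ht
    · rw [beads_over hinj, hlabO, ← H.antipodePow_eq_conj]
    · rw [beads_under hinj, hlabU, ← H.antipodePow_eq_conj]
  unfold evaluate
  rw [Finset.sum_congr rfl fun σ _ => key σ, ← Finset.sum_mul, value]
  congr 1
  -- The given expansions are exchanged for the fixed expansion of R, and the exponents at each
  -- crossing for 0 and the level. Only the tensors at the crossings have to be compared.
  refine sum_ordProd_congr (k := k) (κ := fun c : K.crossings => Fin (E (K.crossingType c)).size)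
    (κ' := fun _ => Fin H.expansion.size) hinj 1 (over_mem_siteTimes _ _) (under_mem_siteTimes _ _)
    (fun c i => H.antipodePow (n (K.overTime c)) ((E (K.crossingType c)).fst i))
    (fun c i => H.antipodePow (n (K.underTime c)) ((E (K.crossingType c)).snd i))
    (fun c i => H.antipodePow 0 (H.expansion.fst i))
    (fun c i => H.antipodePow (K.level c.1) (H.expansion.snd i)) ?_
  intro c
  rw [H.sum_expansion, BiframedDiagram.level_eq_of_isDecomposed hK c.2]
  have h1 : ∑ i, H.antipodePow (n (K.overTime c)) ((E (K.crossingType c)).fst i) ⊗ₜ[k]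
      H.antipodePow (n (K.underTime c)) ((E (K.crossingType c)).snd i) =
      TensorProduct.map (H.antipodePow (n (K.overTime c))).toLinearMap
        (H.antipodePow (n (K.underTime c))).toLinearMap (H.crossingTensor (K.crossingType c)) := by
    refine Eq.trans ?_ (congrArg _ (E (K.crossingType c)).sum_eq)
    rw [map_sum]
    rfl
  rw [h1, crossingTensor_eq, H.map_levelTensor]
  congr 1
  simp only [hn, KnotoidDiagram.overTime, KnotoidDiagram.underTime]
  split_ifs <;> ring

end RibbonStructure

end

/-! ### Invariance under reparametrizations and ambient isotopies. -/

noncomputable section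

lemma planeDet_eq_zero_iff {z w : ℂ} :
    planeDet z w = 0 ↔ ∃ a b : ℝ, (a ≠ 0 ∨ b ≠ 0) ∧ a • z + b • w = 0 := by
  constructor
  · intro h
    unfold planeDet at h
    by_cases hz : z = 0
    · exact ⟨1, 0, Or.inl one_ne_zero, by simp [hz]⟩
    · refine ⟨-(z.re * w.re + z.im * w.im), z.re ^ 2 + z.im ^ 2, Or.inr ?_, ?_⟩
      · have := Complex.normSq_pos.2 hz
        rw [Complex.normSq_apply] at this
        nlinarith
      · apply Complex.ext
        · simp only [Complex.add_re, Complex.smul_re, smul_eq_mul, Complex.zero_re]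
          linear_combination (-z.im) * h
        · simp only [Complex.add_im, Complex.smul_im, smul_eq_mul, Complex.zero_im]
          linear_combination (z.re) * h
  · rintro ⟨a, b, hab, h⟩
    have h1 := congrArg Complex.re h
    have h2 := congrArg Complex.im h
    simp only [Complex.add_re, Complex.smul_re, smul_eq_mul, Complex.zero_re, Complex.add_im,
      Complex.smul_im, Complex.zero_im] at h1 h2
    unfold planeDet
    rcases hab with ha | hb
    · apply mul_left_cancel₀ ha
      linear_combination w.im * h1 - w.re * h2
    · apply mul_left_cancel₀ hb
      linear_combination z.re * h2 - z.im * h1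

/-- A vanishing determinant means linear dependence, which an injective linear map reflects. -/
lemma planeDet_map_ne_zero {L : ℂ →ₗ[ℝ] ℂ} (hL : Function.Injective L) {z w : ℂ}
    (h : planeDet z w ≠ 0) : planeDet (L z) (L w) ≠ 0 := by
  intro h'
  obtain ⟨a, b, hab, e⟩ := planeDet_eq_zero_iff.1 h'
  refine h (planeDet_eq_zero_iff.2 ⟨a, b, hab, hL ?_⟩)
  rw [map_add, map_smul, map_smul, e, map_zero]

namespace RibbonStructure

variable {k A : Type*} [CommRing k] [Ring A] [HopfAlgebra k A] (H : RibbonStructure k A)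

/-- The value sees only the order of the passages through the crossings, the levels and the
rotation. -/
lemma value_congr {K K' : BiframedDiagram} {φ : ℝ → ℝ} (hφ : StrictMonoOn φ (Set.Icc 0 1))
    (hmem : ∀ c ∈ K'.crossings, (φ c.1, φ c.2) ∈ K.crossings)
    (hsurj : ∀ d ∈ K.crossings, ∃ c ∈ K'.crossings, (φ c.1, φ c.2) = d)
    (hlev : ∀ c ∈ K'.crossings, K.level (φ c.1, φ c.2) = K'.level c)
    (hrot : K.rotation = K'.rotation) : H.value K' = H.value K := by
  let e : K'.crossings ≃ K.crossings := Equiv.ofBijective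
    (fun c => ⟨(φ c.1.1, φ c.1.2), hmem c.1 c.2⟩) (by
      constructor
      · rintro ⟨c, hc⟩ ⟨d, hd⟩ h
        obtain ⟨⟨c1, c2, c3, c4⟩, c5⟩ := K'.mem_crossings.1 hc
        obtain ⟨⟨d1, d2, d3, d4⟩, d5⟩ := K'.mem_crossings.1 hd
        simp only [Subtype.mk.injEq, Prod.mk.injEq] at h ⊢
        exact Prod.ext (hφ.injOn c1 d1 h.1) (hφ.injOn c2 d2 h.2)
      · rintro ⟨d, hd⟩
        obtain ⟨c, hc, h⟩ := hsurj d hd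
        exact ⟨⟨c, hc⟩, Subtype.ext h⟩)
  unfold value
  rw [hrot]
  congr 1
  have h1 := H.powSum_comp_equiv e K.injective_times 0 (fun c => K.level c.1)
  have h2 := H.powSum_comp_strictMono (φ := φ) K'.injective_times 0 (fun c => K'.level c.1)
    (hφ.mono (by
      intro t ht
      obtain ⟨c, rfl | rfl⟩ := mem_siteTimes.1 ht
      exacts [(K'.mem_crossings.1 c.2).1.1, (K'.mem_crossings.1 c.2).1.2.1]))
  rw [← h1, ← h2]
  have h3 : (fun c : K.crossings => K.level c.1) ∘ e = fun c : K'.crossings => K'.level c.1 :=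
    funext fun c => hlev c.1 c.2
  rw [h3]
  rfl

/-- The velocity is multiplied by the positive derivative of ρ, so the new angle function is the old
one composed with ρ. -/
theorem value_eq_of_reparametrized {K K' : BiframedDiagram} (h : Reparametrized K K') :
    H.value K' = H.value K := by
  obtain ⟨ρ, hρ, hpos, h0, h1, hcurve, hover⟩ := h
  have hmono : StrictMonoOn ρ (Set.Icc 0 1) := by
    refine strictMonoOn_of_deriv_pos (convex_Icc 0 1) hρ.continuousOn fun t ht => ?_
    rw [interior_Icc] at ht
    rw [← derivWithin_of_mem_nhds (Icc_mem_nhds ht.1 ht.2)]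
    exact hpos t (Set.Ioo_subset_Icc_self ht)
  have hmaps : ∀ t ∈ Set.Icc (0 : ℝ) 1, ρ t ∈ Set.Icc (0 : ℝ) 1 := by
    intro t ht
    have a := hmono.monotoneOn (by simp) ht ht.1
    have b := hmono.monotoneOn ht (by simp) ht.2
    rw [h0] at a
    rw [h1] at b
    exact ⟨a, b⟩
  have hsurj : ∀ t ∈ Set.Icc (0 : ℝ) 1, ∃ s ∈ Set.Icc (0 : ℝ) 1, ρ s = t := by
    intro t ht
    have := intermediate_value_Icc zero_le_one hρ.continuousOn
    rw [h0, h1] at this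
    exact this ht
  have hvel : ∀ t ∈ Set.Icc (0 : ℝ) 1, K'.velocity t =
      (derivWithin ρ (Set.Icc 0 1) t) • K.velocity (ρ t) := by
    intro t ht
    have d1 : HasDerivWithinAt ρ (derivWithin ρ (Set.Icc 0 1) t) (Set.Icc 0 1) t :=
      (hρ.differentiableOn (by simp) t ht).hasDerivWithinAt
    have d2 : HasDerivWithinAt K.curve (K.velocity (ρ t)) (Set.Icc 0 1) (ρ t) :=
      (K.smooth.differentiableOn (by simp) _ (hmaps t ht)).hasDerivWithinAt
    have d3 := d2.scomp t d1 hmaps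
    have d4 : HasDerivWithinAt K'.curve _ (Set.Icc 0 1) t := d3.congr hcurve (hcurve t ht)
    exact d4.derivWithin (uniqueDiffOn_Icc zero_lt_one t ht)
  have hangle : ∀ t ∈ Set.Icc (0 : ℝ) 1, K'.angle t = K.angle (ρ t) := by
    refine BiframedDiagram.angle_eq_of_isAngle (v := K'.velocity) (θ := K.angle ∘ ρ)
      ⟨K.isAngle.cont.comp hρ.continuousOn hmaps, ?_⟩ (fun _ _ => rfl)
      (by rw [Function.comp_apply, h0, K.angle_zero])
    intro t ht
    rw [hvel t ht, norm_smul, Real.norm_eq_abs, abs_of_pos (hpos t ht), Complex.real_smul,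
      Complex.ofReal_mul, mul_assoc]
    congr 1
    exact K.isAngle.eq _ (hmaps t ht)
  refine H.value_congr (φ := ρ) hmono ?_ ?_ ?_ ?_
  · intro c hc
    have hct := K'.isCrossingTime_fst hc
    obtain ⟨⟨c1, c2, c3, c4⟩, c5⟩ := K'.mem_crossings.1 hc
    rw [hcurve _ c1, hcurve _ c2] at c4
    exact K.mem_crossings.2 ⟨⟨hmaps _ c1, hmaps _ c2, fun h => c3 (hmono.injOn c1 c2 h), c4⟩,
      by rw [← hover _ hct]; exact c5⟩
  · intro d hd
    obtain ⟨⟨d1, d2, d3, d4⟩, d5⟩ := K.mem_crossings.1 hd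
    obtain ⟨s, hs, hs'⟩ := hsurj _ d1
    obtain ⟨t, ht, ht'⟩ := hsurj _ d2
    have hst : s ≠ t := by rintro rfl; exact d3 (hs'.symm.trans ht')
    have hcv : K'.curve s = K'.curve t := by rw [hcurve _ hs, hcurve _ ht, hs', ht', d4]
    refine ⟨(s, t), K'.mem_crossings.2 ⟨⟨hs, ht, hst, hcv⟩, ?_⟩, Prod.ext hs' ht'⟩
    rw [hover s ⟨hs, t, ht, hst.symm, hcv.symm⟩, hs']
    exact d5
  · intro c hc
    obtain ⟨⟨c1, c2, c3, c4⟩, c5⟩ := K'.mem_crossings.1 hc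
    simp only [BiframedDiagram.level, hangle _ c1, hangle _ c2]
  · simp only [BiframedDiagram.rotation, hangle 1 (by simp), h1]

/-- The angles of all stages of the isotopy form one continuous function Θ(s, t). At a crossing the
two tangents stay independent, because the differential of each stage is injective; their angle
never meets a multiple of π and its floor is constant in s. The tangent at the head points down at
every stage, so the rotation is constant too. The intermediate diagrams need not be decomposed. -/
theorem value_eq_of_ambientIsotopic {K K' : BiframedDiagram} (h : AmbientIsotopic K K') :
    H.value K' = H.value K := by
  obtain ⟨F, hF, hF0, hFG, hdown, hcurve, hover⟩ := h
  set Φ : ℝ × ℂ → ℂ := fun p => F p.1 p.2 with hΦ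
  set D : ℝ × ℂ → (ℝ × ℂ →L[ℝ] ℂ) := fderivWithin ℝ Φ (Set.Icc 0 1 ×ˢ Set.univ) with hD
  have hU : UniqueDiffOn ℝ (Set.Icc (0 : ℝ) 1 ×ˢ (Set.univ : Set ℂ)) :=
    (uniqueDiffOn_Icc zero_lt_one).prod uniqueDiffOn_univ
  have hDc : ContinuousOn D (Set.Icc 0 1 ×ˢ Set.univ) :=
    hF.continuousOn_fderivWithin hU (by simp)
  set v : ℝ × ℝ → ℂ := fun p => D (p.1, K.curve p.2) (0, K.velocity p.2) with hv
  have hDF : ∀ s ∈ Set.Icc (0 : ℝ) 1, ∀ z, HasFDerivAt (F s)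
      ((D (s, z)).comp (ContinuousLinearMap.inr ℝ ℝ ℂ)) z := by
    intro s hs z
    have d1 : HasFDerivWithinAt Φ (D (s, z)) (Set.Icc 0 1 ×ˢ Set.univ) (s, z) :=
      (hF.differentiableOn (by simp) (s, z) ⟨hs, trivial⟩).hasFDerivWithinAt
    have d2 : HasFDerivWithinAt (fun w : ℂ => (s, w)) (ContinuousLinearMap.inr ℝ ℝ ℂ)
      Set.univ z := (hasFDerivAt_prodMk_right s z).hasFDerivWithinAt
    have d3 := d1.comp z d2 (fun w _ => ⟨hs, trivial⟩)
    exact hasFDerivWithinAt_univ.1 d3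
  -- By the chain rule the differential of the smooth inverse G is a left inverse.
  have hDinj : ∀ s ∈ Set.Icc (0 : ℝ) 1, ∀ z, Function.Injective
      ((D (s, z)).comp (ContinuousLinearMap.inr ℝ ℝ ℂ)) := by
    intro s hs z
    obtain ⟨G, hG, hl, hr⟩ := hFG s hs
    have d1 := ((hG.differentiable (by simp)) (F s z)).hasFDerivAt.comp z (hDF s hs z)
    have d2 : HasFDerivAt (G ∘ F s) (ContinuousLinearMap.id ℝ ℂ) z := by
      rw [show G ∘ F s = id from funext hl]
      exact hasFDerivAt_id z
    have d3 := d1.unique d2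
    intro x y hxy
    have e1 := congrArg (fun L => L x) d3
    have e2 := congrArg (fun L => L y) d3
    simp only [ContinuousLinearMap.comp_apply, ContinuousLinearMap.id_apply] at e1 e2 hxy
    rw [← e1, ← e2, hxy]
  have hvd : ∀ s ∈ Set.Icc (0 : ℝ) 1, ∀ t ∈ Set.Icc (0 : ℝ) 1,
      derivWithin (fun t => F s (K.curve t)) (Set.Icc 0 1) t = v (s, t) := by
    intro s hs t ht
    have d2 : HasDerivWithinAt K.curve (K.velocity t) (Set.Icc 0 1) t :=
      (K.smooth.differentiableOn (by simp) _ ht).hasDerivWithinAt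
    have d3 := (hDF s hs (K.curve t)).comp_hasDerivWithinAt t d2
    exact d3.derivWithin (uniqueDiffOn_Icc zero_lt_one t ht)
  have hv' : ∀ s t, v (s, t) = ((D (s, K.curve t)).comp (ContinuousLinearMap.inr ℝ ℝ ℂ))
    (K.velocity t) := fun _ _ => rfl
  have hvc : ContinuousOn v (Set.Icc 0 1 ×ˢ Set.Icc 0 1) := by
    have c1 : ContinuousOn (fun p : ℝ × ℝ => (p.1, K.curve p.2)) (Set.Icc 0 1 ×ˢ Set.Icc 0 1) :=
      continuous_fst.continuousOn.prodMk
        (K.smooth.continuousOn.comp continuous_snd.continuousOn fun p hp => hp.2)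
    have c2 : ContinuousOn (fun p : ℝ × ℝ => ((0 : ℝ), K.velocity p.2))
        (Set.Icc 0 1 ×ˢ Set.Icc 0 1) :=
      continuousOn_const.prodMk
        (K.continuousOn_velocity.comp continuous_snd.continuousOn fun p hp => hp.2)
    exact (hDc.comp c1 fun p hp => ⟨hp.1, trivial⟩).clm_apply c2
  have hv0 : ∀ p ∈ Set.Icc (0 : ℝ) 1 ×ˢ Set.Icc (0 : ℝ) 1, v p ≠ 0 := by
    rintro ⟨s, t⟩ ⟨hs, ht⟩ h0
    rw [hv'] at h0
    exact K.velocity_ne_zero ht (hDinj s hs _ (h0.trans (map_zero _).symm))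
  obtain ⟨Θ, hΘc, hΘ⟩ := exists_isAngle_family hvc hv0 (fun s hs => by
    rw [← hvd s hs 0 (by simp)]; exact (hdown s hs).1)
  have m0 : (0 : ℝ) ∈ Set.Icc (0 : ℝ) 1 := by simp
  have m1 : (1 : ℝ) ∈ Set.Icc (0 : ℝ) 1 := by simp
  have hK : ∀ t ∈ Set.Icc (0 : ℝ) 1, K.angle t = Θ (0, t) := by
    refine BiframedDiagram.angle_eq_of_isAngle (hΘ 0 m0).1 (fun t ht => ?_) (hΘ 0 m0).2
    rw [← hvd 0 m0 t ht]
    simp only [hF0]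
    rfl
  have hK' : ∀ t ∈ Set.Icc (0 : ℝ) 1, K'.angle t = Θ (1, t) := by
    refine BiframedDiagram.angle_eq_of_isAngle (hΘ 1 m1).1 (fun t ht => ?_) (hΘ 1 m1).2
    rw [← hvd 1 m1 t ht]
    exact derivWithin_congr hcurve (hcurve t ht)
  have hΘt : ∀ t ∈ Set.Icc (0 : ℝ) 1, ContinuousOn (fun s => Θ (s, t)) (Set.Icc 0 1) :=
    fun t ht => hΘc.comp (by fun_prop) fun s hs => ⟨hs, ht⟩
  have hinj : ∀ s t, s ∈ Set.Icc (0 : ℝ) 1 → t ∈ Set.Icc (0 : ℝ) 1 →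
      (K'.curve s = K'.curve t ↔ K.curve s = K.curve t) := by
    intro s t hs ht
    obtain ⟨G, hG, hl, hr⟩ := hFG 1 m1
    rw [hcurve s hs, hcurve t ht]
    exact hl.injective.eq_iff
  have hcross : ∀ c, c ∈ K'.crossings ↔ c ∈ K.crossings := by
    intro c
    rw [K.mem_crossings, K'.mem_crossings]
    constructor
    · rintro ⟨⟨c1, c2, c3, c4⟩, c5⟩
      have c4' := (hinj _ _ c1 c2).1 c4
      rw [hover c.1 ⟨c1, c.2, c2, c3.symm, c4'.symm⟩] at c5
      exact ⟨⟨c1, c2, c3, c4'⟩, c5⟩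
    · rintro ⟨⟨c1, c2, c3, c4⟩, c5⟩
      rw [← hover c.1 ⟨c1, c.2, c2, c3.symm, c4.symm⟩] at c5
      exact ⟨⟨c1, c2, c3, (hinj _ _ c1 c2).2 c4⟩, c5⟩
  refine H.value_congr (φ := id) strictMonoOn_id (fun c hc => (hcross c).1 hc)
    (fun d hd => ⟨d, (hcross d).2 hd, rfl⟩) ?_ ?_
  · intro c hc
    obtain ⟨⟨c1, c2, c3, c4⟩, c5⟩ := K.mem_crossings.1 ((hcross c).1 hc)
    simp only [BiframedDiagram.level, id, hK _ c1, hK _ c2, hK' _ c1, hK' _ c2]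
    refine floor_div_pi_const (f := fun s => Θ (s, c.2) - Θ (s, c.1)) Set.ordConnected_Icc
      ((hΘt _ c2).sub (hΘt _ c1)) ?_ m0 m1
    intro s hs
    have h1 : planeDet (v (s, c.1)) (v (s, c.2)) ≠ 0 := by
      rw [hv', hv', c4]
      exact planeDet_map_ne_zero (L := ((D (s, K.curve c.2)).comp
        (ContinuousLinearMap.inr ℝ ℝ ℂ)).toLinearMap) (hDinj s hs _)
        (K.transverse _ c1 _ c2 c3 c4)
    have h2 := planeDet_eq_sin (hΘ s hs).1 (hΘ s hs).1 c1 c2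
    rw [h2] at h1
    exact right_ne_zero_of_mul h1
  · simp only [BiframedDiagram.rotation, hK 1 m1, hK' 1 m1]
    congr 1
    refine halfTurns_const (f := fun s => Θ (s, 1)) Set.ordConnected_Icc (hΘt 1 m1) ?_ m0 m1
    intro s hs
    have h1 := (hdown s hs).2.2
    rw [hvd s hs 1 m1] at h1
    have h2 := (hΘ s hs).1.im_eq m1
    rw [h2] at h1
    intro h3
    simp [h3] at h1

end RibbonStructure

end

/-! ### Shears: every diagram is isotopic to a decomposed one. -/

noncomputable section

/-- The shear of the plane that keeps vertical vectors and adds `c` times the horizontal coordinate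
to the vertical one. -/
def planeShear (c : ℝ) : ℂ →L[ℝ] ℂ :=
  ContinuousLinearMap.id ℝ ℂ + (c • Complex.reCLM).smulRight Complex.I

lemma planeShear_apply (c : ℝ) (z : ℂ) : planeShear c z = z + (c * z.re : ℝ) * Complex.I := by
  simp [planeShear]

@[simp] lemma planeShear_re (c : ℝ) (z : ℂ) : (planeShear c z).re = z.re := by
  simp [planeShear_apply]

@[simp] lemma planeShear_im (c : ℝ) (z : ℂ) : (planeShear c z).im = z.im + c * z.re := by
  simp [planeShear_apply]

lemma planeShear_neg_apply (c : ℝ) (z : ℂ) : planeShear (-c) (planeShear c z) = z := by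
  apply Complex.ext <;> simp

lemma planeShear_injective (c : ℝ) : Function.Injective (planeShear c) :=
  Function.LeftInverse.injective (planeShear_neg_apply c)

lemma PointsDown.planeShear {z : ℂ} (h : PointsDown z) (c : ℝ) : PointsDown (planeShear c z) := by
  refine ⟨by simpa using h.1, ?_⟩
  rw [planeShear_im, h.1, mul_zero, add_zero]
  exact h.2

namespace BiframedDiagram

variable (K : BiframedDiagram)

lemma derivWithin_shear_curve (c : ℝ) {t : ℝ} (ht : t ∈ Set.Icc (0 : ℝ) 1) :
    derivWithin (fun t => planeShear c (K.curve t)) (Set.Icc 0 1) t =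
      planeShear c (K.velocity t) := by
  have d2 : HasDerivWithinAt K.curve (K.velocity t) (Set.Icc 0 1) t :=
    (K.smooth.differentiableOn (by simp) _ ht).hasDerivWithinAt
  exact ((planeShear c).hasFDerivAt.comp_hasDerivWithinAt t d2).derivWithin
    (uniqueDiffOn_Icc zero_lt_one t ht)

/-- The image of a diagram under a shear. -/
def shear (c : ℝ) : BiframedDiagram where
  curve t := planeShear c (K.curve t)
  isOver := K.isOver
  smooth := (planeShear c).contDiff.comp_contDiffOn K.smooth
  immersed t ht := by
    rw [K.derivWithin_shear_curve c ht]
    exact fun h => K.velocity_ne_zero ht (planeShear_injective c (h.trans (map_zero _).symm))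
  transverse s hs t ht hst h := by
    rw [K.derivWithin_shear_curve c ht, K.derivWithin_shear_curve c hs]
    exact planeDet_map_ne_zero (L := (planeShear c).toLinearMap) (planeShear_injective c)
      (K.transverse s hs t ht hst (planeShear_injective c h))
  no_triple r hr s hs t ht h h' := K.no_triple r hr s hs t ht (planeShear_injective c h)
    (planeShear_injective c h')
  finite_double := by
    refine K.finite_double.subset ?_
    rintro p ⟨h1, h2, h3, h4⟩
    exact ⟨h1, h2, h3, planeShear_injective c h4⟩
  leg_simple t ht h := K.leg_simple t ht (planeShear_injective c h)
  head_simple t ht h := K.head_simple t ht (planeShear_injective c h)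
  over_under s hs t ht hst h := K.over_under s hs t ht hst (planeShear_injective c h)
  leg_down := by
    change PointsDown (derivWithin _ _ _)
    rw [K.derivWithin_shear_curve c (by simp)]
    exact K.leg_down.planeShear c
  head_down := by
    change PointsDown (derivWithin _ _ _)
    rw [K.derivWithin_shear_curve c (by simp)]
    exact K.head_down.planeShear c

lemma ambientIsotopic_shear (c : ℝ) : AmbientIsotopic K (K.shear c) := by
  refine ⟨fun s z => planeShear (s * c) z, ?_, ?_, ?_, ?_, ?_, ?_⟩
  · simp only [planeShear_apply]
    have h1 : ContDiff ℝ ∞ fun p : ℝ × ℂ => p.2.re := Complex.reCLM.contDiff.comp contDiff_snd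
    have h2 : ContDiff ℝ ∞ fun p : ℝ × ℂ => ((p.1 * c * p.2.re : ℝ) : ℂ) :=
      Complex.ofRealCLM.contDiff.comp ((contDiff_fst.mul contDiff_const).mul h1)
    exact (contDiff_snd.add (h2.mul contDiff_const)).contDiffOn
  · intro z
    simp [planeShear_apply]
  · intro s _
    refine ⟨planeShear (-(s * c)), (planeShear _).contDiff, planeShear_neg_apply _, ?_⟩
    intro z
    have := planeShear_neg_apply (-(s * c)) z
    rwa [neg_neg] at this
  · intro s _
    rw [K.derivWithin_shear_curve _ (by simp), K.derivWithin_shear_curve _ (by simp)]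
    exact ⟨K.leg_down.planeShear _, K.head_down.planeShear _⟩
  · intro t _
    simp [shear]
  · intro t _
    rfl

lemma shear_velocity (c : ℝ) {t : ℝ} (ht : t ∈ Set.Icc (0 : ℝ) 1) :
    (K.shear c).velocity t = planeShear c (K.velocity t) :=
  K.derivWithin_shear_curve c ht

lemma shear_acceleration (c : ℝ) {t : ℝ} (ht : t ∈ Set.Icc (0 : ℝ) 1) :
    (K.shear c).acceleration t = planeShear c (K.acceleration t) := by
  have h : Set.EqOn (K.shear c).velocity (fun t => planeShear c (K.velocity t)) (Set.Icc 0 1) :=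
    fun t ht => K.shear_velocity c ht
  rw [KnotoidDiagram.acceleration, derivWithin_congr h (h ht)]
  exact ((planeShear c).hasFDerivAt.comp_hasDerivWithinAt t
    (hasDerivWithinAt_velocity ht)).derivWithin (uniqueDiffOn_Icc zero_lt_one t ht)

/-- Infinitely many zeros would accumulate in the compact interval. The accumulation point is a zero
by continuity, but zeros with nonzero derivative are isolated. -/
lemma finite_zeros_of_hasDerivWithinAt {h h' : ℝ → ℝ}
    (hd : ∀ t ∈ Set.Icc (0 : ℝ) 1, HasDerivWithinAt h (h' t) (Set.Icc 0 1) t)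
    (h0 : ∀ t ∈ Set.Icc (0 : ℝ) 1, h t = 0 → h' t ≠ 0) :
    {t | t ∈ Set.Icc (0 : ℝ) 1 ∧ h t = 0}.Finite := by
  by_contra hinf
  obtain ⟨x, hx, hacc⟩ := Set.Infinite.exists_accPt_of_subset_isCompact hinf isCompact_Icc
    (fun t ht => ht.1)
  have hsub : nhdsWithin x {x}ᶜ ⊓ Filter.principal {t | t ∈ Set.Icc (0 : ℝ) 1 ∧ h t = 0} ≤
      nhdsWithin x (Set.Icc 0 1 \ {x}) := by
    rw [nhdsWithin, inf_assoc, Filter.inf_principal]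
    refine inf_le_inf_left _ (Filter.principal_mono.2 ?_)
    rintro t ⟨h1, h2⟩
    exact ⟨h2.1, h1⟩
  have hz : ∀ᶠ t in nhdsWithin x {x}ᶜ ⊓
      Filter.principal {t | t ∈ Set.Icc (0 : ℝ) 1 ∧ h t = 0}, h t = 0 :=
    Filter.Eventually.filter_mono inf_le_right (Filter.eventually_principal.2 fun t ht => ht.2)
  have hx0 : h x = 0 := by
    have hc : Filter.Tendsto h (nhdsWithin x {x}ᶜ ⊓
        Filter.principal {t | t ∈ Set.Icc (0 : ℝ) 1 ∧ h t = 0}) (nhds (h x)) :=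
      ((hd x hx).continuousWithinAt).mono_left
        (hsub.trans (nhdsWithin_mono x Set.sdiff_subset))
    have : (nhdsWithin x {x}ᶜ ⊓
        Filter.principal {t | t ∈ Set.Icc (0 : ℝ) 1 ∧ h t = 0}).NeBot := hacc
    exact tendsto_nhds_unique (hc.congr' hz) tendsto_const_nhds |>.symm ▸ rfl
  have hne := (hd x hx).eventually_ne (c := 0) (h0 x hx hx0)
  have : (nhdsWithin x {x}ᶜ ⊓
      Filter.principal {t | t ∈ Set.Icc (0 : ℝ) 1 ∧ h t = 0}).NeBot := hacc
  obtain ⟨t, ht, ht'⟩ := ((hne.filter_mono hsub).and hz).exists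
  exact ht ht'

/-- Almost every shear of a diagram is decomposed. -/
theorem exists_shear_isDecomposed : ∃ c : ℝ, (K.shear c).IsDecomposed := by
  -- The shear with parameter m t is the one that makes the tangent at t horizontal; S consists of
  -- the times at which this produces a degenerate critical point.
  set m : ℝ → ℝ := fun t => -(K.velocity t).im / (K.velocity t).re with hm
  set S : Set ℝ := {t | t ∈ Set.Icc (0 : ℝ) 1 ∧ (K.velocity t).re ≠ 0 ∧
    (K.acceleration t).im + m t * (K.acceleration t).re = 0} with hS
  -- On S the derivative of m vanishes, so the set of bad parameters is null by Sard's theorem in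
  -- dimension one. The crossing times are finite in number and exclude only finitely many further
  -- parameters.
  have hS0 : MeasureTheory.volume (m '' S) = 0 := by
    refine MeasureTheory.addHaar_image_eq_zero_of_det_fderivWithin_eq_zero
      (f' := fun _ => 0) MeasureTheory.volume ?_ ?_
    · rintro t ⟨ht, hre, h0⟩
      have d1 := hasDerivWithinAt_velocity (K := K) ht
      have dre : HasDerivWithinAt (fun t => (K.velocity t).re) (K.acceleration t).re
        (Set.Icc 0 1) t := Complex.reCLM.hasFDerivAt.comp_hasDerivWithinAt t d1
      have dim : HasDerivWithinAt (fun t => (K.velocity t).im) (K.acceleration t).im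
        (Set.Icc 0 1) t := Complex.imCLM.hasFDerivAt.comp_hasDerivWithinAt t d1
      have d2 := (dim.neg.div dre hre).mono (fun s hs => hs.1 : S ⊆ Set.Icc 0 1)
      have d3 : HasDerivWithinAt m 0 S t := by
        convert! d2 using 1
        simp only [hm, Pi.neg_apply] at h0 ⊢
        field_simp at h0 ⊢
        linear_combination h0
      convert! d3.hasFDerivWithinAt using 1
      ext; simp
    · intro t _
      simp [ContinuousLinearMap.det]
  have hT0 : MeasureTheory.volume (m '' {t | K.IsCrossingTime t}) = 0 := by
    refine Set.Finite.measure_zero (Set.Finite.image _ ?_) _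
    refine (siteTimes K.overTime K.underTime).finite_toSet.subset ?_
    intro t ht
    obtain ⟨c, hc, h⟩ := K.isCrossingTime_iff.1 ht
    exact Finset.mem_coe.2 (mem_siteTimes.2 ⟨⟨c, hc⟩, h⟩)
  obtain ⟨c, hc⟩ : ∃ c, c ∉ m '' S ∪ m '' {t | K.IsCrossingTime t} := by
    by_contra hcon
    push Not at hcon
    have h1 := MeasureTheory.measure_union_null hS0 hT0
    rw [Set.eq_univ_of_forall hcon] at h1
    simp at h1
  rw [Set.mem_union, not_or] at hc
  -- Vertical tangents stay vertical under a shear, so a tangent that becomes horizontal has nonzero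
  -- real part and its time has m t = c.
  have hzero : ∀ t ∈ Set.Icc (0 : ℝ) 1, (K.velocity t).im + c * (K.velocity t).re = 0 →
      (K.velocity t).re ≠ 0 ∧ m t = c := by
    intro t ht h
    have hre : (K.velocity t).re ≠ 0 := by
      intro hre
      rw [hre, mul_zero, add_zero] at h
      exact K.velocity_ne_zero ht (Complex.ext hre h)
    refine ⟨hre, ?_⟩
    rw [hm]
    simp only
    rw [div_eq_iff hre]
    linarith
  have hnondeg : ∀ t ∈ Set.Icc (0 : ℝ) 1, ((K.shear c).velocity t).im = 0 →
      ((K.shear c).acceleration t).im ≠ 0 := by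
    intro t ht h h'
    rw [K.shear_velocity c ht, planeShear_im] at h
    rw [K.shear_acceleration c ht, planeShear_im] at h'
    obtain ⟨h1, h2⟩ := hzero t ht h
    exact hc.1 ⟨t, ⟨ht, h1, by rw [h2]; exact h'⟩, h2⟩
  refine ⟨c, ?_, hnondeg, ?_⟩
  · exact finite_zeros_of_hasDerivWithinAt (h := fun t => ((K.shear c).velocity t).im)
      (fun t ht => Complex.imCLM.hasFDerivAt.comp_hasDerivWithinAt t
        (hasDerivWithinAt_velocity ht)) hnondeg
  · intro t ht h
    have ht' : K.IsCrossingTime t := by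
      obtain ⟨h1, s, hs, hst, h2⟩ := ht
      exact ⟨h1, s, hs, hst, planeShear_injective c h2⟩
    rw [K.shear_velocity c ht'.1, planeShear_im] at h
    exact hc.2 ⟨t, ht', (hzero t ht'.1 h).2⟩

end BiframedDiagram

end

/-! ### Diagrams that differ only in a window. -/

noncomputable section

/-- Angles at a distance less than π have counts that differ by at most 1, and the equal parities
exclude a difference of 1. -/
lemma eq_halfTurns_of_abs_sub_lt {x y : ℝ} (h : |x - y| < Real.pi)
    (he : Even (halfTurns x) ↔ Even (halfTurns y)) : halfTurns x = halfTurns y := by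
  obtain ⟨x1, x2⟩ := halfTurns_spec x
  obtain ⟨y1, y2⟩ := halfTurns_spec y
  obtain ⟨h1, h2⟩ := abs_lt.1 h
  have hpi := Real.pi_pos
  have a1 : (halfTurns x : ℝ) < halfTurns y + 2 := by
    by_contra hcon
    push Not at hcon
    nlinarith [mul_le_mul_of_nonneg_right hcon hpi.le]
  have a2 : (halfTurns y : ℝ) < halfTurns x + 2 := by
    by_contra hcon
    push Not at hcon
    nlinarith [mul_le_mul_of_nonneg_right hcon hpi.le]
  have b1 : halfTurns x < halfTurns y + 2 := by exact_mod_cast a1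
  have b2 : halfTurns y < halfTurns x + 2 := by exact_mod_cast a2
  rw [Int.even_iff, Int.even_iff] at he
  omega

namespace Window

variable {W : Window} {J : Set ℝ} {K K' : BiframedDiagram}

/-! ### Comparison of two diagrams that differ in a window -/

lemma DifferOnlyIn.mono_set (h : W.DifferOnlyIn J K K') {J' : Set ℝ}
    (hJ : ∀ t ∈ Set.Icc (0 : ℝ) 1, t ∈ J' ↔ t ∈ J) : W.DifferOnlyIn J' K K' := by
  obtain ⟨h1, h2, h3, h4⟩ := h
  refine ⟨fun t ht => (hJ t ht).trans (h1 t ht), fun t ht => (hJ t ht).trans (h2 t ht),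
    fun t ht htJ => h3 t ht (fun h => htJ ((hJ t ht).2 h)),
    fun t htJ ht => h4 t (fun h => htJ ((hJ t ht.1).2 h)) ht⟩

lemma DifferOnlyIn.mem_iff (h : W.DifferOnlyIn J K K') {s t : ℝ} (hs : s ∈ Set.Icc (0 : ℝ) 1)
    (ht : t ∈ Set.Icc (0 : ℝ) 1) (hst : K.curve s = K.curve t) : s ∈ J ↔ t ∈ J := by
  rw [h.1 s hs, h.1 t ht, hst]

lemma DifferOnlyIn.symm (h : W.DifferOnlyIn J K K') : W.DifferOnlyIn J K' K := by
  obtain ⟨h1, h2, h3, h4⟩ := h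
  refine ⟨h2, h1, fun t ht htJ => (h3 t ht htJ).symm, ?_⟩
  rintro t htJ ⟨ht, s, hs, hst, hcu⟩
  have hsJ : s ∉ J := by
    rwa [h2 s hs, hcu, ← h2 t ht]
  refine (h4 t htJ ⟨ht, s, hs, hst, ?_⟩).symm
  rw [← h3 s hs hsJ, ← h3 t ht htJ, hcu]

lemma DifferOnlyIn.mem_crossings (h : W.DifferOnlyIn J K K') {c : ℝ × ℝ}
    (hc : c ∈ K.crossings) (hcJ : c.1 ∉ J) : c ∈ K'.crossings := by
  have hct := KnotoidDiagram.isCrossingTime_fst hc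
  obtain ⟨⟨h1, h2, h3, h4⟩, h5⟩ := K.mem_crossings.1 hc
  have hcJ2 : c.2 ∉ J := by rwa [← h.mem_iff h1 h2 h4]
  refine K'.mem_crossings.2 ⟨⟨h1, h2, h3, ?_⟩, ?_⟩
  · rw [h.2.2.1 _ h1 hcJ, h.2.2.1 _ h2 hcJ2, h4]
  · rw [h.2.2.2 _ hcJ hct, h5]

lemma DifferOnlyIn.velocity_eq (h : W.DifferOnlyIn J K K') (hJ : IsClosed J) {t : ℝ}
    (ht : t ∈ Set.Icc (0 : ℝ) 1) (htJ : t ∉ J) : K'.velocity t = K.velocity t := by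
  refine Filter.EventuallyEq.derivWithin_eq ?_ (h.2.2.1 t ht htJ)
  filter_upwards [self_mem_nhdsWithin, nhdsWithin_le_nhds (hJ.isOpen_compl.mem_nhds htJ)]
    with s hs hsJ
  exact h.2.2.1 s hs hsJ

/-- Continuity carries the agreement outside J to its boundary. In this way the strands of both
diagrams have the same end-points. -/
lemma DifferOnlyIn.curve_eq (h : W.DifferOnlyIn J K K') {t : ℝ} (ht : t ∈ Set.Icc (0 : ℝ) 1)
    (htJ : t ∈ closure (Set.Icc (0 : ℝ) 1 \ J)) : K'.curve t = K.curve t := by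
  have hE : Set.EqOn K'.curve K.curve (Set.Icc (0 : ℝ) 1 \ J) := fun s hs => h.2.2.1 s hs.1 hs.2
  exact hE.of_subset_closure (t := Set.Icc (0 : ℝ) 1 ∩ closure (Set.Icc (0 : ℝ) 1 \ J))
    (K'.smooth.continuousOn.mono Set.inter_subset_left)
    (K.smooth.continuousOn.mono Set.inter_subset_left)
    (fun s hs => ⟨hs.1, subset_closure hs⟩) Set.inter_subset_right ⟨ht, htJ⟩

lemma left_mem_closure {a b : ℝ} (ha : 0 < a) (hab : a < b) (hb : b < 1) {C : Set ℝ}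
    (hC : IsClosed C) (hd : Disjoint (Set.Icc a b) C) :
    a ∈ closure (Set.Icc (0 : ℝ) 1 \ (Set.Icc a b ∪ C)) := by
  have haC : a ∉ C := Set.disjoint_left.1 hd (Set.left_mem_Icc.2 hab.le)
  rw [mem_closure_iff_frequently]
  refine Filter.Frequently.filter_mono (Filter.Eventually.frequently ?_)
    (nhdsWithin_le_nhds (s := Set.Iio a))
  filter_upwards [self_mem_nhdsWithin, nhdsWithin_le_nhds (hC.isOpen_compl.mem_nhds haC),
    nhdsWithin_le_nhds (Ioi_mem_nhds ha)] with s h1 h2 h3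
  refine ⟨⟨le_of_lt h3, (le_of_lt h1).trans (hab.trans hb).le⟩, ?_⟩
  rintro (h | h)
  · exact absurd h.1 (not_le.2 h1)
  · exact h2 h

lemma right_mem_closure {a b : ℝ} (ha : 0 < a) (hab : a < b) (hb : b < 1) {C : Set ℝ}
    (hC : IsClosed C) (hd : Disjoint (Set.Icc a b) C) :
    b ∈ closure (Set.Icc (0 : ℝ) 1 \ (Set.Icc a b ∪ C)) := by
  have haC : b ∉ C := Set.disjoint_left.1 hd (Set.right_mem_Icc.2 hab.le)
  rw [mem_closure_iff_frequently]
  refine Filter.Frequently.filter_mono (Filter.Eventually.frequently ?_)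
    (nhdsWithin_le_nhds (s := Set.Ioi b))
  filter_upwards [self_mem_nhdsWithin, nhdsWithin_le_nhds (hC.isOpen_compl.mem_nhds haC),
    nhdsWithin_le_nhds (Iio_mem_nhds hb)] with s h1 h2 h3
  refine ⟨⟨(ha.trans hab).le.trans (le_of_lt h1), le_of_lt h3⟩, ?_⟩
  rintro (h | h)
  · exact absurd h.2 (not_le.2 h1)
  · exact h2 h

/-- The velocities agree outside J and lie in common half-planes during J, so they are never
opposite to each other. -/
lemma DifferOnlyIn.abs_angle_sub_lt (h : W.DifferOnlyIn J K K') (hJ : IsClosed J)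
    (hv : ∀ t ∈ Set.Icc (0 : ℝ) 1, t ∈ J → InHalfPlane (K.velocity t) (K'.velocity t)) {t : ℝ}
    (ht : t ∈ Set.Icc (0 : ℝ) 1) : |K'.angle t - K.angle t| < Real.pi := by
  refine K.isAngle.abs_sub_lt K'.isAngle le_rfl le_rfl (s := 0) (by simp) ?_ ?_ t ht
  · rw [K.angle_zero, K'.angle_zero, sub_self, abs_zero]
    exact Real.pi_pos
  · intro t ht
    by_cases htJ : t ∈ J
    · exact hv t ht htJ
    · rw [h.velocity_eq hJ ht htJ]
      exact InHalfPlane.refl (K.velocity_ne_zero ht)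

lemma DifferOnlyIn.angle_eq (h : W.DifferOnlyIn J K K') (hJ : IsClosed J)
    (hv : ∀ t ∈ Set.Icc (0 : ℝ) 1, t ∈ J → InHalfPlane (K.velocity t) (K'.velocity t)) {t : ℝ}
    (ht : t ∈ Set.Icc (0 : ℝ) 1) (htJ : t ∉ J) : K'.angle t = K.angle t :=
  K.isAngle.eq_of_abs_sub_lt K'.isAngle ht (h.velocity_eq hJ ht htJ).symm
    (K.velocity_ne_zero ht) (h.abs_angle_sub_lt hJ hv ht)

/-! ### Directions and strands in a window -/

lemma direction_eq (W : Window) (K : BiframedDiagram) {t : ℝ} (ht : t ∈ Set.Icc (0 : ℝ) 1) :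
    W.direction (K.velocity t) = (‖K.velocity t‖ / ‖W.scale‖ : ℝ) *
      Complex.exp ((K.angle t - W.scale.arg : ℝ) * Complex.I) := by
  have h2 : (‖W.scale‖ : ℂ) ≠ 0 := by exact_mod_cast norm_ne_zero_iff.2 W.scale_ne_zero
  rw [direction, div_eq_iff W.scale_ne_zero]
  nth_rw 3 [← Complex.norm_mul_exp_arg_mul_I W.scale]
  nth_rw 1 [K.isAngle.eq t ht]
  have : ((K.angle t : ℝ) : ℂ) * Complex.I = ((K.angle t - W.scale.arg : ℝ) : ℂ) * Complex.I +
      W.scale.arg * Complex.I := by push_cast; ring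
  rw [this, Complex.exp_add]
  push_cast
  field_simp

lemma direction_im (W : Window) (K : BiframedDiagram) {t : ℝ} (ht : t ∈ Set.Icc (0 : ℝ) 1) :
    (W.direction (K.velocity t)).im =
      ‖K.velocity t‖ / ‖W.scale‖ * Real.sin (K.angle t - W.scale.arg) := by
  rw [W.direction_eq K ht, Complex.im_ofReal_mul, Complex.exp_ofReal_mul_I_im]

lemma direction_re (W : Window) (K : BiframedDiagram) {t : ℝ} (ht : t ∈ Set.Icc (0 : ℝ) 1) :
    (W.direction (K.velocity t)).re =
      ‖K.velocity t‖ / ‖W.scale‖ * Real.cos (K.angle t - W.scale.arg) := by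
  rw [W.direction_eq K ht, Complex.re_ofReal_mul, Complex.exp_ofReal_mul_I_re]

lemma norm_div_pos (W : Window) (K : BiframedDiagram) {t : ℝ} (ht : t ∈ Set.Icc (0 : ℝ) 1) :
    0 < ‖K.velocity t‖ / ‖W.scale‖ :=
  div_pos (norm_pos_iff.2 (K.velocity_ne_zero ht)) (norm_pos_iff.2 W.scale_ne_zero)

lemma inHalfPlane_of_im_neg {z w : ℂ} (hz : (W.direction z).im < 0)
    (hw : (W.direction w).im < 0) : InHalfPlane z w := by
  refine ⟨Complex.I / W.scale, ?_, ?_⟩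
  · rw [mul_div_assoc', mul_comm z, ← mul_div_assoc', Complex.I_mul_re]
    exact neg_pos.2 hz
  · rw [mul_div_assoc', mul_comm w, ← mul_div_assoc', Complex.I_mul_re]
    exact neg_pos.2 hw

lemma inHalfPlane_of_im_pos {z w : ℂ} (hz : 0 < (W.direction z).im)
    (hw : 0 < (W.direction w).im) : InHalfPlane z w := by
  refine ⟨-Complex.I / W.scale, ?_, ?_⟩
  · rw [mul_div_assoc', mul_comm z, ← mul_div_assoc', neg_mul, Complex.neg_re, Complex.I_mul_re,
      neg_neg]
    exact hz
  · rw [mul_div_assoc', mul_comm w, ← mul_div_assoc', neg_mul, Complex.neg_re, Complex.I_mul_re,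
      neg_neg]
    exact hw

lemma hasDerivWithinAt_coord (W : Window) (K : BiframedDiagram) {t : ℝ}
    (ht : t ∈ Set.Icc (0 : ℝ) 1) : HasDerivWithinAt (fun t => W.coord (K.curve t))
      (W.direction (K.velocity t)) (Set.Icc 0 1) t :=
  ((K.smooth.differentiableOn (by simp) _ ht).hasDerivWithinAt.sub_const _).div_const _

/-- The height of the diagram in the window. -/
def height (W : Window) (K : BiframedDiagram) (t : ℝ) : ℝ := (W.coord (K.curve t)).im

lemma hasDerivWithinAt_height (W : Window) (K : BiframedDiagram) {t : ℝ}
    (ht : t ∈ Set.Icc (0 : ℝ) 1) : HasDerivWithinAt (W.height K)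
      (W.direction (K.velocity t)).im (Set.Icc 0 1) t :=
  Complex.imCLM.hasFDerivAt.comp_hasDerivWithinAt t (W.hasDerivWithinAt_coord K ht)

lemma continuousOn_height (W : Window) (K : BiframedDiagram) :
    ContinuousOn (W.height K) (Set.Icc 0 1) :=
  fun _ ht => (W.hasDerivWithinAt_height K ht).continuousWithinAt

lemma height_eq_of_curve_eq (W : Window) {s t : ℝ} (h : K.curve s = K.curve t) :
    W.height K s = W.height K t := by rw [height, h, height]

lemma strictAntiOn_height {a b : ℝ} (ha : 0 ≤ a) (hb : b ≤ 1)
    (h : ∀ t ∈ Set.Ioo a b, (W.direction (K.velocity t)).im < 0) :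
    StrictAntiOn (W.height K) (Set.Icc a b) := by
  refine strictAntiOn_of_deriv_neg (convex_Icc a b)
    ((W.continuousOn_height K).mono (Set.Icc_subset_Icc ha hb)) ?_
  intro t ht
  rw [interior_Icc] at ht
  have ht0 : t ∈ Set.Ioo (0 : ℝ) 1 := ⟨ha.trans_lt ht.1, ht.2.trans_le hb⟩
  rw [((W.hasDerivWithinAt_height K (Set.Ioo_subset_Icc_self ht0)).hasDerivAt
    (Icc_mem_nhds ht0.1 ht0.2)).deriv]
  exact h t ht

lemma strictMonoOn_height {a b : ℝ} (ha : 0 ≤ a) (hb : b ≤ 1)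
    (h : ∀ t ∈ Set.Ioo a b, 0 < (W.direction (K.velocity t)).im) :
    StrictMonoOn (W.height K) (Set.Icc a b) := by
  refine strictMonoOn_of_deriv_pos (convex_Icc a b)
    ((W.continuousOn_height K).mono (Set.Icc_subset_Icc ha hb)) ?_
  intro t ht
  rw [interior_Icc] at ht
  have ht0 : t ∈ Set.Ioo (0 : ℝ) 1 := ⟨ha.trans_lt ht.1, ht.2.trans_le hb⟩
  rw [((W.hasDerivWithinAt_height K (Set.Ioo_subset_Icc_self ht0)).hasDerivAt
    (Icc_mem_nhds ht0.1 ht0.2)).deriv]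
  exact h t ht

/-- The number of half-turns of the diagram with respect to the window. -/
def turns (W : Window) (K : BiframedDiagram) (t : ℝ) : ℤ :=
  halfTurns (K.angle t - W.scale.arg)

lemma turns_even_iff (W : Window) (K : BiframedDiagram) {t : ℝ} (ht : t ∈ Set.Icc (0 : ℝ) 1)
    (h : (W.direction (K.velocity t)).im ≠ 0) :
    Even (W.turns K t) ↔ (W.direction (K.velocity t)).im < 0 := by
  have hn := W.norm_div_pos K ht
  rw [W.direction_im K ht] at h ⊢
  rcases lt_or_gt_of_ne (right_ne_zero_of_mul h) with h' | h'
  · exact ⟨fun _ => mul_neg_of_pos_of_neg hn h', fun _ => halfTurns_even_of_sin_neg h'⟩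
  · constructor
    · intro he
      exact absurd he (Int.not_even_iff_odd.2 (halfTurns_odd_of_sin_pos h'))
    · intro hl
      exact absurd hl (not_lt.2 (mul_pos hn h').le)

lemma turns_const (W : Window) (K : BiframedDiagram) {s : Set ℝ} (hs : s.OrdConnected)
    (h01 : s ⊆ Set.Icc 0 1) (h : ∀ t ∈ s, (W.direction (K.velocity t)).im ≠ 0) {x y : ℝ}
    (hx : x ∈ s) (hy : y ∈ s) : W.turns K x = W.turns K y := by
  refine halfTurns_const (f := fun t => K.angle t - W.scale.arg) hs
    ((K.isAngle.cont.mono h01).sub continuousOn_const) ?_ hx hy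
  intro t ht h0
  apply h t ht
  rw [W.direction_im K (h01 ht), h0, mul_zero]

namespace IsStrand

variable {a b : ℝ}

lemma bounds (h : W.IsStrand K a b) : 0 < a ∧ a < b ∧ b < 1 := by
  rcases h with ⟨⟨h1, h2, h3, -⟩, -⟩ | ⟨⟨h1, h2, h3, -⟩, -⟩ <;> exact ⟨h1, h2, h3⟩

lemma subset (h : W.IsStrand K a b) : Set.Icc a b ⊆ Set.Icc 0 1 :=
  Set.Icc_subset_Icc h.bounds.1.le h.bounds.2.2.le

lemma im_ne_zero (h : W.IsStrand K a b) {t : ℝ} (ht : t ∈ Set.Icc a b) :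
    (W.direction (K.velocity t)).im ≠ 0 := by
  rcases h with ⟨-, h⟩ | ⟨-, h⟩
  exacts [(h t ht).ne, (h t ht).ne']

lemma turns_eq (h : W.IsStrand K a b) {t : ℝ} (ht : t ∈ Set.Icc a b) :
    W.turns K t = W.turns K a :=
  W.turns_const K Set.ordConnected_Icc h.subset (fun _ ht => h.im_ne_zero ht) ht
    (Set.left_mem_Icc.2 h.bounds.2.1.le)

lemma cases (h : W.IsStrand K a b) :
    (Even (W.turns K a) ∧ StrictAntiOn (W.height K) (Set.Icc a b) ∧ W.height K a = 1 ∧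
      W.height K b = -1) ∨
    (¬ Even (W.turns K a) ∧ StrictMonoOn (W.height K) (Set.Icc a b) ∧ W.height K a = -1 ∧
      W.height K b = 1) := by
  have ha : a ∈ Set.Icc a b := Set.left_mem_Icc.2 h.bounds.2.1.le
  rw [W.turns_even_iff K (h.subset ha) (h.im_ne_zero ha)]
  have h' := h
  rcases h with ⟨h1, h2⟩ | ⟨h1, h2⟩
  · exact Or.inl ⟨h2 a ha, strictAntiOn_height h'.bounds.1.le h'.bounds.2.2.le
      (fun t ht => h2 t (Set.Ioo_subset_Icc_self ht)), h1.2.2.2.2⟩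
  · exact Or.inr ⟨not_lt.2 (h2 a ha).le, strictMonoOn_height h'.bounds.1.le h'.bounds.2.2.le
      (fun t ht => h2 t (Set.Ioo_subset_Icc_self ht)), h1.2.2.2.2⟩

lemma injOn (h : W.IsStrand K a b) : Set.InjOn (W.height K) (Set.Icc a b) := by
  rcases h.cases with ⟨-, h, -⟩ | ⟨-, h, -⟩
  exacts [h.injOn, h.injOn]

lemma neg_one_zpow_mul_im_neg (h : W.IsStrand K a b) {t : ℝ} (ht : t ∈ Set.Icc a b) :
    (-1 : ℝ) ^ W.turns K a * (W.direction (K.velocity t)).im < 0 := by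
  have he := W.turns_even_iff K (h.subset ht) (h.im_ne_zero ht)
  rw [h.turns_eq ht] at he
  rcases Int.even_or_odd (W.turns K a) with h' | h'
  · rw [h'.neg_one_zpow, one_mul]
    exact he.1 h'
  · rw [h'.neg_one_zpow, neg_one_mul, neg_neg_iff_pos]
    exact lt_of_le_of_ne (not_lt.1 fun hl => Int.not_even_iff_odd.2 h' (he.2 hl))
      (h.im_ne_zero ht).symm

/-- The common starting point is on the top side or on the bottom side of the window, so both
strands descend or both ascend. -/
lemma inHalfPlane (h : W.IsStrand K a b) (h' : W.IsStrand K' a b)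
    (hc : K'.curve a = K.curve a) {t : ℝ} (ht : t ∈ Set.Icc a b) :
    InHalfPlane (K.velocity t) (K'.velocity t) := by
  have hc' : W.height K' a = W.height K a := by rw [height, hc, height]
  rcases h with ⟨h1, h2⟩ | ⟨h1, h2⟩
  · rcases h' with ⟨h1', h2'⟩ | ⟨h1', h2'⟩
    · exact inHalfPlane_of_im_neg (h2 t ht) (h2' t ht)
    · have e1 := h1.2.2.2.2.1
      have e2 := h1'.2.2.2.2.1
      rw [height, height] at hc'
      linarith
  · rcases h' with ⟨h1', h2'⟩ | ⟨h1', h2'⟩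
    · have e1 := h1.2.2.2.2.1
      have e2 := h1'.2.2.2.2.1
      rw [height, height] at hc'
      linarith
    · exact inHalfPlane_of_im_pos (h2 t ht) (h2' t ht)

lemma turns_eq_turns (h : W.IsStrand K a b) (h' : W.IsStrand K' a b)
    (hc : K'.curve a = K.curve a) (hlt : |K'.angle a - K.angle a| < Real.pi) :
    W.turns K' a = W.turns K a := by
  have hc' : W.height K' a = W.height K a := by rw [height, hc, height]
  refine eq_halfTurns_of_abs_sub_lt (by rwa [sub_sub_sub_cancel_right]) ?_
  change Even (W.turns K' a) ↔ Even (W.turns K a)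
  rcases h.cases with ⟨h1, -, h2, -⟩ | ⟨h1, -, h2, -⟩ <;>
    rcases h'.cases with ⟨h1', -, h2', -⟩ | ⟨h1', -, h2', -⟩
  · exact iff_of_true h1' h1
  · linarith
  · linarith
  · exact iff_of_false h1' h1

end IsStrand

end Window

namespace QuasitriangularStructure

variable {k A : Type*} [CommRing k] [Ring A] [HopfAlgebra k A] (H : QuasitriangularStructure k A)

/-- The state sum of a diagram, with the crossings in a window separated from the others. -/
lemma powSum_crossings {ι : Type} [Fintype ι] [DecidableEq ι] (K : BiframedDiagram) {J : Set ℝ}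
    {O : Finset (ℝ × ℝ)} (hO : ∀ c, c ∈ O ↔ c ∈ K.crossings ∧ c.1 ∉ J) (x : ι → ℝ × ℝ)
    (hx : Function.Injective x) (hmem : ∀ c, (c ∈ K.crossings ∧ c.1 ∈ J) ↔ ∃ i, x i = c) :
    Function.Injective (Sum.elim (Sum.elim (fun c : O => c.1.1) (fun i => (x i).1))
      (Sum.elim (fun c : O => c.1.2) (fun i => (x i).2))) ∧
    H.powSum K.overTime K.underTime 0 (fun c => K.level c.1) =
      H.powSum (Sum.elim (fun c : O => c.1.1) (fun i => (x i).1))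
        (Sum.elim (fun c : O => c.1.2) (fun i => (x i).2))
        (Sum.elim (fun _ => 0) (fun _ => 0))
        (Sum.elim (fun c : O => K.level c.1) (fun i => K.level (x i))) := by
  let f : O ⊕ ι → K.crossings := Sum.elim (fun c => ⟨c.1, ((hO _).1 c.2).1⟩)
    (fun i => ⟨x i, ((hmem _).2 ⟨i, rfl⟩).1⟩)
  have hf : Function.Bijective f := by
    constructor
    · rintro (c | i) (d | j) h
      · exact congrArg Sum.inl (Subtype.ext (congrArg Subtype.val h :))
      · have h : c.1 = x j := congrArg Subtype.val h
        exact absurd ((hmem _).2 ⟨j, rfl⟩).2 (h ▸ ((hO _).1 c.2).2)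
      · have h : x i = d.1 := congrArg Subtype.val h
        exact absurd ((hmem _).2 ⟨i, h⟩).2 ((hO _).1 d.2).2
      · exact congrArg Sum.inr (hx (congrArg Subtype.val h :))
    · intro c
      by_cases hc : c.1.1 ∈ J
      · obtain ⟨i, hi⟩ := (hmem c.1).1 ⟨c.2, hc⟩
        exact ⟨Sum.inr i, Subtype.ext hi⟩
      · exact ⟨Sum.inl ⟨c.1, (hO _).2 ⟨c.2, hc⟩⟩, rfl⟩
  have e1 : K.overTime ∘ f = Sum.elim (fun c : O => c.1.1) (fun i => (x i).1) := by
    ext (c | c) <;> rfl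
  have e2 : K.underTime ∘ f = Sum.elim (fun c : O => c.1.2) (fun i => (x i).2) := by
    ext (c | c) <;> rfl
  have e3 : (0 : K.crossings → ℤ) ∘ f = Sum.elim (fun _ => 0) (fun _ => 0) := by
    ext (c | c) <;> rfl
  have e4 : (fun c : K.crossings => K.level c.1) ∘ f =
      Sum.elim (fun c : O => K.level c.1) (fun i => K.level (x i)) := by
    ext (c | c) <;> rfl
  have key := H.powSum_comp_equiv (Equiv.ofBijective f hf) K.injective_times 0
    (fun c => K.level c.1)
  rw [Equiv.coe_ofBijective, e1, e2, e3, e4] at key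
  refine ⟨?_, key.symm⟩
  rw [← e1, ← e2, ← Sum.elim_comp_map]
  exact K.injective_times.comp (Sum.map_injective.2 ⟨hf.1, hf.1⟩)

end QuasitriangularStructure

/-- Diagrams that differ in a window by pieces with the same local tensor have the same value. -/
theorem RibbonStructure.value_eq_of_localTensor_eq {k A : Type*} [CommRing k] [Ring A]
    [HopfAlgebra k A] (H : RibbonStructure k A) {W : Window} {K K' : BiframedDiagram}
    {a₁ b₁ a₂ b₂ a₃ b₃ : ℝ} (h₁ : a₁ ≤ b₁) (h₂ : a₂ ≤ b₂) (h₃ : a₃ ≤ b₃)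
    (h₁₂ : Disjoint (Set.Icc a₁ b₁) (Set.Icc a₂ b₂))
    (h₁₃ : Disjoint (Set.Icc a₁ b₁) (Set.Icc a₃ b₃))
    (h₂₃ : Disjoint (Set.Icc a₂ b₂) (Set.Icc a₃ b₃))
    (h : W.DifferOnlyIn (Set.Icc a₁ b₁ ∪ Set.Icc a₂ b₂ ∪ Set.Icc a₃ b₃) K K')
    (hone : 1 ∉ Set.Icc a₁ b₁ ∪ Set.Icc a₂ b₂ ∪ Set.Icc a₃ b₃)
    (hang : ∀ t ∈ Set.Icc (0 : ℝ) 1, t ∉ Set.Icc a₁ b₁ ∪ Set.Icc a₂ b₂ ∪ Set.Icc a₃ b₃ →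
      K'.angle t = K.angle t)
    {ι ι' : Type} [Fintype ι] [DecidableEq ι] [Fintype ι'] [DecidableEq ι']
    (x : ι → ℝ × ℝ) (hx : Function.Injective x) (hmem : ∀ c, (c ∈ K.crossings ∧
      c.1 ∈ Set.Icc a₁ b₁ ∪ Set.Icc a₂ b₂ ∪ Set.Icc a₃ b₃) ↔ ∃ i, x i = c)
    (x' : ι' → ℝ × ℝ) (hx' : Function.Injective x') (hmem' : ∀ c, (c ∈ K'.crossings ∧
      c.1 ∈ Set.Icc a₁ b₁ ∪ Set.Icc a₂ b₂ ∪ Set.Icc a₃ b₃) ↔ ∃ i, x' i = c)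
    (p q : ι → ℤ) (hpq : ∀ i, q i - p i = K.level (x i))
    (p' q' : ι' → ℤ) (hpq' : ∀ i, q' i - p' i = K'.level (x' i))
    (hloc : H.localTensor (fun i => (x i).1) (fun i => (x i).2) p q
        (Set.Icc a₁ b₁) (Set.Icc a₂ b₂) (Set.Icc a₃ b₃) =
      H.localTensor (fun i => (x' i).1) (fun i => (x' i).2) p' q'
        (Set.Icc a₁ b₁) (Set.Icc a₂ b₂) (Set.Icc a₃ b₃)) :
    H.value K' = H.value K := by
  classical
  set J := Set.Icc a₁ b₁ ∪ Set.Icc a₂ b₂ ∪ Set.Icc a₃ b₃ with hJ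
  set O := K.crossings.filter (fun c => c.1 ∉ J) with hOdef
  have hO : ∀ c, c ∈ O ↔ c ∈ K.crossings ∧ c.1 ∉ J := fun c => Finset.mem_filter
  have hO' : ∀ c, c ∈ O ↔ c ∈ K'.crossings ∧ c.1 ∉ J := fun c => by
    rw [hO]
    exact ⟨fun hc => ⟨h.mem_crossings hc.1 hc.2, hc.2⟩,
      fun hc => ⟨h.symm.mem_crossings hc.1 hc.2, hc.2⟩⟩
  have htwo : ∀ L : BiframedDiagram, (∀ s ∈ Set.Icc (0 : ℝ) 1, ∀ t ∈ Set.Icc (0 : ℝ) 1,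
      L.curve s = L.curve t → (s ∈ J ↔ t ∈ J)) → ∀ c ∈ L.crossings, c.1 ∈ J ↔ c.2 ∈ J := by
    intro L hL c hc
    obtain ⟨⟨h1, h2, h3, h4⟩, h5⟩ := L.mem_crossings.1 hc
    exact hL _ h1 _ h2 h4
  have hK := htwo K (fun s hs t ht => h.mem_iff hs ht)
  have hK' := htwo K' (fun s hs t ht => h.symm.mem_iff hs ht)
  obtain ⟨hinj, hsum⟩ := H.powSum_crossings K hO x hx hmem
  obtain ⟨hinj', hsum'⟩ := H.powSum_crossings K' hO' x' hx' hmem'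
  have hrot : K'.rotation = K.rotation := by
    rw [BiframedDiagram.rotation, BiframedDiagram.rotation, hang 1 (by simp) hone]
  have hlev : (fun c : O => K'.level c.1) = fun c : O => K.level c.1 := by
    ext c
    obtain ⟨hc, hcJ⟩ := (hO _).1 c.2
    obtain ⟨⟨h1, h2, h3, h4⟩, h5⟩ := K.mem_crossings.1 hc
    rw [BiframedDiagram.level, BiframedDiagram.level, hang _ h1 hcJ,
      hang _ h2 (fun h' => hcJ ((hK _ hc).2 h'))]
  have hOinj : Function.Injective (Sum.elim (fun c : O => c.1.1) (fun c : O => c.1.2)) := by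
    have := hinj.comp (Sum.map_injective.2 ⟨Sum.inl_injective, Sum.inl_injective⟩ :
      Function.Injective (Sum.map (Sum.inl : O → O ⊕ ι) (Sum.inl : O → O ⊕ ι)))
    rwa [Sum.elim_comp_map, Sum.elim_comp_inl, Sum.elim_comp_inl] at this
  have hxinj : ∀ {ι : Type} {x : ι → ℝ × ℝ},
      Function.Injective (Sum.elim (Sum.elim (fun c : O => c.1.1) (fun i => (x i).1))
        (Sum.elim (fun c : O => c.1.2) (fun i => (x i).2))) →
      Function.Injective (Sum.elim (fun i => (x i).1) (fun i => (x i).2)) := by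
    intro ι x hinj
    have := hinj.comp (Sum.map_injective.2 ⟨Sum.inr_injective, Sum.inr_injective⟩ :
      Function.Injective (Sum.map (Sum.inr : ι → O ⊕ ι) (Sum.inr : ι → O ⊕ ι)))
    rwa [Sum.elim_comp_map, Sum.elim_comp_inr, Sum.elim_comp_inr] at this
  -- Crossings outside the window are common to both diagrams and have the same levels, so one map Z
  -- computes both state sums from the local tensors.
  obtain ⟨Z, hZ⟩ := H.exists_powSum_eq_localTensor hOinj (fun _ => 0) (fun c => K.level c.1)
    h₁ h₂ h₃ h₁₂ h₁₃ h₂₃ (by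
      intro t ht
      obtain ⟨c, hc⟩ := mem_siteTimes.1 ht
      obtain ⟨hcK, hcJ⟩ := (hO _).1 c.2
      rcases hc with rfl | rfl
      · exact hcJ
      · exact fun h' => hcJ ((hK _ hcK).2 h'))
  have hin : ∀ t ∈ siteTimes (fun i => (x i).1) (fun i => (x i).2), t ∈ J := by
    intro t ht
    obtain ⟨i, hi⟩ := mem_siteTimes.1 ht
    obtain ⟨hc, hcJ⟩ := (hmem _).2 ⟨i, rfl⟩
    rcases hi with rfl | rfl
    exacts [hcJ, (hK _ hc).1 hcJ]
  have hin' : ∀ t ∈ siteTimes (fun i => (x' i).1) (fun i => (x' i).2), t ∈ J := by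
    intro t ht
    obtain ⟨i, hi⟩ := mem_siteTimes.1 ht
    obtain ⟨hc, hcJ⟩ := (hmem' _).2 ⟨i, rfl⟩
    rcases hi with rfl | rfl
    exacts [hcJ, (hK' _ hc).1 hcJ]
  rw [RibbonStructure.value, RibbonStructure.value, hrot, hsum, hsum', hlev,
    H.powSum_congr hinj (p' := Sum.elim (fun _ => 0) p)
      (q' := Sum.elim (fun c : O => K.level c.1) q) (by
        rintro (c | i)
        · rfl
        · simp [hpq]),
    H.powSum_congr hinj' (p' := Sum.elim (fun _ => 0) p')
      (q' := Sum.elim (fun c : O => K.level c.1) q') (by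
        rintro (c | i)
        · rfl
        · simp [hpq']),
    hZ ι _ _ (hxinj hinj) p q hin, hZ ι' _ _ (hxinj hinj') p' q' hin', hloc]

end

/-! ### The second Reidemeister move. -/

noncomputable section

lemma KnotoidDiagram.injective_times_comp (K : KnotoidDiagram) {ι : Type} {x : ι → ℝ × ℝ}
    (hx : Function.Injective x) (hK : ∀ i, x i ∈ K.crossings) :
    Function.Injective (Sum.elim (fun i => (x i).1) (fun i => (x i).2)) := by
  have hf : Function.Injective fun i => (⟨x i, hK i⟩ : K.crossings) :=
    fun i j h => hx (congrArg Subtype.val h :)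
  have := K.injective_times.comp (Sum.map_injective.2 ⟨hf, hf⟩)
  rwa [Sum.elim_comp_map] at this

/-- A descending strand meets the higher of two points first, an ascending strand meets it last.
This translates the order of time into the order from top to bottom. -/
lemma Window.IsStrand.even_turns_iff {W : Window} {K : BiframedDiagram} {a b : ℝ}
    (h : W.IsStrand K a b) {t t' : ℝ} (ht : t ∈ Set.Icc a b) (ht' : t' ∈ Set.Icc a b)
    (hne : t ≠ t') :
    Even (W.turns K a) ↔ (W.height K t' < W.height K t ↔ t < t') := by
  rcases h.cases with ⟨h1, h2, -⟩ | ⟨h1, h2, -⟩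
  · exact iff_of_true h1 (h2.lt_iff_gt ht' ht)
  · refine iff_of_false h1 ?_
    rw [h2.lt_iff_lt ht' ht]
    rcases lt_or_gt_of_ne hne with h | h
    · simp [h, h.le]
    · simp [h, h.le]

namespace QuasitriangularStructure

variable {k A : Type*} [CommRing k] [Ring A] [HopfAlgebra k A] (H : QuasitriangularStructure k A)

/-- The product of two beads on a strand, when their order from top to bottom is known. -/
lemma ordProd_strand {n : ℤ} {τ τ' : ℝ} (hne : τ ≠ τ') {w : Prop} [Decidable w]
    (h : Even n ↔ (w ↔ τ < τ')) {b : ℝ → A} {y y' : A} (hy : b τ = H.antipodePow n y)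
    (hy' : b τ' = H.antipodePow n y') :
    ordProd {τ, τ'} b = H.antipodePow n (if w then y * y' else y' * y) := by
  rcases Int.even_or_odd n with he | ho
  · have h := h.1 he
    split_ifs with hw
    · rw [ordProd_pair (h.1 hw), hy, hy', H.antipodePow_mul_of_even he]
    · rw [Finset.pair_comm, ordProd_pair (lt_of_le_of_ne (not_lt.1 (mt h.2 hw)) hne.symm), hy, hy',
        H.antipodePow_mul_of_even he]
  · have h := (not_congr h).1 (Int.not_even_iff_odd.2 ho)
    split_ifs with hw
    · have h' : ¬ τ < τ' := fun hl => h ⟨fun _ => hl, fun _ => hw⟩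
      rw [Finset.pair_comm, ordProd_pair (lt_of_le_of_ne (not_lt.1 h') hne.symm), hy, hy',
        H.antipodePow_mul_of_odd ho]
    · have h' : τ < τ' := by
        by_contra hl
        exact h ⟨fun h => absurd h hw, fun h => absurd h hl⟩
      rw [ordProd_pair h', hy, hy', H.antipodePow_mul_of_odd ho]

/-- The hypotheses say that the crossing 0 is the upper one on both strands. The power of S common
to the beads of a strand is taken out of the product; if it is odd it reverses the product, which
undoes the reversed order in which an ascending strand is run through. What remains is the product
from top to bottom. -/
lemma localTensor_two {o u : Fin 2 → ℝ} (hinj : Function.Injective (Sum.elim o u))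
    {I₁ I₂ I₃ : Set ℝ} (h₁₂ : Disjoint I₁ I₂) (h₁₃ : Disjoint I₁ I₃) (h₂₃ : Disjoint I₂ I₃)
    (ho : ∀ i, o i ∈ I₁) (hu : ∀ i, u i ∈ I₂) (n₁ n₂ : ℤ) (m : Fin 2 → ℤ)
    (h₁ : Even n₁ ↔ o 0 < o 1) (h₂ : Even n₂ ↔ u 0 < u 1) :
    H.localTensor o u (fun _ => n₁) (fun i => n₂ + m i) I₁ I₂ I₃ =
      TensorProduct.assoc k A A A (TensorProduct.map (H.antipodePow n₁).toLinearMap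
        (H.antipodePow n₂).toLinearMap (H.levelTensor (m 0) * H.levelTensor (m 1)) ⊗ₜ 1) := by
  classical
  have d₁₂ := Set.disjoint_left.1 h₁₂
  have d₁₃ := Set.disjoint_left.1 h₁₃
  have d₂₃ := Set.disjoint_left.1 h₂₃
  have f₁ : (siteTimes o u).filter (· ∈ I₁) = {o 0, o 1} := by
    ext t
    simp only [Finset.mem_filter, mem_siteTimes, Fin.exists_fin_two, Finset.mem_insert,
      Finset.mem_singleton]
    constructor
    · rintro ⟨(h | h) | (h | h), ht⟩
      · exact Or.inl h.symm
      · exact absurd (h ▸ hu 0 : t ∈ I₂) (d₁₂ ht)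
      · exact Or.inr h.symm
      · exact absurd (h ▸ hu 1 : t ∈ I₂) (d₁₂ ht)
    · rintro (rfl | rfl)
      · exact ⟨Or.inl (Or.inl rfl), ho 0⟩
      · exact ⟨Or.inr (Or.inl rfl), ho 1⟩
  have f₂ : (siteTimes o u).filter (· ∈ I₂) = {u 0, u 1} := by
    ext t
    simp only [Finset.mem_filter, mem_siteTimes, Fin.exists_fin_two, Finset.mem_insert,
      Finset.mem_singleton]
    constructor
    · rintro ⟨(h | h) | (h | h), ht⟩
      · exact absurd ht (d₁₂ (h ▸ ho 0 : t ∈ I₁))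
      · exact Or.inl h.symm
      · exact absurd ht (d₁₂ (h ▸ ho 1 : t ∈ I₁))
      · exact Or.inr h.symm
    · rintro (rfl | rfl)
      · exact ⟨Or.inl (Or.inr rfl), hu 0⟩
      · exact ⟨Or.inr (Or.inr rfl), hu 1⟩
  have f₃ : (siteTimes o u).filter (· ∈ I₃) = ∅ := by
    refine Finset.filter_eq_empty_iff.2 fun t ht ht3 => ?_
    obtain ⟨i, rfl | rfl⟩ := mem_siteTimes.1 ht
    · exact d₁₃ (ho i) ht3
    · exact d₂₃ (hu i) ht3
  have ne₁ : o 0 ≠ o 1 := fun h => by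
    have := hinj (a₁ := Sum.inl 0) (a₂ := Sum.inl 1) h
    simp at this
  have ne₂ : u 0 ≠ u 1 := fun h => by
    have := hinj (a₁ := Sum.inr 0) (a₂ := Sum.inr 1) h
    simp at this
  have hT : ∀ j, H.levelTensor j =
      ∑ i, H.expansion.fst i ⊗ₜ H.antipodePow j (H.expansion.snd i) := by
    intro j
    have := H.sum_expansion 0 j
    rw [sub_zero] at this
    simpa only [H.antipodePow_zero] using this.symm
  rw [localTensor, hT, hT, Finset.sum_mul_sum, map_sum, TensorProduct.sum_tmul, map_sum,
    ← (finTwoArrowEquiv (Fin H.expansion.size)).symm.sum_comp, Fintype.sum_prod_type]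
  refine Finset.sum_congr rfl fun i _ => ?_
  rw [map_sum, TensorProduct.sum_tmul, map_sum]
  refine Finset.sum_congr rfl fun j _ => ?_
  rw [f₁, f₂, f₃, ordProd_empty,
    H.ordProd_strand (w := True) ne₁ (by simpa using h₁) (y := H.expansion.fst i)
      (y' := H.expansion.fst j) (powBeads_over hinj _ _ _ 0) (powBeads_over hinj _ _ _ 1),
    H.ordProd_strand (w := True) ne₂ (by simpa using h₂)
      (y := H.antipodePow (m 0) (H.expansion.snd i))
      (y' := H.antipodePow (m 1) (H.expansion.snd j))
      ((powBeads_under hinj _ _ _ 0).trans (by rw [H.antipodePow_add]; rfl))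
      ((powBeads_under hinj _ _ _ 1).trans (by rw [H.antipodePow_add]; rfl))]
  simp

lemma localTensor_of_isEmpty {ι : Type} [Fintype ι] [DecidableEq ι] [IsEmpty ι] (o u : ι → ℝ)
    (p q : ι → ℤ) (I₁ I₂ I₃ : Set ℝ) :
    H.localTensor o u p q I₁ I₂ I₃ = 1 ⊗ₜ (1 ⊗ₜ 1) := by
  have : siteTimes o u = ∅ := by
    refine Finset.eq_empty_of_forall_notMem fun t ht => ?_
    obtain ⟨i, -⟩ := mem_siteTimes.1 ht
    exact isEmptyElim i
  simp [localTensor, this]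

end QuasitriangularStructure

/-- Relative to the window the two crossings carry R and R⁻¹ in one of the two orders, because their
determinants have opposite signs and the directions of the strands affect both signs in the same
way. The product from top to bottom is 1, as for the empty window. -/
theorem RibbonStructure.value_eq_of_moveR2 {k A : Type*} [CommRing k] [Ring A] [HopfAlgebra k A]
    (H : RibbonStructure k A) {K K' : BiframedDiagram} (h : MoveR2 K K') :
    H.value K' = H.value K := by
  obtain ⟨W, a, b, c, d, hd, hW, hab, hcd, hab', hcd', ⟨s, t, s', t', hset, hdet, hdet', ho, ho'⟩,
    hempty⟩ := h
  -- The crossings are renamed so that (s, t) is the upper one; of their signs only the product is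
  -- kept.
  obtain ⟨s, t, s', t', hset, hdet, ho, ho', hh⟩ : ∃ s t s' t' : ℝ,
      crossingsBetween K a b c d = {(s, t), (s', t')} ∧
      planeDet (K.velocity s) (K.velocity t) * planeDet (K.velocity s') (K.velocity t') < 0 ∧
      K.isOver s = true ∧ K.isOver s' = true ∧ W.height K s' < W.height K s := by
    have m1 : (s, t) ∈ crossingsBetween K a b c d := by rw [hset]; simp
    have m2 : (s', t') ∈ crossingsBetween K a b c d := by rw [hset]; simp
    rcases lt_trichotomy (W.height K s') (W.height K s) with hlt | heq | hgt
    · exact ⟨s, t, s', t', hset, mul_neg_of_pos_of_neg hdet hdet', ho, ho', hlt⟩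
    · have e1 : s' = s := hab.injOn m2.1 m1.1 heq
      subst e1
      have e2 : t' = t := hcd.injOn m2.2.1 m1.2.1
        (W.height_eq_of_curve_eq (m2.2.2.symm.trans m1.2.2))
      subst e2
      exact absurd hdet (not_lt.2 hdet'.le)
    · exact ⟨s', t', s, t, by rw [hset, Set.pair_comm], mul_neg_of_neg_of_pos hdet' hdet, ho', ho,
        hgt⟩
  have m1 : (s, t) ∈ crossingsBetween K a b c d := by rw [hset]; simp
  have m2 : (s', t') ∈ crossingsBetween K a b c d := by rw [hset]; simp
  -- The localization is stated for three intervals; this one is a dummy that contains no times of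
  -- the diagrams.
  set I₃ := Set.Icc (-2 : ℝ) (-1) with hI₃
  have hI : ∀ {t : ℝ}, t ∈ Set.Icc (0 : ℝ) 1 → t ∉ I₃ := fun ht h => by
    linarith [ht.1, h.2]
  have h₁₃ : Disjoint (Set.Icc a b) I₃ := Set.disjoint_left.2 fun t ht => hI (hab.subset ht)
  have h₂₃ : Disjoint (Set.Icc c d) I₃ := Set.disjoint_left.2 fun t ht => hI (hcd.subset ht)
  have hJ : ∀ t ∈ Set.Icc (0 : ℝ) 1, t ∈ Set.Icc a b ∪ Set.Icc c d ∪ I₃ ↔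
      t ∈ Set.Icc a b ∪ Set.Icc c d := by
    intro t ht
    have := hI ht
    rw [Set.mem_union _ _ I₃]
    exact or_iff_left this
  have hcl : IsClosed (Set.Icc a b ∪ Set.Icc c d) := isClosed_Icc.union isClosed_Icc
  have hca : K'.curve a = K.curve a := hW.curve_eq (hab.subset (Set.left_mem_Icc.2
    hab.bounds.2.1.le)) (Window.left_mem_closure hab.bounds.1 hab.bounds.2.1 hab.bounds.2.2
    isClosed_Icc hd)
  have hcc : K'.curve c = K.curve c := hW.curve_eq (hcd.subset (Set.left_mem_Icc.2
    hcd.bounds.2.1.le)) (by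
      rw [Set.union_comm]
      exact Window.left_mem_closure hcd.bounds.1 hcd.bounds.2.1 hcd.bounds.2.2
        isClosed_Icc hd.symm)
  have hplane : ∀ t ∈ Set.Icc (0 : ℝ) 1, t ∈ Set.Icc a b ∪ Set.Icc c d →
      InHalfPlane (K.velocity t) (K'.velocity t) := by
    rintro t - (ht | ht)
    exacts [hab.inHalfPlane hab' hca ht, hcd.inHalfPlane hcd' hcc ht]
  have hmem : ∀ L : BiframedDiagram, W.IsStrand L a b → W.IsStrand L c d →
      (∀ p ∈ crossingsBetween L a b c d, L.isOver p.1 = true) →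
      (∀ s ∈ Set.Icc (0 : ℝ) 1, ∀ t ∈ Set.Icc (0 : ℝ) 1, L.curve s = L.curve t →
        (s ∈ Set.Icc a b ∪ Set.Icc c d ↔ t ∈ Set.Icc a b ∪ Set.Icc c d)) →
      ∀ x, (x ∈ L.crossings ∧ x.1 ∈ Set.Icc a b ∪ Set.Icc c d ∪ I₃) ↔
        x ∈ crossingsBetween L a b c d := by
    intro L hab hcd hov htwo x
    constructor
    · rintro ⟨hx, hxJ⟩
      have hu := KnotoidDiagram.isOver_snd hx
      obtain ⟨⟨h1, h2, h3, h4⟩, h5⟩ := L.mem_crossings.1 hx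
      rw [hJ _ h1] at hxJ
      have hxJ' := (htwo _ h1 _ h2 h4).1 hxJ
      rcases hxJ with hx1 | hx1 <;> rcases hxJ' with hx2 | hx2
      · exact absurd (hab.injOn hx1 hx2 (W.height_eq_of_curve_eq h4)) h3
      · exact ⟨hx1, hx2, h4⟩
      · have := hov (x.2, x.1) ⟨hx2, hx1, h4.symm⟩
        rw [hu] at this
        exact absurd this (by simp)
      · exact absurd (hcd.injOn hx1 hx2 (W.height_eq_of_curve_eq h4)) h3
    · intro hx
      refine ⟨L.mem_crossings.2 ⟨⟨hab.subset hx.1, hcd.subset hx.2.1, ?_, hx.2.2⟩, hov x hx⟩,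
        Or.inl (Or.inl hx.1)⟩
      exact fun e => Set.disjoint_left.1 hd hx.1 (e ▸ hx.2.1)
  have hK := hmem K hab hcd (by
      rw [hset]
      rintro p (rfl | rfl)
      exacts [ho, ho']) (fun s hs t ht => hW.mem_iff hs ht)
  have hK' := hmem K' hab' hcd' (by simp [hempty]) (fun s hs t ht => hW.symm.mem_iff hs ht)
  set n₁ := W.turns K a with hn₁
  set n₂ := W.turns K c with hn₂
  set x : Fin 2 → ℝ × ℝ := ![(s, t), (s', t')] with hx
  -- The level is (n₂ + m i) - n₁, where m i is 0 or -1 according to the sign of the crossing in the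
  -- window.
  set m : Fin 2 → ℤ := fun i => - (if 0 < (-1 : ℝ) ^ (n₂ - n₁) *
    planeDet (K.velocity (x i).1) (K.velocity (x i).2) then 0 else 1) with hm
  have hxmem : ∀ i, x i ∈ crossingsBetween K a b c d := by
    intro i
    fin_cases i
    exacts [m1, m2]
  have hss : s ≠ s' := by
    rintro rfl
    exact lt_irrefl _ hh
  have htt : t ≠ t' := by
    rintro rfl
    rw [W.height_eq_of_curve_eq m1.2.2, W.height_eq_of_curve_eq m2.2.2] at hh
    exact lt_irrefl _ hh
  have hst : W.height K t' < W.height K t := by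
    rwa [← W.height_eq_of_curve_eq m1.2.2, ← W.height_eq_of_curve_eq m2.2.2]
  have hxinj : Function.Injective x := by
    intro i j
    fin_cases i <;> fin_cases j <;> simp [hx, hss, hss.symm]
  have hinj : Function.Injective (Sum.elim (fun i => (x i).1) (fun i => (x i).2)) :=
    K.injective_times_comp hxinj fun i => ((hK (x i)).2 (hxmem i)).1
  refine H.value_eq_of_localTensor_eq (ι := Fin 2) (ι' := Empty) hab.bounds.2.1.le
    hcd.bounds.2.1.le (by norm_num : (-2 : ℝ) ≤ -1) hd h₁₃ h₂₃ (hW.mono_set hJ) ?_ ?_ x hxinj ?_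
    Empty.elim (fun i => i.elim) ?_ (fun _ => n₁) (fun i => n₂ + m i) ?_ Empty.elim Empty.elim
    (fun i => i.elim) ?_
  · rw [hJ 1 (by simp)]
    rintro (h | h)
    · linarith [h.2, hab.bounds.2.2]
    · linarith [h.2, hcd.bounds.2.2]
  · intro t ht htJ
    rw [hJ t ht] at htJ
    exact hW.angle_eq hcl hplane ht htJ
  · intro y
    rw [hK, hset]
    simp [hx, Fin.exists_fin_two, eq_comm]
  · intro y
    rw [hK', hempty]
    simp
  · intro i
    rw [BiframedDiagram.level_eq_of_frame ((hK (x i)).2 (hxmem i)).1 W.scale.arg]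
    change _ = W.turns K (x i).2 - W.turns K (x i).1 - (if 0 < (-1 : ℝ) ^ (W.turns K (x i).2 -
      W.turns K (x i).1) * _ then 0 else 1)
    rw [hab.turns_eq (hxmem i).1, hcd.turns_eq (hxmem i).2.1, hm]
    ring
  · rw [H.localTensor_of_isEmpty (ι := Empty), H.localTensor_two hinj hd h₁₃ h₂₃ (fun i => (hxmem i).1)
      (fun i => (hxmem i).2.1) n₁ n₂ m]
    · have hone : H.levelTensor (m 0) * H.levelTensor (m 1) = 1 := by
        have hs : (0 < (-1 : ℝ) ^ (n₂ - n₁) * planeDet (K.velocity s) (K.velocity t) ∧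
            ¬ 0 < (-1 : ℝ) ^ (n₂ - n₁) * planeDet (K.velocity s') (K.velocity t')) ∨
          (¬ 0 < (-1 : ℝ) ^ (n₂ - n₁) * planeDet (K.velocity s) (K.velocity t) ∧
            0 < (-1 : ℝ) ^ (n₂ - n₁) * planeDet (K.velocity s') (K.velocity t')) := by
          rcases mul_neg_iff.1 hdet with ⟨g1, g2⟩ | ⟨g1, g2⟩ <;>
            rcases Int.even_or_odd (n₂ - n₁) with e | e <;> rw [e.neg_one_zpow]
          · exact Or.inl ⟨by linarith, by linarith⟩
          · exact Or.inr ⟨by linarith, by linarith⟩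
          · exact Or.inr ⟨by linarith, by linarith⟩
          · exact Or.inl ⟨by linarith, by linarith⟩
        rcases hs with ⟨g1, g2⟩ | ⟨g1, g2⟩
        · have e0 : m 0 = 0 := by simp only [hm, hx]; simp [g1]
          have e1 : m 1 = -1 := by simp only [hm, hx]; simp [g2]
          rw [e0, e1, H.levelTensor_zero, H.levelTensor_neg_one, Units.mul_inv]
        · have e0 : m 0 = -1 := by simp only [hm, hx]; simp [g1]
          have e1 : m 1 = 0 := by simp only [hm, hx]; simp [g2]
          rw [e0, e1, H.levelTensor_zero, H.levelTensor_neg_one, Units.inv_mul]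
      rw [hone, Algebra.TensorProduct.one_def]
      simp [H.antipodePow_apply_one]
    · have := hab.even_turns_iff m1.1 m2.1 hss
      rw [iff_true_left hh] at this
      exact this
    · have := hcd.even_turns_iff m1.2.1 m2.2.1 htt
      rw [iff_true_left hst] at this
      exact this

end

/-! ### The third Reidemeister move, algebraic part: Yang-Baxter with signs. -/

noncomputable section

lemma sum_mul_sum_mul_sum {B κ : Type*} [Ring B] [Fintype κ] (f g h : κ → B) :
    (∑ i, f i) * (∑ j, g j) * (∑ l, h l) = ∑ i, ∑ j, ∑ l, f i * g j * h l := by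
  rw [Finset.sum_mul_sum, Finset.sum_mul]
  refine Finset.sum_congr rfl fun i _ => ?_
  rw [Finset.sum_mul_sum]

/-- The functions on `Fin 3` as triples. -/
def tripleEquiv (κ : Type*) : κ × κ × κ ≃ (Fin 3 → κ) where
  toFun p := ![p.1, p.2.1, p.2.2]
  invFun f := (f 0, f 1, f 2)
  left_inv p := rfl
  right_inv f := by
    ext i
    fin_cases i <;> rfl

open Classical in
lemma filter_mem_eq_pair {α : Type*} {S : Finset α} {I : Set α} {a b : α} (ha : a ∈ S)
    (hb : b ∈ S) (ha' : a ∈ I) (hb' : b ∈ I) (h : ∀ t ∈ S, t ∈ I → t = a ∨ t = b) :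
    S.filter (· ∈ I) = {a, b} := by
  ext t
  rw [Finset.mem_filter, Finset.mem_insert, Finset.mem_singleton]
  constructor
  · exact fun ht => h t ht.1 ht.2
  · rintro (rfl | rfl)
    exacts [⟨ha, ha'⟩, ⟨hb, hb'⟩]

lemma forall_siteTimes_three {o u : Fin 3 → ℝ} {P : ℝ → Prop} (h₀ : P (o 0)) (h₁ : P (o 1))
    (h₂ : P (o 2)) (h₀' : P (u 0)) (h₁' : P (u 1)) (h₂' : P (u 2)) :
    ∀ t ∈ siteTimes o u, P t := by
  intro t ht
  obtain ⟨i, rfl | rfl⟩ := mem_siteTimes.1 ht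
  · fin_cases i
    exacts [h₀, h₁, h₂]
  · fin_cases i
    exacts [h₀', h₁', h₂']

namespace QuasitriangularStructure

variable {k A : Type*} [CommRing k] [Ring A] [HopfAlgebra k A] (H : QuasitriangularStructure k A)

/-- The tensor on three strands, a top one, a middle one and a bottom one, that cross pairwise once:
`w₁`, `w₂`, `w₃` say which of the two crossings on each of the strands is the upper one. -/
def braidTensor (m₀ m₁ m₂ : ℤ) (w₁ w₂ w₃ : Bool) : A ⊗[k] (A ⊗[k] A) :=
  ∑ i, ∑ j, ∑ l,
    (if w₁ then H.expansion.fst i * H.expansion.fst j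
      else H.expansion.fst j * H.expansion.fst i) ⊗ₜ
    ((if w₂ then H.antipodePow m₀ (H.expansion.snd i) * H.expansion.fst l
      else H.expansion.fst l * H.antipodePow m₀ (H.expansion.snd i)) ⊗ₜ
    (if w₃ then H.antipodePow m₁ (H.expansion.snd j) * H.antipodePow m₂ (H.expansion.snd l)
      else H.antipodePow m₂ (H.expansion.snd l) * H.antipodePow m₁ (H.expansion.snd j)))

lemma levelTensor_eq_sum (j : ℤ) : H.levelTensor j =
    ∑ i, H.expansion.fst i ⊗ₜ H.antipodePow j (H.expansion.snd i) := by
  have := H.sum_expansion 0 j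
  rw [sub_zero] at this
  simpa only [H.antipodePow_zero] using this.symm

lemma leg12_levelTensor (j : ℤ) : leg12 k (H.levelTensor j) =
    ∑ i, H.expansion.fst i ⊗ₜ (H.antipodePow j (H.expansion.snd i) ⊗ₜ (1 : A)) := by
  rw [levelTensor_eq_sum, leg12, TensorProduct.sum_tmul, map_sum]
  rfl

lemma leg13_levelTensor (j : ℤ) : leg13 k (H.levelTensor j) =
    ∑ i, H.expansion.fst i ⊗ₜ ((1 : A) ⊗ₜ H.antipodePow j (H.expansion.snd i)) := by
  rw [levelTensor_eq_sum, leg13, map_sum]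
  rfl

lemma leg23_levelTensor (j : ℤ) : leg23 k (H.levelTensor j) =
    ∑ i, (1 : A) ⊗ₜ (H.expansion.fst i ⊗ₜ H.antipodePow j (H.expansion.snd i)) := by
  rw [levelTensor_eq_sum, leg23, TensorProduct.tmul_sum]

variable (m₀ m₁ m₂ : ℤ)

/-- Here `w₁` says that the crossing 12 is above 13, `w₂` that 12 is above 23, and `w₃` that 13 is
above 23. Six of the eight combinations are linear orders of the three crossings, and each gives the
product of the three tensors in that order; the other two combinations are cyclic. -/
lemma braidTensor_ttt : H.braidTensor m₀ m₁ m₂ true true true =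
    leg12 k (H.levelTensor m₀) * leg13 k (H.levelTensor m₁) * leg23 k (H.levelTensor m₂) := by
  rw [leg12_levelTensor, leg13_levelTensor, leg23_levelTensor, sum_mul_sum_mul_sum]
  simp [braidTensor]

lemma braidTensor_ttf : H.braidTensor m₀ m₁ m₂ true true false =
    leg12 k (H.levelTensor m₀) * leg23 k (H.levelTensor m₂) * leg13 k (H.levelTensor m₁) := by
  rw [leg12_levelTensor, leg13_levelTensor, leg23_levelTensor, sum_mul_sum_mul_sum]
  simp only [Algebra.TensorProduct.tmul_mul_tmul, mul_one, one_mul]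
  exact Finset.sum_congr rfl fun _ _ => Finset.sum_comm

lemma braidTensor_ftt : H.braidTensor m₀ m₁ m₂ false true true =
    leg13 k (H.levelTensor m₁) * leg12 k (H.levelTensor m₀) * leg23 k (H.levelTensor m₂) := by
  rw [leg12_levelTensor, leg13_levelTensor, leg23_levelTensor, sum_mul_sum_mul_sum]
  simp only [Algebra.TensorProduct.tmul_mul_tmul, mul_one, one_mul]
  exact Finset.sum_comm

lemma braidTensor_fft : H.braidTensor m₀ m₁ m₂ false false true =
    leg13 k (H.levelTensor m₁) * leg23 k (H.levelTensor m₂) * leg12 k (H.levelTensor m₀) := by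
  rw [leg12_levelTensor, leg13_levelTensor, leg23_levelTensor, sum_mul_sum_mul_sum]
  simp only [Algebra.TensorProduct.tmul_mul_tmul, mul_one, one_mul]
  exact Finset.sum_comm.trans (Finset.sum_congr rfl fun _ _ => Finset.sum_comm)

lemma braidTensor_tff : H.braidTensor m₀ m₁ m₂ true false false =
    leg23 k (H.levelTensor m₂) * leg12 k (H.levelTensor m₀) * leg13 k (H.levelTensor m₁) := by
  rw [leg12_levelTensor, leg13_levelTensor, leg23_levelTensor, sum_mul_sum_mul_sum]
  simp only [Algebra.TensorProduct.tmul_mul_tmul, mul_one, one_mul]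
  exact (Finset.sum_congr rfl fun _ _ => Finset.sum_comm).trans Finset.sum_comm

lemma braidTensor_fff : H.braidTensor m₀ m₁ m₂ false false false =
    leg23 k (H.levelTensor m₂) * leg13 k (H.levelTensor m₁) * leg12 k (H.levelTensor m₀) := by
  rw [leg12_levelTensor, leg13_levelTensor, leg23_levelTensor, sum_mul_sum_mul_sum]
  simp only [Algebra.TensorProduct.tmul_mul_tmul, mul_one, one_mul]
  exact (Finset.sum_comm.trans (Finset.sum_congr rfl fun _ _ => Finset.sum_comm)).trans
    Finset.sum_comm

/-- `R₁₂` as a unit. -/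
def unit12 : (A ⊗[k] (A ⊗[k] A))ˣ where
  val := leg12 k (H.R : A ⊗[k] A)
  inv := leg12 k (H.R⁻¹ : (A ⊗[k] A)ˣ)
  val_inv := by rw [← leg12_mul, Units.mul_inv, leg12_one]
  inv_val := by rw [← leg12_mul, Units.inv_mul, leg12_one]

/-- `R₁₃` as a unit. -/
def unit13 : (A ⊗[k] (A ⊗[k] A))ˣ where
  val := leg13 k (H.R : A ⊗[k] A)
  inv := leg13 k (H.R⁻¹ : (A ⊗[k] A)ˣ)
  val_inv := by rw [← leg13_mul, Units.mul_inv, leg13_one]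
  inv_val := by rw [← leg13_mul, Units.inv_mul, leg13_one]

/-- `R₂₃` as a unit. -/
def unit23 : (A ⊗[k] (A ⊗[k] A))ˣ where
  val := leg23 k (H.R : A ⊗[k] A)
  inv := leg23 k (H.R⁻¹ : (A ⊗[k] A)ˣ)
  val_inv := by rw [← leg23_mul, Units.mul_inv, leg23_one]
  inv_val := by rw [← leg23_mul, Units.inv_mul, leg23_one]

lemma yang_baxter_units : H.unit12 * H.unit13 * H.unit23 = H.unit23 * H.unit13 * H.unit12 :=
  Units.ext H.yang_baxter

/-- The orders of the crossings that are possible for three strands in given positions at the top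
lead to the same tensor. -/
lemma exists_braidTensor_eq (e₀ e₁ e₂ : Bool) : ∃ V, ∀ w₁ w₂ w₃ : Bool,
    ((e₁ = w₁) ↔ (e₂ = w₂)) → ((e₀ = w₁) ↔ (e₂ = w₃)) → ((e₀ = w₂) ↔ (e₁ = w₃)) →
    ¬ (w₁ = true ∧ w₂ = false ∧ w₃ = true) → ¬ (w₁ = false ∧ w₂ = true ∧ w₃ = false) →
    H.braidTensor (if e₀ then 0 else -1) (if e₁ then 0 else -1) (if e₂ then 0 else -1)
      w₁ w₂ w₃ = V := by
  have h := H.yang_baxter_units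
  set x := H.unit12
  set y := H.unit13
  set z := H.unit23
  have hx : leg12 k (H.levelTensor 0) = (x : A ⊗[k] (A ⊗[k] A)) := by
    rw [levelTensor_zero]; rfl
  have hy : leg13 k (H.levelTensor 0) = (y : A ⊗[k] (A ⊗[k] A)) := by
    rw [levelTensor_zero]; rfl
  have hz : leg23 k (H.levelTensor 0) = (z : A ⊗[k] (A ⊗[k] A)) := by
    rw [levelTensor_zero]; rfl
  have hx' : leg12 k (H.levelTensor (-1)) = ((x⁻¹ : (A ⊗[k] (A ⊗[k] A))ˣ) : A ⊗[k] (A ⊗[k] A)) := by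
    rw [levelTensor_neg_one]; rfl
  have hy' : leg13 k (H.levelTensor (-1)) = ((y⁻¹ : (A ⊗[k] (A ⊗[k] A))ˣ) : A ⊗[k] (A ⊗[k] A)) := by
    rw [levelTensor_neg_one]; rfl
  have hz' : leg23 k (H.levelTensor (-1)) = ((z⁻¹ : (A ⊗[k] (A ⊗[k] A))ˣ) : A ⊗[k] (A ⊗[k] A)) := by
    rw [levelTensor_neg_one]; rfl
  -- The other forms of the Yang-Baxter equation arise from it by inversion, or by multiplication on
  -- both sides with inverses of the factors.
  have q1 : x⁻¹ * y⁻¹ * z⁻¹ = z⁻¹ * y⁻¹ * x⁻¹ := by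
    have := congrArg (fun t => t⁻¹) h
    simpa [mul_assoc] using this.symm
  have q2 : x * z⁻¹ * y⁻¹ = y⁻¹ * z⁻¹ * x := by
    have := congrArg (fun t => y⁻¹ * z⁻¹ * t * z⁻¹ * y⁻¹) h
    simpa [mul_assoc] using this.symm
  have q3 : y⁻¹ * x⁻¹ * z = z * x⁻¹ * y⁻¹ := by
    have := congrArg (fun t => y⁻¹ * x⁻¹ * t * x⁻¹ * y⁻¹) h
    simpa [mul_assoc] using this.symm
  have q4 : y * x * z⁻¹ = z⁻¹ * x * y := by
    have := congrArg (fun t => z⁻¹ * t * z⁻¹) h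
    simpa [mul_assoc] using this.symm
  have q5 : y * z * x⁻¹ = x⁻¹ * z * y := by
    have := congrArg (fun t => x⁻¹ * t * x⁻¹) h
    simpa [mul_assoc] using this
  cases e₀ <;> cases e₁ <;> cases e₂ <;> simp only [Bool.false_eq_true, if_false, if_true]
  · refine ⟨((z⁻¹ * y⁻¹ * x⁻¹ : (A ⊗[k] (A ⊗[k] A))ˣ) : A ⊗[k] (A ⊗[k] A)), fun w₁ w₂ w₃ c₁ c₂ c₃ c₄ c₅ => ?_⟩
    have hw : (w₁ = false ∧ w₂ = false ∧ w₃ = false) ∨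
        (w₁ = true ∧ w₂ = true ∧ w₃ = true) := by
      revert w₁ w₂ w₃; decide
    obtain ⟨rfl, rfl, rfl⟩ | ⟨rfl, rfl, rfl⟩ := hw
    · rw [braidTensor_fff, hx', hy', hz']; rfl
    · rw [← q1, braidTensor_ttt, hx', hy', hz']; rfl
  · refine ⟨((y⁻¹ * x⁻¹ * z : (A ⊗[k] (A ⊗[k] A))ˣ) : A ⊗[k] (A ⊗[k] A)), fun w₁ w₂ w₃ c₁ c₂ c₃ c₄ c₅ => ?_⟩
    have hw : (w₁ = false ∧ w₂ = true ∧ w₃ = true) ∨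
        (w₁ = true ∧ w₂ = false ∧ w₃ = false) := by
      revert w₁ w₂ w₃; decide
    obtain ⟨rfl, rfl, rfl⟩ | ⟨rfl, rfl, rfl⟩ := hw
    · rw [braidTensor_ftt, hx', hy', hz]; rfl
    · rw [q3, braidTensor_tff, hx', hy', hz]; rfl
  · refine ⟨0, fun w₁ w₂ w₃ c₁ c₂ c₃ c₄ c₅ => ?_⟩
    exfalso
    revert w₁ w₂ w₃
    decide
  · refine ⟨((y * z * x⁻¹ : (A ⊗[k] (A ⊗[k] A))ˣ) : A ⊗[k] (A ⊗[k] A)), fun w₁ w₂ w₃ c₁ c₂ c₃ c₄ c₅ => ?_⟩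
    have hw : (w₁ = false ∧ w₂ = false ∧ w₃ = true) ∨
        (w₁ = true ∧ w₂ = true ∧ w₃ = false) := by
      revert w₁ w₂ w₃; decide
    obtain ⟨rfl, rfl, rfl⟩ | ⟨rfl, rfl, rfl⟩ := hw
    · rw [braidTensor_fft, hx', hy, hz]; rfl
    · rw [q5, braidTensor_ttf, hx', hy, hz]; rfl
  · refine ⟨((x * z⁻¹ * y⁻¹ : (A ⊗[k] (A ⊗[k] A))ˣ) : A ⊗[k] (A ⊗[k] A)), fun w₁ w₂ w₃ c₁ c₂ c₃ c₄ c₅ => ?_⟩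
    have hw : (w₁ = true ∧ w₂ = true ∧ w₃ = false) ∨
        (w₁ = false ∧ w₂ = false ∧ w₃ = true) := by
      revert w₁ w₂ w₃; decide
    obtain ⟨rfl, rfl, rfl⟩ | ⟨rfl, rfl, rfl⟩ := hw
    · rw [braidTensor_ttf, hx, hy', hz']; rfl
    · rw [q2, braidTensor_fft, hx, hy', hz']; rfl
  · refine ⟨0, fun w₁ w₂ w₃ c₁ c₂ c₃ c₄ c₅ => ?_⟩
    exfalso
    revert w₁ w₂ w₃
    decide
  · refine ⟨((y * x * z⁻¹ : (A ⊗[k] (A ⊗[k] A))ˣ) : A ⊗[k] (A ⊗[k] A)), fun w₁ w₂ w₃ c₁ c₂ c₃ c₄ c₅ => ?_⟩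
    have hw : (w₁ = false ∧ w₂ = true ∧ w₃ = true) ∨
        (w₁ = true ∧ w₂ = false ∧ w₃ = false) := by
      revert w₁ w₂ w₃; decide
    obtain ⟨rfl, rfl, rfl⟩ | ⟨rfl, rfl, rfl⟩ := hw
    · rw [braidTensor_ftt, hx, hy, hz']; rfl
    · rw [q4, braidTensor_tff, hx, hy, hz']; rfl
  · refine ⟨((x * y * z : (A ⊗[k] (A ⊗[k] A))ˣ) : A ⊗[k] (A ⊗[k] A)), fun w₁ w₂ w₃ c₁ c₂ c₃ c₄ c₅ => ?_⟩
    have hw : (w₁ = true ∧ w₂ = true ∧ w₃ = true) ∨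
        (w₁ = false ∧ w₂ = false ∧ w₃ = false) := by
      revert w₁ w₂ w₃; decide
    obtain ⟨rfl, rfl, rfl⟩ | ⟨rfl, rfl, rfl⟩ := hw
    · rw [braidTensor_ttt, hx, hy, hz]; rfl
    · rw [h, braidTensor_fff, hx, hy, hz]; rfl

/-- As for two strands, one power of S comes out of the product on each strand and removes its
orientation. The crossings 0, 1, 2 are those of the first with the second, the first with the third
and the second with the third strand. -/
lemma localTensor_three {o u : Fin 3 → ℝ} (hinj : Function.Injective (Sum.elim o u))
    {I₁ I₂ I₃ : Set ℝ} (h₁₂ : Disjoint I₁ I₂) (h₁₃ : Disjoint I₁ I₃) (h₂₃ : Disjoint I₂ I₃)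
    (o₀ : o 0 ∈ I₁) (u₀ : u 0 ∈ I₂) (o₁ : o 1 ∈ I₁) (u₁ : u 1 ∈ I₃) (o₂ : o 2 ∈ I₂)
    (u₂ : u 2 ∈ I₃) (n₁ n₂ n₃ m₀ m₁ m₂ : ℤ) {w₁ w₂ w₃ : Bool}
    (h₁ : Even n₁ ↔ (w₁ = true ↔ o 0 < o 1)) (h₂ : Even n₂ ↔ (w₂ = true ↔ u 0 < o 2))
    (h₃ : Even n₃ ↔ (w₃ = true ↔ u 1 < u 2)) :
    H.localTensor o u ![n₁, n₁, n₂] ![n₂ + m₀, n₃ + m₁, n₃ + m₂] I₁ I₂ I₃ =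
      TensorProduct.map (H.antipodePow n₁).toLinearMap (TensorProduct.map
        (H.antipodePow n₂).toLinearMap (H.antipodePow n₃).toLinearMap)
        (H.braidTensor m₀ m₁ m₂ w₁ w₂ w₃) := by
  classical
  have d₁₂ := Set.disjoint_left.1 h₁₂
  have d₁₃ := Set.disjoint_left.1 h₁₃
  have d₂₃ := Set.disjoint_left.1 h₂₃
  have f₁ : (siteTimes o u).filter (· ∈ I₁) = {o 0, o 1} :=
    filter_mem_eq_pair (over_mem_siteTimes _ _ _) (over_mem_siteTimes _ _ _) o₀ o₁
      (forall_siteTimes_three (fun _ => Or.inl rfl) (fun _ => Or.inr rfl)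
        (fun h => absurd o₂ (d₁₂ h)) (fun h => absurd u₀ (d₁₂ h)) (fun h => absurd u₁ (d₁₃ h))
        (fun h => absurd u₂ (d₁₃ h)))
  have f₂ : (siteTimes o u).filter (· ∈ I₂) = {u 0, o 2} :=
    filter_mem_eq_pair (under_mem_siteTimes _ _ _) (over_mem_siteTimes _ _ _) u₀ o₂
      (forall_siteTimes_three (fun h => absurd h (d₁₂ o₀)) (fun h => absurd h (d₁₂ o₁))
        (fun _ => Or.inr rfl) (fun _ => Or.inl rfl) (fun h => absurd u₁ (d₂₃ h))
        (fun h => absurd u₂ (d₂₃ h)))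
  have f₃ : (siteTimes o u).filter (· ∈ I₃) = {u 1, u 2} :=
    filter_mem_eq_pair (under_mem_siteTimes _ _ _) (under_mem_siteTimes _ _ _) u₁ u₂
      (forall_siteTimes_three (fun h => absurd h (d₁₃ o₀)) (fun h => absurd h (d₁₃ o₁))
        (fun h => absurd h (d₂₃ o₂)) (fun h => absurd h (d₂₃ u₀)) (fun _ => Or.inl rfl)
        (fun _ => Or.inr rfl))
  have ne₁ : o 0 ≠ o 1 := fun h => by
    have := hinj (a₁ := Sum.inl 0) (a₂ := Sum.inl 1) h
    simp at this
  have ne₂ : u 0 ≠ o 2 := fun h => by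
    have := hinj (a₁ := Sum.inr 0) (a₂ := Sum.inl 2) h
    simp at this
  have ne₃ : u 1 ≠ u 2 := fun h => by
    have := hinj (a₁ := Sum.inr 1) (a₂ := Sum.inr 2) h
    simp at this
  rw [localTensor, braidTensor, ← (tripleEquiv (Fin H.expansion.size)).sum_comp,
    Fintype.sum_prod_type, map_sum]
  refine Finset.sum_congr rfl fun i _ => ?_
  rw [Fintype.sum_prod_type, map_sum]
  refine Finset.sum_congr rfl fun j _ => ?_
  rw [map_sum]
  refine Finset.sum_congr rfl fun l _ => ?_
  rw [f₁, f₂, f₃,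
    H.ordProd_strand ne₁ h₁ (y := H.expansion.fst i) (y' := H.expansion.fst j)
      (powBeads_over hinj _ _ _ 0) (powBeads_over hinj _ _ _ 1),
    H.ordProd_strand ne₂ h₂ (y := H.antipodePow m₀ (H.expansion.snd i))
      (y' := H.expansion.fst l)
      ((powBeads_under hinj _ _ _ 0).trans (H.antipodePow_add _ _ _))
      (powBeads_over hinj _ _ _ 2),
    H.ordProd_strand ne₃ h₃ (y := H.antipodePow m₁ (H.expansion.snd j))
      (y' := H.antipodePow m₂ (H.expansion.snd l))
      ((powBeads_under hinj _ _ _ 1).trans (H.antipodePow_add _ _ _))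
      ((powBeads_under hinj _ _ _ 2).trans (H.antipodePow_add _ _ _))]
  simp

end QuasitriangularStructure

end

noncomputable section

/-! ### The position of a function with one simple zero -/

/-- The derivative makes f positive just after x, and without a further zero the sign cannot change.
-/
lemma pos_of_hasDerivWithinAt_pos {f : ℝ → ℝ} {D x y : ℝ} (hxy : x < y)
    (hf : ContinuousOn f (Set.Icc x y)) (hd : HasDerivWithinAt f D (Set.Icc x y) x) (hD : 0 < D)
    (hx : f x = 0) (hz : ∀ t ∈ Set.Ioc x y, f t ≠ 0) : 0 < f y := by
  by_contra hcon
  have h1 := hasDerivWithinAt_iff_tendsto_slope.1 hd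
  have hset : Set.Icc x y \ {x} = Set.Ioc x y := by
    ext t
    simp only [Set.mem_sdiff, Set.mem_Icc, Set.mem_singleton_iff, Set.mem_Ioc]
    exact ⟨fun h => ⟨lt_of_le_of_ne h.1.1 (Ne.symm h.2), h.1.2⟩,
      fun h => ⟨⟨h.1.le, h.2⟩, h.1.ne'⟩⟩
  rw [hset, nhdsWithin_Ioc_eq_nhdsGT hxy] at h1
  have h2 : ∀ᶠ t in nhdsWithin x (Set.Ioi x), t ∈ Set.Ioc x y := Ioc_mem_nhdsGT hxy
  obtain ⟨t, ht, ht'⟩ := ((h1.eventually (lt_mem_nhds hD)).and h2).exists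
  have hpos : 0 < f t := by
    rw [slope_def_field, hx, sub_zero] at ht
    have := mul_pos ht (sub_pos.2 ht'.1)
    rwa [div_mul_cancel₀ _ (sub_pos.2 ht'.1).ne'] at this
  obtain ⟨z, hz1, hz2⟩ := intermediate_value_Icc' ht'.2
    (hf.mono (Set.Icc_subset_Icc_left ht'.1.le)) ⟨not_lt.1 hcon, hpos.le⟩
  exact hz z ⟨ht'.1.trans_le hz1.1, hz1.2⟩ hz2

/-- The side before z is reflected to the side after z by t ↦ -f(-t), and a negative derivative is
reduced to a positive one by replacing f by -f. -/
lemma pos_iff_of_unique_zero {f : ℝ → ℝ} {D a b z : ℝ} (hf : ContinuousOn f (Set.Icc a b))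
    (hza : z ∈ Set.Icc a b) (hd : HasDerivWithinAt f D (Set.Icc a b) z) (hD : D ≠ 0)
    (h0 : f z = 0) (hz : ∀ t ∈ Set.Icc a b, f t = 0 → t = z) {y : ℝ} (hy : y ∈ Set.Icc a b)
    (hyz : y ≠ z) : 0 < f y ↔ (0 < D ↔ z < y) := by
  have key : ∀ {f : ℝ → ℝ} {D : ℝ}, ContinuousOn f (Set.Icc a b) →
      HasDerivWithinAt f D (Set.Icc a b) z → 0 < D → f z = 0 →
      (∀ t ∈ Set.Icc a b, f t = 0 → t = z) → (0 < f y ↔ z < y) := by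
    intro f D hf hd hD h0 hz
    rcases lt_or_gt_of_ne hyz with hlt | hgt
    · refine iff_of_false ?_ (not_lt.2 hlt.le)
      have hsub : Set.Icc y z ⊆ Set.Icc a b := Set.Icc_subset_Icc hy.1 hza.2
      have hmaps : Set.MapsTo (fun t : ℝ => -t) (Set.Icc (-z) (-y)) (Set.Icc y z) :=
        fun t ht => ⟨by linarith [ht.2], by linarith [ht.1]⟩
      have hd' : HasDerivWithinAt (fun t => -f (-t)) D (Set.Icc (-z) (-y)) (-z) := by
        have h1 : HasDerivWithinAt (fun t : ℝ => -t) (-1) (Set.Icc (-z) (-y)) (-z) :=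
          hasDerivWithinAt_neg _ _
        have h2 : HasDerivWithinAt f D (Set.Icc y z) (-(-z)) := by
          rw [neg_neg]; exact hd.mono hsub
        have := (HasDerivWithinAt.comp (-z) h2 h1 hmaps).neg
        convert! this using 1
        ring
      have := pos_of_hasDerivWithinAt_pos (f := fun t => -f (-t)) (neg_lt_neg hlt)
        ((hf.comp continuousOn_neg (fun t ht => hsub (hmaps ht))).neg) hd' hD (by simp [h0])
        (by
          intro t ht h
          have h1 := hz (-t) (hsub (hmaps ⟨ht.1.le, ht.2⟩)) (neg_eq_zero.1 h)
          linarith [ht.1])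
      simp only [neg_neg] at this
      linarith
    · refine iff_of_true ?_ hgt
      have hsub : Set.Icc z y ⊆ Set.Icc a b := Set.Icc_subset_Icc hza.1 hy.2
      exact pos_of_hasDerivWithinAt_pos hgt (hf.mono hsub) (hd.mono hsub) hD h0
        (fun t ht h => ht.1.ne' (hz t (hsub ⟨ht.1.le, ht.2⟩) h))
  rcases lt_or_gt_of_ne hD with hneg | hpos
  · have h1 := key (f := fun t => -f t) hf.neg hd.neg (neg_pos.2 hneg) (by simp [h0])
      (fun t ht h => hz t ht (neg_eq_zero.1 h))
    have h2 : f y ≠ 0 := fun h => hyz (hz y hy h)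
    have h3 : 0 < f y ↔ ¬ 0 < -f y := by
      rw [neg_pos, not_lt]
      exact ⟨le_of_lt, fun h => lt_of_le_of_ne h h2.symm⟩
    rw [h3, h1]
    simp [not_lt.2 hneg.le]
  · rw [key hf hd hpos h0 hz]
    simp [hpos]

/-! ### Strands as graphs over the height, and their positions above and below a crossing. -/

namespace Window

variable {W : Window} {K K' : BiframedDiagram} {a b c d e f : ℝ}

lemma IsStrand.bijOn (h : W.IsStrand K a b) :
    Set.BijOn (W.height K) (Set.Icc a b) (Set.Icc (-1) 1) := by
  have hab := h.bounds.2.1.le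
  have ma := Set.left_mem_Icc.2 hab
  have mb := Set.right_mem_Icc.2 hab
  have hc := (W.continuousOn_height K).mono h.subset
  refine ⟨fun t ht => ?_, h.injOn, ?_⟩
  · rcases h.cases with ⟨-, h1, h2, h3⟩ | ⟨-, h1, h2, h3⟩
    · rw [← h3, ← h2]
      exact ⟨h1.antitoneOn ht mb ht.2, h1.antitoneOn ma ht ht.1⟩
    · rw [← h2, ← h3]
      exact ⟨h1.monotoneOn ma ht ht.1, h1.monotoneOn ht mb ht.2⟩
  · rcases h.cases with ⟨-, h1, h2, h3⟩ | ⟨-, h1, h2, h3⟩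
    · rw [← h3, ← h2]
      exact intermediate_value_Icc' hab hc
    · rw [← h2, ← h3]
      exact intermediate_value_Icc hab hc

/-- A strand may be parametrized by the height. -/
lemma IsStrand.exists_section (h : W.IsStrand K a b) : ∃ τ : ℝ → ℝ, Continuous τ ∧
    (∀ y, τ y ∈ Set.Icc a b) ∧ ∀ y ∈ Set.Icc (-1 : ℝ) 1, W.height K (τ y) = y := by
  let E := Set.BijOn.equiv (W.height K) h.bijOn
  have hE : Continuous E :=
    ((W.continuousOn_height K).mono h.subset).domRestrict.subtype_mk _
  let F := hE.homeoOfEquivCompactToT2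
  have h11 : (-1 : ℝ) ≤ 1 := by norm_num
  refine ⟨fun y => (F.symm (Set.projIcc (-1 : ℝ) 1 h11 y) : ℝ),
    continuous_subtype_val.comp (F.symm.continuous.comp (continuous_projIcc (h := h11))),
    fun y => (F.symm _).2, fun y hy => ?_⟩
  have := congrArg Subtype.val (F.apply_symm_apply (Set.projIcc (-1 : ℝ) 1 h11 y))
  simp only [Set.projIcc_of_mem h11 hy] at this ⊢
  exact this

/-- This is the derivative of an inverse function; it is taken within [-1, 1] because a crossing may
lie on the top or bottom side of the window. -/
lemma IsStrand.hasDerivWithinAt_section (h : W.IsStrand K a b) {τ : ℝ → ℝ} (hτ : Continuous τ)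
    (hm : ∀ y, τ y ∈ Set.Icc a b) (hs : ∀ y ∈ Set.Icc (-1 : ℝ) 1, W.height K (τ y) = y) {y : ℝ}
    (hy : y ∈ Set.Icc (-1 : ℝ) 1) : HasDerivWithinAt τ
      ((W.direction (K.velocity (τ y))).im)⁻¹ (Set.Icc (-1) 1) y := by
  have h1 := W.hasDerivWithinAt_height K (h.subset (hm y))
  have hne := h.im_ne_zero (hm y)
  have h2 : HasFDerivWithinAt (W.height K) ((ContinuousLinearEquiv.unitsEquivAut ℝ
      (Units.mk0 _ hne) : ℝ ≃L[ℝ] ℝ) : ℝ →L[ℝ] ℝ) (Set.Icc 0 1) (τ y) := by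
    convert! h1.hasFDerivWithinAt using 1
  have h3 := HasFDerivWithinAt.of_local_left_inverse (s := Set.Icc (-1 : ℝ) 1) (a := y)
    (tendsto_nhdsWithin_iff.2 ⟨(hτ.tendsto y).mono_left nhdsWithin_le_nhds,
      Filter.Eventually.of_forall fun z => h.subset (hm z)⟩) h2 hy
    (eventually_mem_nhdsWithin.mono fun z hz => hs z hz)
  convert! h3.hasDerivWithinAt using 1
  simp

/-- The position of two strands with one crossing, above the crossing and below it. -/
lemma IsStrand.re_lt_re_iff (h : W.IsStrand K a b) (h' : W.IsStrand K c d)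
    (hd : Disjoint (Set.Icc a b) (Set.Icc c d)) {s t : ℝ}
    (hst : crossingsBetween K a b c d = {(s, t)}) {x y : ℝ} (hx : x ∈ Set.Icc a b)
    (hy : y ∈ Set.Icc c d) (hxy : W.height K x = W.height K y)
    (hne : W.height K x ≠ W.height K s) :
    (W.coord (K.curve y)).re < (W.coord (K.curve x)).re ↔
      (0 < (-1 : ℝ) ^ (W.turns K c - W.turns K a) * planeDet (K.velocity s) (K.velocity t) ↔
        W.height K s < W.height K x) := by
  have hmem : (s, t) ∈ crossingsBetween K a b c d := by rw [hst]; rfl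
  obtain ⟨hs, ht, hcu⟩ := hmem
  simp only at hs ht hcu
  obtain ⟨τ, hτ, hm, hsec⟩ := h.exists_section
  obtain ⟨τ', hτ', hm', hsec'⟩ := h'.exists_section
  have hsI := h.bijOn.mapsTo hs
  have htI := h'.bijOn.mapsTo ht
  have hxI := h.bijOn.mapsTo hx
  have hhst : W.height K s = W.height K t := W.height_eq_of_curve_eq hcu
  have e1 : ∀ {x}, x ∈ Set.Icc a b → τ (W.height K x) = x := fun hx =>
    h.injOn (hm _) hx (hsec _ (h.bijOn.mapsTo hx))
  have e2 : ∀ {x}, x ∈ Set.Icc c d → τ' (W.height K x) = x := fun hx =>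
    h'.injOn (hm' _) hx (hsec' _ (h'.bijOn.mapsTo hx))
  set X : ℝ → ℝ := fun t => (W.coord (K.curve t)).re with hX
  have hXd : ∀ t ∈ Set.Icc (0 : ℝ) 1, HasDerivWithinAt X (W.direction (K.velocity t)).re
      (Set.Icc 0 1) t := fun t ht =>
    Complex.reCLM.hasFDerivAt.comp_hasDerivWithinAt t (W.hasDerivWithinAt_coord K ht)
  have hXc : ContinuousOn X (Set.Icc 0 1) := fun t ht => (hXd t ht).continuousWithinAt
  have d1 : HasDerivWithinAt (fun y => X (τ y)) ((W.direction (K.velocity s)).re *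
      ((W.direction (K.velocity s)).im)⁻¹) (Set.Icc (-1) 1) (W.height K s) := by
    have := h.hasDerivWithinAt_section hτ hm hsec hsI
    have h2 := hXd (τ (W.height K s)) (h.subset (hm _))
    have h3 := HasDerivWithinAt.comp (W.height K s) h2 this (fun y _ => h.subset (hm y))
    rw [e1 hs] at h3
    exact h3
  have d2 : HasDerivWithinAt (fun y => X (τ' y)) ((W.direction (K.velocity t)).re *
      ((W.direction (K.velocity t)).im)⁻¹) (Set.Icc (-1) 1) (W.height K s) := by
    rw [hhst]
    have := h'.hasDerivWithinAt_section hτ' hm' hsec' htI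
    have h2 := hXd (τ' (W.height K t)) (h'.subset (hm' _))
    have h3 := HasDerivWithinAt.comp (W.height K t) h2 this (fun y _ => h'.subset (hm' y))
    rw [e2 ht] at h3
    exact h3
  set vs := W.direction (K.velocity s) with hvs
  set vt := W.direction (K.velocity t) with hvt
  have n1 : vs.im ≠ 0 := h.im_ne_zero hs
  have n2 : vt.im ≠ 0 := h'.im_ne_zero ht
  have g1 : (-1 : ℝ) ^ W.turns K a * vs.im < 0 := h.neg_one_zpow_mul_im_neg hs
  have g2 : (-1 : ℝ) ^ W.turns K c * vt.im < 0 := h'.neg_one_zpow_mul_im_neg ht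
  have hdet : planeDet (K.velocity s) (K.velocity t) = planeDet vs vt * ‖W.scale‖ ^ 2 := by
    have q1 : K.velocity s = vs * W.scale := (div_mul_cancel₀ _ W.scale_ne_zero).symm
    have q2 : K.velocity t = vt * W.scale := (div_mul_cancel₀ _ W.scale_ne_zero).symm
    rw [q1, q2, ← Complex.normSq_eq_norm_sq, Complex.normSq_apply]
    simp only [planeDet, Complex.mul_re, Complex.mul_im]
    ring
  -- The difference of the slopes of the two graphs at the crossing is a determinant of directions.
  have hD : vs.re * vs.im⁻¹ - vt.re * vt.im⁻¹ = planeDet vs vt / (vs.im * vt.im) := by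
    rw [planeDet]
    field_simp
  have hscale : 0 < ‖W.scale‖ ^ 2 := by
    have := norm_pos_iff.2 W.scale_ne_zero
    positivity
  -- The signs of the vertical components are given by the parities of the half-turns, so the sign
  -- of the slope difference is the sign of the crossing as seen in the window, without
  -- orientations.
  have hDpos : 0 < planeDet vs vt / (vs.im * vt.im) ↔
      0 < (-1 : ℝ) ^ (W.turns K c - W.turns K a) * planeDet (K.velocity s) (K.velocity t) := by
    have hpow : (-1 : ℝ) ^ (W.turns K c - W.turns K a) =
        (-1 : ℝ) ^ W.turns K c * (-1 : ℝ) ^ W.turns K a := by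
      rw [zpow_sub₀ (by norm_num), div_eq_mul_inv, ← inv_zpow]
      norm_num
    have hprod : 0 < ((-1 : ℝ) ^ W.turns K c * (-1 : ℝ) ^ W.turns K a) * (vs.im * vt.im) := by
      have := mul_pos_of_neg_of_neg g1 g2
      linarith
    have : (-1 : ℝ) ^ (W.turns K c - W.turns K a) * planeDet (K.velocity s) (K.velocity t) =
        planeDet vs vt / (vs.im * vt.im) *
          (((-1 : ℝ) ^ W.turns K c * (-1 : ℝ) ^ W.turns K a) * (vs.im * vt.im) *
            ‖W.scale‖ ^ 2) := by
      rw [hpow, hdet]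
      field_simp
    rw [this]
    exact (mul_pos_iff_of_pos_right (mul_pos hprod hscale)).symm
  have hdne : planeDet (K.velocity s) (K.velocity t) ≠ 0 := K.transverse s (h.subset hs) t
    (h'.subset ht) (fun e => Set.disjoint_left.1 hd hs (e ▸ ht)) hcu
  have key := pos_iff_of_unique_zero (f := fun y => X (τ y) - X (τ' y)) (y := W.height K x)
    ((hXc.comp hτ.continuousOn (fun y _ => h.subset (hm y))).sub
      (hXc.comp hτ'.continuousOn (fun y _ => h'.subset (hm' y)))) hsI (d1.sub d2)
    (by
      rw [hD, div_ne_zero_iff]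
      refine ⟨fun h0 => hdne ?_, mul_ne_zero n1 n2⟩
      rw [hdet, h0, zero_mul])
    (by
      simp only [hX]
      rw [e1 hs]
      conv_lhs => rw [hhst, e2 ht, hcu]
      exact sub_self _)
    (by
      intro y hy h0
      have hc : K.curve (τ y) = K.curve (τ' y) := by
        have hcoord : W.coord (K.curve (τ y)) = W.coord (K.curve (τ' y)) :=
          Complex.ext (sub_eq_zero.1 h0) ((hsec y hy).trans (hsec' y hy).symm)
        have := (div_left_inj' W.scale_ne_zero).1 hcoord
        exact sub_left_inj.1 this
      have : (τ y, τ' y) ∈ crossingsBetween K a b c d := ⟨hm y, hm' y, hc⟩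
      rw [hst] at this
      have h4 : τ y = s := congrArg Prod.fst (Set.mem_singleton_iff.1 this)
      rw [← h4, hsec y hy])
    hxI hne
  rw [hD, hDpos] at key
  simp only [e1 hx] at key
  conv at key => lhs; rw [hxy, e2 hy]
  rw [← key, sub_pos]

end Window

end

/-! ### The third Reidemeister move, geometric part. -/

noncomputable section

lemma not_iff_not_right {P Q : Prop} : ¬ (P ↔ ¬ Q) ↔ (P ↔ Q) := by tauto

lemma iff_iff_iff_of_iff_not {P Q R S : Prop} (h : (R ↔ ¬ S) ↔ (P ↔ ¬ Q)) :
    (P ↔ Q) ↔ (R ↔ S) := by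
  rw [← not_iff_not_right (P := P), ← not_iff_not_right (P := R), h]

namespace Window

variable {W : Window} {K K' : BiframedDiagram} {a b c d e f : ℝ}

/-- The sign, with respect to the window, of a crossing of strands that begin at `a` and `c`. -/
def crossingSign (W : Window) (K : BiframedDiagram) (a c : ℝ) (p : ℝ × ℝ) : Prop :=
  0 < (-1 : ℝ) ^ (W.turns K c - W.turns K a) * planeDet (K.velocity p.1) (K.velocity p.2)

open Classical in
lemma level_eq_of_isStrand (h : W.IsStrand K a b) (h' : W.IsStrand K c d) {p : ℝ × ℝ}
    (hp : p ∈ K.crossings) (h1 : p.1 ∈ Set.Icc a b) (h2 : p.2 ∈ Set.Icc c d) :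
    K.level p = W.turns K c + (if W.crossingSign K a c p then 0 else -1) - W.turns K a := by
  have := BiframedDiagram.level_eq_of_frame hp W.scale.arg
  change _ = W.turns K p.2 - W.turns K p.1 - (if 0 < (-1 : ℝ) ^ (W.turns K p.2 -
      W.turns K p.1) * _ then 0 else 1) at this
  rw [h.turns_eq h1, h'.turns_eq h2] at this
  rw [this]
  change _ - _ - (if W.crossingSign K a c p then 0 else 1) = _
  split_ifs <;> ring

lemma IsStrand.exists_ends (h : W.IsStrand K a b) (ha : K'.curve a = K.curve a)
    (hb : K'.curve b = K.curve b) :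
    ∃ x ∈ Set.Icc a b, ∃ y ∈ Set.Icc a b, K'.curve x = K.curve x ∧ K'.curve y = K.curve y ∧
      W.height K x = 1 ∧ W.height K y = -1 := by
  have ma := Set.left_mem_Icc.2 h.bounds.2.1.le
  have mb := Set.right_mem_Icc.2 h.bounds.2.1.le
  rcases h.cases with ⟨-, -, h1, h2⟩ | ⟨-, -, h1, h2⟩
  · exact ⟨a, ma, b, mb, ha, hb, h1, h2⟩
  · exact ⟨b, mb, a, ma, hb, ha, h2, h1⟩

/-- The sign of the crossing of two strands with one crossing depends only on the ends. -/
lemma IsStrand.crossingSign_iff (h : W.IsStrand K a b) (h₂ : W.IsStrand K c d)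
    (h' : W.IsStrand K' a b) (h₂' : W.IsStrand K' c d)
    (ha : K'.curve a = K.curve a) (hb : K'.curve b = K.curve b)
    (hc : K'.curve c = K.curve c) (hd : K'.curve d = K.curve d)
    (hdis : Disjoint (Set.Icc a b) (Set.Icc c d)) {p p' : ℝ × ℝ}
    (hp : crossingsBetween K a b c d = {p}) (hp' : crossingsBetween K' a b c d = {p'}) :
    W.crossingSign K a c p ↔ W.crossingSign K' a c p' := by
  obtain ⟨s, t⟩ := p
  obtain ⟨s', t'⟩ := p'
  obtain ⟨x, hx, y, hy, ex, ey, hx1, hy1⟩ := h.exists_ends ha hb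
  obtain ⟨z, hz, w, hw, ez, ew, hz1, hw1⟩ := h₂.exists_ends hc hd
  have hheight : ∀ {t}, K'.curve t = K.curve t → W.height K' t = W.height K t := fun h => by
    rw [height, h, height]
  have m : (s, t) ∈ crossingsBetween K a b c d := by rw [hp]; rfl
  have m' : (s', t') ∈ crossingsBetween K' a b c d := by rw [hp']; rfl
  -- A crossing on the top side is a common end of two strands, and the ends are the same in both
  -- diagrams.
  have htop : W.height K s = 1 ↔ W.height K' s' = 1 := by
    constructor
    · intro h1
      have e1 : s = x := h.injOn m.1 hx (h1.trans hx1.symm)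
      have e2 : t = z := h₂.injOn m.2.1 hz ((W.height_eq_of_curve_eq m.2.2.symm).trans
        (h1.trans hz1.symm))
      have : (x, z) ∈ crossingsBetween K' a b c d :=
        ⟨hx, hz, by have := m.2.2; rw [e1, e2] at this; rw [ex, ez]; exact this⟩
      rw [hp'] at this
      have e3 : x = s' := congrArg Prod.fst (Set.mem_singleton_iff.1 this)
      rw [← e3, hheight ex, hx1]
    · intro h1
      have e1 : s' = x := h'.injOn m'.1 hx (h1.trans ((hheight ex).trans hx1).symm)
      have e2 : t' = z := h₂'.injOn m'.2.1 hz ((W.height_eq_of_curve_eq m'.2.2.symm).trans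
        (h1.trans ((hheight ez).trans hz1).symm))
      have : (x, z) ∈ crossingsBetween K a b c d :=
        ⟨hx, hz, by have := m'.2.2; rw [e1, e2, ex, ez] at this; exact this⟩
      rw [hp] at this
      have e3 : x = s := congrArg Prod.fst (Set.mem_singleton_iff.1 this)
      rw [← e3, hx1]
  -- The sign is read off from the order of two ends: those at the top in general, those at the
  -- bottom if the crossing is itself at the top.
  by_cases h1 : W.height K s = 1
  · have h1' := htop.1 h1
    have q := h.re_lt_re_iff h₂ hdis hp hy hw (hy1.trans hw1.symm)
      (by rw [hy1, h1]; norm_num)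
    have q' := h'.re_lt_re_iff h₂' hdis hp' hy hw
      (((hheight ey).trans hy1).trans ((hheight ew).trans hw1).symm)
      (by rw [hheight ey, hy1, h1']; norm_num)
    rw [hheight ey, hy1, h1', ey, ew] at q'
    rw [hy1, h1] at q
    rw [q] at q'
    norm_num at q'
    rw [← not_lt, ← not_lt, not_iff_not] at q'
    exact q'
  · have h1' := mt htop.2 h1
    have l1 : W.height K s < 1 := lt_of_le_of_ne (h.bijOn.mapsTo m.1).2 h1
    have l1' : W.height K' s' < 1 := lt_of_le_of_ne (h'.bijOn.mapsTo m'.1).2 h1'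
    have q := h.re_lt_re_iff h₂ hdis hp hx hz (hx1.trans hz1.symm)
      (by rw [hx1]; exact Ne.symm h1)
    have q' := h'.re_lt_re_iff h₂' hdis hp' hx hz
      (((hheight ex).trans hx1).trans ((hheight ez).trans hz1).symm)
      (by rw [hheight ex, hx1]; exact Ne.symm h1')
    rw [hheight ex, hx1, ex, ez, iff_true_right l1'] at q'
    rw [hx1, iff_true_right l1] at q
    exact q.symm.trans q'

/-- Relations between the signs and the heights of the crossings of three strands. -/
lemma IsStrand.relations (h₁ : W.IsStrand K a b) (h₂ : W.IsStrand K c d) (h₃ : W.IsStrand K e f)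
    (d₁₂ : Disjoint (Set.Icc a b) (Set.Icc c d)) (d₁₃ : Disjoint (Set.Icc a b) (Set.Icc e f))
    (d₂₃ : Disjoint (Set.Icc c d) (Set.Icc e f)) {p q r : ℝ × ℝ}
    (hp : crossingsBetween K a b c d = {p}) (hq : crossingsBetween K a b e f = {q})
    (hr : crossingsBetween K c d e f = {r}) :
    (p.1 ≠ q.1 ∧ p.2 ≠ r.1 ∧ q.2 ≠ r.2) ∧
    ((W.crossingSign K a e q ↔ W.height K q.1 < W.height K p.1) ↔
      (W.crossingSign K c e r ↔ W.height K r.1 < W.height K p.2)) ∧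
    ((W.crossingSign K a c p ↔ W.height K q.1 < W.height K p.1) ↔
      (W.crossingSign K c e r ↔ W.height K r.2 < W.height K q.2)) ∧
    ((W.crossingSign K a c p ↔ W.height K r.1 < W.height K p.2) ↔
      (W.crossingSign K a e q ↔ W.height K r.2 < W.height K q.2)) := by
  obtain ⟨p, p'⟩ := p
  obtain ⟨q, q'⟩ := q
  obtain ⟨r, r'⟩ := r
  have mp : (p, p') ∈ crossingsBetween K a b c d := by rw [hp]; rfl
  have mq : (q, q') ∈ crossingsBetween K a b e f := by rw [hq]; rfl
  have mr : (r, r') ∈ crossingsBetween K c d e f := by rw [hr]; rfl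
  obtain ⟨p1, p2, p3⟩ := mp
  obtain ⟨q1, q2, q3⟩ := mq
  obtain ⟨r1, r2, r3⟩ := mr
  simp only at p1 p2 p3 q1 q2 q3 r1 r2 r3 ⊢
  have ne12 : ∀ {x y}, x ∈ Set.Icc a b → y ∈ Set.Icc c d → x ≠ y := fun hx hy e =>
    Set.disjoint_left.1 d₁₂ hx (e ▸ hy)
  have ne13 : ∀ {x y}, x ∈ Set.Icc a b → y ∈ Set.Icc e f → x ≠ y := fun hx hy e =>
    Set.disjoint_left.1 d₁₃ hx (e ▸ hy)
  have ne23 : ∀ {x y}, x ∈ Set.Icc c d → y ∈ Set.Icc e f → x ≠ y := fun hx hy e =>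
    Set.disjoint_left.1 d₂₃ hx (e ▸ hy)
  have htriple : ∀ {x y z}, x ∈ Set.Icc a b → y ∈ Set.Icc c d → z ∈ Set.Icc e f →
      K.curve x = K.curve y → K.curve y ≠ K.curve z := by
    intro x y z hx hy hz h h'
    rcases K.no_triple x (h₁.subset hx) y (h₂.subset hy) z (h₃.subset hz) h h' with h | h | h
    exacts [ne12 hx hy h, ne23 hy hz h, ne13 hx hz h]
  have np : p ≠ q := by
    rintro rfl
    exact htriple p1 p2 q2 p3 (p3.symm.trans q3)
  have nr : p' ≠ r := by
    rintro rfl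
    exact htriple p1 p2 r2 p3 r3
  have nq : q' ≠ r' := by
    rintro rfl
    exact htriple q1 r1 q2 (q3.trans r3.symm) r3
  have hp' := W.height_eq_of_curve_eq p3
  have hq' := W.height_eq_of_curve_eq q3
  have hr' := W.height_eq_of_curve_eq r3
  have npq : W.height K p ≠ W.height K q := fun h => np (h₁.injOn p1 q1 h)
  have npr : W.height K p' ≠ W.height K r := fun h => nr (h₂.injOn p2 r1 h)
  have nqr : W.height K q' ≠ W.height K r' := fun h => nq (h₃.injOn q2 r2 h)
  refine ⟨⟨np, nr, nq⟩, ?_, ?_, ?_⟩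
  -- At the height of the crossing of the first two strands both have the same position relative to
  -- the third one. The two descriptions of this position by `re_lt_re_iff` must agree.
  · obtain ⟨z, hz, hzh⟩ := h₃.bijOn.surjOn (h₁.bijOn.mapsTo p1)
    have i1 := h₁.re_lt_re_iff h₃ d₁₃ hq p1 hz hzh.symm npq
    have i2 := h₂.re_lt_re_iff h₃ d₂₃ hr p2 hz (hp'.symm.trans hzh.symm) npr
    rw [p3] at i1
    exact i1.symm.trans i2
  -- The same comparison is made at the height of the crossing of the first and third strands, with
  -- the second strand. As that strand is listed second in one pair and first in the other, the two
  -- positions are opposite, and a triple point would be needed for equality.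
  · obtain ⟨y, hy, hyh⟩ := h₂.bijOn.surjOn (h₁.bijOn.mapsTo q1)
    have i1 := h₁.re_lt_re_iff h₂ d₁₂ hp q1 hy hyh.symm npq.symm
    have i2 := h₂.re_lt_re_iff h₃ d₂₃ hr hy q2 (hyh.trans hq')
      (by rw [hyh, hq', hr']; exact nqr)
    have hne : (W.coord (K.curve y)).re ≠ (W.coord (K.curve q')).re := by
      intro h
      have hcoord : W.coord (K.curve y) = W.coord (K.curve q') := Complex.ext h (hyh.trans hq')
      have := sub_left_inj.1 ((div_left_inj' W.scale_ne_zero).1 hcoord)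
      exact htriple q1 hy q2 (q3.trans this.symm) this
    rw [q3] at i1
    have l1 : W.height K p < W.height K q ↔ ¬ W.height K q < W.height K p := by
      rw [not_lt]; exact ⟨le_of_lt, fun h => lt_of_le_of_ne h npq⟩
    have l2 : (W.coord (K.curve q')).re < (W.coord (K.curve y)).re ↔
        ¬ (W.coord (K.curve y)).re < (W.coord (K.curve q')).re := by
      rw [not_lt]; exact ⟨le_of_lt, fun h => lt_of_le_of_ne h hne.symm⟩
    rw [hyh, hq', hr', l2, i1, ← hq', l1] at i2
    change ¬ (W.crossingSign K a c (p, p') ↔ _) ↔ (W.crossingSign K c e (r, r') ↔ _) at i2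
    rw [hq'] at i2 ⊢
    exact not_iff_not_right.symm.trans i2
  · obtain ⟨x, hx, hxh⟩ := h₁.bijOn.surjOn (h₂.bijOn.mapsTo r1)
    have i1 := h₁.re_lt_re_iff h₂ d₁₂ hp hx r1 hxh (by rw [hxh, hp']; exact npr.symm)
    have i2 := h₁.re_lt_re_iff h₃ d₁₃ hq hx r2 (hxh.trans hr')
      (by rw [hxh, hr', hq']; exact nqr.symm)
    rw [r3, i2] at i1
    rw [hxh] at i1
    have l1 : W.height K p < W.height K r ↔ ¬ W.height K r < W.height K p' := by
      rw [not_lt, hp']; exact ⟨le_of_lt, fun h => lt_of_le_of_ne h npr⟩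
    have l2 : W.height K q < W.height K r ↔ ¬ W.height K r' < W.height K q' := by
      rw [not_lt, hq', hr']; exact ⟨le_of_lt, fun h => lt_of_le_of_ne h nqr⟩
    rw [l1, l2] at i1
    change (W.crossingSign K a e (q, q') ↔ _) ↔ (W.crossingSign K a c (p, p') ↔ _) at i1
    exact iff_iff_iff_of_iff_not i1

end Window

/-- The local tensor of three strands that cross pairwise once. -/
lemma QuasitriangularStructure.localTensor_eq_braidTensor {k A : Type*} [CommRing k] [Ring A]
    [HopfAlgebra k A] (H : QuasitriangularStructure k A) {W : Window} {K : BiframedDiagram}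
    {a b c d e f : ℝ} (h₁ : W.IsStrand K a b) (h₂ : W.IsStrand K c d) (h₃ : W.IsStrand K e f)
    (d₁₂ : Disjoint (Set.Icc a b) (Set.Icc c d)) (d₁₃ : Disjoint (Set.Icc a b) (Set.Icc e f))
    (d₂₃ : Disjoint (Set.Icc c d) (Set.Icc e f)) {p q r : ℝ × ℝ}
    (hp : crossingsBetween K a b c d = {p}) (hq : crossingsBetween K a b e f = {q})
    (hr : crossingsBetween K c d e f = {r}) (op : K.isOver p.1 = true) (oq : K.isOver q.1 = true)
    (or : K.isOver r.1 = true)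
    (hJ : ∀ s ∈ Set.Icc (0 : ℝ) 1, ∀ t ∈ Set.Icc (0 : ℝ) 1, K.curve s = K.curve t →
      (s ∈ Set.Icc a b ∪ Set.Icc c d ∪ Set.Icc e f ↔
        t ∈ Set.Icc a b ∪ Set.Icc c d ∪ Set.Icc e f))
    {e₀ e₁ e₂ : Bool} (s₀ : e₀ = true ↔ W.crossingSign K a c p)
    (s₁ : e₁ = true ↔ W.crossingSign K a e q) (s₂ : e₂ = true ↔ W.crossingSign K c e r)
    {V : A ⊗[k] (A ⊗[k] A)} (hV : ∀ w₁ w₂ w₃ : Bool,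
      ((e₁ = w₁) ↔ (e₂ = w₂)) → ((e₀ = w₁) ↔ (e₂ = w₃)) → ((e₀ = w₂) ↔ (e₁ = w₃)) →
      ¬ (w₁ = true ∧ w₂ = false ∧ w₃ = true) → ¬ (w₁ = false ∧ w₂ = true ∧ w₃ = false) →
      H.braidTensor (if e₀ then 0 else -1) (if e₁ then 0 else -1) (if e₂ then 0 else -1)
        w₁ w₂ w₃ = V) {n₁ n₂ n₃ : ℤ} (t₁ : W.turns K a = n₁) (t₂ : W.turns K c = n₂)
    (t₃ : W.turns K e = n₃) :
    Function.Injective ![p, q, r] ∧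
    (∀ x, (x ∈ K.crossings ∧ x.1 ∈ Set.Icc a b ∪ Set.Icc c d ∪ Set.Icc e f) ↔
      ∃ i, ![p, q, r] i = x) ∧
    (∀ i, ![n₂ + (if e₀ then 0 else -1), n₃ + (if e₁ then 0 else -1),
      n₃ + (if e₂ then 0 else -1)] i - ![n₁, n₁, n₂] i = K.level (![p, q, r] i)) ∧
    H.localTensor (fun i => (![p, q, r] i).1) (fun i => (![p, q, r] i).2) ![n₁, n₁, n₂]
      ![n₂ + (if e₀ then 0 else -1), n₃ + (if e₁ then 0 else -1), n₃ + (if e₂ then 0 else -1)]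
      (Set.Icc a b) (Set.Icc c d) (Set.Icc e f) =
        TensorProduct.map (H.antipodePow n₁).toLinearMap (TensorProduct.map
          (H.antipodePow n₂).toLinearMap (H.antipodePow n₃).toLinearMap) V := by
  classical
  obtain ⟨⟨npq, npr, nqr⟩, c₁, c₂, c₃⟩ := h₁.relations h₂ h₃ d₁₂ d₁₃ d₂₃ hp hq hr
  have mp : p ∈ crossingsBetween K a b c d := by rw [hp]; rfl
  have mq : q ∈ crossingsBetween K a b e f := by rw [hq]; rfl
  have mr : r ∈ crossingsBetween K c d e f := by rw [hr]; rfl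
  have ne12 : ∀ {x y}, x ∈ Set.Icc a b → y ∈ Set.Icc c d → x ≠ y := fun hx hy e =>
    Set.disjoint_left.1 d₁₂ hx (e ▸ hy)
  have ne13 : ∀ {x y}, x ∈ Set.Icc a b → y ∈ Set.Icc e f → x ≠ y := fun hx hy e =>
    Set.disjoint_left.1 d₁₃ hx (e ▸ hy)
  have ne23 : ∀ {x y}, x ∈ Set.Icc c d → y ∈ Set.Icc e f → x ≠ y := fun hx hy e =>
    Set.disjoint_left.1 d₂₃ hx (e ▸ hy)
  have kp : p ∈ K.crossings := K.mem_crossings.2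
    ⟨⟨h₁.subset mp.1, h₂.subset mp.2.1, ne12 mp.1 mp.2.1, mp.2.2⟩, op⟩
  have kq : q ∈ K.crossings := K.mem_crossings.2
    ⟨⟨h₁.subset mq.1, h₃.subset mq.2.1, ne13 mq.1 mq.2.1, mq.2.2⟩, oq⟩
  have kr : r ∈ K.crossings := K.mem_crossings.2
    ⟨⟨h₂.subset mr.1, h₃.subset mr.2.1, ne23 mr.1 mr.2.1, mr.2.2⟩, or⟩
  have hinj : Function.Injective ![p, q, r] := by
    have e1 : p ≠ q := fun h => npq (congrArg Prod.fst h)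
    have e2 : p ≠ r := fun h => ne12 mp.1 mr.1 (congrArg Prod.fst h)
    have e3 : q ≠ r := fun h => nqr (congrArg Prod.snd h)
    intro i j
    fin_cases i <;> fin_cases j <;> simp [e1, e2, e3, e1.symm, e2.symm, e3.symm]
  have hmem : ∀ i, ![p, q, r] i ∈ K.crossings := by
    intro i
    fin_cases i
    exacts [kp, kq, kr]
  refine ⟨hinj, ?_, ?_, ?_⟩
  · intro x
    constructor
    · rintro ⟨hx, hxJ⟩
      have hu := KnotoidDiagram.isOver_snd hx
      obtain ⟨⟨g1, g2, g3, g4⟩, g5⟩ := K.mem_crossings.1 hx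
      have hflip : ∀ {a b c d : ℝ} {p : ℝ × ℝ}, crossingsBetween K a b c d = {p} →
          K.isOver p.1 = true → x.2 ∈ Set.Icc a b → x.1 ∈ Set.Icc c d → False := by
        intro a b c d p hp op h2 h1
        have : (x.2, x.1) ∈ crossingsBetween K a b c d := ⟨h2, h1, g4.symm⟩
        rw [hp] at this
        rw [← Set.mem_singleton_iff.1 this, hu] at op
        exact absurd op (by simp)
      have hfound : ∀ {a b c d : ℝ} {p : ℝ × ℝ}, crossingsBetween K a b c d = {p} →
          x.1 ∈ Set.Icc a b → x.2 ∈ Set.Icc c d → p = x := by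
        intro a b c d p hp h1 h2
        have : x ∈ crossingsBetween K a b c d := ⟨h1, h2, g4⟩
        rw [hp] at this
        exact (Set.mem_singleton_iff.1 this).symm
      have hself : ∀ {a b : ℝ}, W.IsStrand K a b → x.1 ∈ Set.Icc a b → x.2 ∈ Set.Icc a b →
          False := fun h h1 h2 => g3 (h.injOn h1 h2 (W.height_eq_of_curve_eq g4))
      -- Of the nine positions of the two times, three belong to a single strand and contradict the
      -- injectivity of the height, three have over and under exchanged, and three give p, q and r.
      rcases hxJ with (h1 | h1) | h1 <;> rcases (hJ _ g1 _ g2 g4).1 (by simp [h1]) with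
        (h2 | h2) | h2
      · exact (hself h₁ h1 h2).elim
      · exact ⟨0, hfound hp h1 h2⟩
      · exact ⟨1, hfound hq h1 h2⟩
      · exact (hflip hp op h2 h1).elim
      · exact (hself h₂ h1 h2).elim
      · exact ⟨2, hfound hr h1 h2⟩
      · exact (hflip hq oq h2 h1).elim
      · exact (hflip hr or h2 h1).elim
      · exact (hself h₃ h1 h2).elim
    · rintro ⟨i, rfl⟩
      refine ⟨hmem i, ?_⟩
      fin_cases i
      exacts [Or.inl (Or.inl mp.1), Or.inl (Or.inl mq.1), Or.inl (Or.inr mr.1)]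
  · intro i
    fin_cases i
    · change n₂ + (if e₀ then 0 else -1) - n₁ = K.level p
      rw [Window.level_eq_of_isStrand h₁ h₂ kp mp.1 mp.2.1, t₁, t₂]
      simp only [s₀]
    · change n₃ + (if e₁ then 0 else -1) - n₁ = K.level q
      rw [Window.level_eq_of_isStrand h₁ h₃ kq mq.1 mq.2.1, t₁, t₃]
      simp only [s₁]
    · change n₃ + (if e₂ then 0 else -1) - n₂ = K.level r
      rw [Window.level_eq_of_isStrand h₂ h₃ kr mr.1 mr.2.1, t₂, t₃]
      simp only [s₂]
  · have q₁ := h₁.even_turns_iff mp.1 mq.1 npq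
    have q₂ := h₂.even_turns_iff mp.2.1 mr.1 npr
    have q₃ := h₃.even_turns_iff mq.2.1 mr.2.1 nqr
    have hp' := W.height_eq_of_curve_eq mp.2.2
    have hq' := W.height_eq_of_curve_eq mq.2.2
    have hr' := W.height_eq_of_curve_eq mr.2.2
    rw [t₁] at q₁
    rw [t₂] at q₂
    rw [t₃] at q₃
    rw [H.localTensor_three (K.injective_times_comp hinj hmem) d₁₂ d₁₃ d₂₃ mp.1 mp.2.1 mq.1
      mq.2.1 mr.1 mr.2.1 n₁ n₂ n₃ _ _ _
      (w₁ := decide (W.height K q.1 < W.height K p.1))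
      (w₂ := decide (W.height K r.1 < W.height K p.2))
      (w₃ := decide (W.height K r.2 < W.height K q.2)) (by rw [decide_eq_true_iff]; exact q₁)
      (by rw [decide_eq_true_iff]; exact q₂) (by rw [decide_eq_true_iff]; exact q₃)]
    have hbool : ∀ (x : Bool) (P Q : Prop) [Decidable Q], (x = true ↔ P) →
        ((x = decide Q) ↔ (P ↔ Q)) := by
      intro x P Q _ h
      rw [← h, Bool.eq_iff_iff, decide_eq_true_iff]
    rw [hV]
    · rw [hbool _ _ _ s₁, hbool _ _ _ s₂]; exact c₁
    · rw [hbool _ _ _ s₀, hbool _ _ _ s₂]; exact c₂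
    · rw [hbool _ _ _ s₀, hbool _ _ _ s₁]; exact c₃
    -- The two cyclic combinations contradict the transitivity of the order of the heights.
    · simp only [decide_eq_true_iff, decide_eq_false_iff_not, not_lt]
      rintro ⟨g1, g2, g3⟩
      linarith
    · simp only [decide_eq_true_iff, decide_eq_false_iff_not, not_lt]
      rintro ⟨g1, g2, g3⟩
      have g4 := lt_of_le_of_ne g1 fun h => npq (h₁.injOn mp.1 mq.1 h)
      linarith

/-- The strands keep their ends, hence their half-turns in the window and the signs of the three
crossings. Before and after the move the local tensor is the image of the same V, which is
determined by the signs alone. -/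
theorem RibbonStructure.value_eq_of_moveR3 {k A : Type*} [CommRing k] [Ring A] [HopfAlgebra k A]
    (H : RibbonStructure k A) {K K' : BiframedDiagram} (h : MoveR3 K K') :
    H.value K' = H.value K := by
  classical
  obtain ⟨W, a, b, c, d, e, f, d₁₂, d₁₃, d₂₃, hW, hL⟩ := h
  obtain ⟨h₁, h₂, h₃, ⟨p1, p2, hp, op⟩, ⟨q1, q2, hq, oq⟩, ⟨r1, r2, hr, or⟩⟩ := hL K (by simp)
  obtain ⟨h₁', h₂', h₃', ⟨p1', p2', hp', op'⟩, ⟨q1', q2', hq', oq'⟩, ⟨r1', r2', hr', or'⟩⟩ :=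
    hL K' (by simp)
  set J := Set.Icc a b ∪ Set.Icc c d ∪ Set.Icc e f with hJ
  have hcl : IsClosed J := (isClosed_Icc.union isClosed_Icc).union isClosed_Icc
  have ends : ∀ {x y : ℝ} {C : Set ℝ}, W.IsStrand K x y → IsClosed C →
      Disjoint (Set.Icc x y) C → J = Set.Icc x y ∪ C →
      K'.curve x = K.curve x ∧ K'.curve y = K.curve y := by
    intro x y C h hC hd hJ
    obtain ⟨b1, b2, b3⟩ := h.bounds
    exact ⟨hW.curve_eq (h.subset (Set.left_mem_Icc.2 b2.le))
        (by rw [hJ]; exact Window.left_mem_closure b1 b2 b3 hC hd),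
      hW.curve_eq (h.subset (Set.right_mem_Icc.2 b2.le))
        (by rw [hJ]; exact Window.right_mem_closure b1 b2 b3 hC hd)⟩
  obtain ⟨ea, eb⟩ := ends h₁ (isClosed_Icc.union isClosed_Icc)
    (Set.disjoint_union_right.2 ⟨d₁₂, d₁₃⟩) (by rw [hJ, Set.union_assoc])
  obtain ⟨ec, ed⟩ := ends h₂ (isClosed_Icc.union isClosed_Icc)
    (Set.disjoint_union_right.2 ⟨d₁₂.symm, d₂₃⟩)
    (by rw [hJ, ← Set.union_assoc, Set.union_comm (Set.Icc a b)])
  obtain ⟨ee, ef⟩ := ends h₃ (isClosed_Icc.union isClosed_Icc)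
    (Set.disjoint_union_right.2 ⟨d₁₃.symm, d₂₃.symm⟩) (by rw [hJ, Set.union_comm])
  have hplane : ∀ t ∈ Set.Icc (0 : ℝ) 1, t ∈ J → InHalfPlane (K.velocity t) (K'.velocity t) := by
    rintro t - ((ht | ht) | ht)
    exacts [h₁.inHalfPlane h₁' ea ht, h₂.inHalfPlane h₂' ec ht, h₃.inHalfPlane h₃' ee ht]
  have hturn : ∀ {x y : ℝ}, W.IsStrand K x y → W.IsStrand K' x y → K'.curve x = K.curve x →
      W.turns K' x = W.turns K x := fun h h' hc => h.turns_eq_turns h' hc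
    (hW.abs_angle_sub_lt hcl hplane (h.subset (Set.left_mem_Icc.2 h.bounds.2.1.le)))
  obtain ⟨V, hV⟩ := H.exists_braidTensor_eq (decide (W.crossingSign K a c (p1, p2)))
    (decide (W.crossingSign K a e (q1, q2))) (decide (W.crossingSign K c e (r1, r2)))
  obtain ⟨i1, i2, i3, i4⟩ := H.localTensor_eq_braidTensor h₁ h₂ h₃ d₁₂ d₁₃ d₂₃ hp hq hr op oq or
    (fun s hs t ht => hW.mem_iff hs ht) decide_eq_true_iff decide_eq_true_iff decide_eq_true_iff hV
    rfl rfl rfl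
  obtain ⟨i1', i2', i3', i4'⟩ := H.localTensor_eq_braidTensor h₁' h₂' h₃' d₁₂ d₁₃ d₂₃ hp' hq' hr'
    op' oq' or' (fun s hs t ht => hW.symm.mem_iff hs ht)
    (decide_eq_true_iff.trans (h₁.crossingSign_iff h₂ h₁' h₂' ea eb ec ed d₁₂ hp hp'))
    (decide_eq_true_iff.trans (h₁.crossingSign_iff h₃ h₁' h₃' ea eb ee ef d₁₃ hq hq'))
    (decide_eq_true_iff.trans (h₂.crossingSign_iff h₃ h₂' h₃' ec ed ee ef d₂₃ hr hr')) hV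
    (hturn h₁ h₁' ea) (hturn h₂ h₂' ec) (hturn h₃ h₃' ee)
  refine H.value_eq_of_localTensor_eq h₁.bounds.2.1.le h₂.bounds.2.1.le h₃.bounds.2.1.le
    d₁₂ d₁₃ d₂₃ hW ?_ (fun t ht htJ => hW.angle_eq hcl hplane ht htJ) _ i1 i2 _ i1' i2' _ _ i3
    _ _ i3' (i4.trans i4'.symm)
  rintro ((h | h) | h)
  exacts [absurd h.2 (not_le.2 h₁.bounds.2.2), absurd h.2 (not_le.2 h₂.bounds.2.2),
    absurd h.2 (not_le.2 h₃.bounds.2.2)]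

end

noncomputable section

open HopfAlgebra

/-! ### The value of a curl -/

namespace QuasitriangularStructure

variable {k A : Type*} [CommRing k] [Ring A] [HopfAlgebra k A] (H : QuasitriangularStructure k A)

/-- The value of a curl with a crossing of level `j`, on which the over-strand is met first. -/
def overCurl (j : ℤ) : A := LinearMap.mul' k A (H.levelTensor j)

/-- The value of a curl with a crossing of level `j`, on which the under-strand is met first. -/
def underCurl (j : ℤ) : A := LinearMap.mul' k A (TensorProduct.comm k A A (H.levelTensor j))

lemma underCurl_one : H.underCurl 1 = H.u := by
  rw [underCurl, levelTensor, ← H.expansion.sum_eq, u_eq]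
  conv_rhs => rw [← H.expansion.sum_eq]
  simp [drinfeld_tmul, H.antipodePow_one]

/-- The exponents 0 and -2 may be replaced by 2 and 0, which gives ∑ βᵢ S²(αᵢ). -/
lemma underCurl_neg_two : H.underCurl (-2) = H.uInv := by
  have h := H.map_levelTensor 2 0 0
  rw [levelTensor_zero, ← H.expansion.sum_eq] at h
  rw [underCurl, uInv, ← H.expansion.sum_eq]
  have e : (0 + 0 - 2 : ℤ) = -2 := rfl
  rw [e] at h
  rw [← h]
  have h2 : ∀ x, H.antipodePow 2 x = antipode k (antipode k x) := by
    intro x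
    have : (2 : ℤ) = 1 + 1 := rfl
    rw [this, H.antipodePow_add, H.antipodePow_one, H.antipodePow_one]
  simp [h2, H.antipodePow_zero]

/-- S ⊗ S fixes the tensor of the crossing, and S reverses the product of its two beads. -/
lemma overCurl_eq (j : ℤ) : H.overCurl j = antipode k (H.underCurl j) := by
  rw [overCurl, ← H.map_same_levelTensor 1 j, underCurl, levelTensor_eq_sum]
  simp [H.antipodePow_one, antipode_mul_antidistrib]

lemma powSum_single_over {o u : ℝ} (h : o < u) (j : ℤ) :
    H.powSum (fun _ : Unit => o) (fun _ => u) (fun _ => 0) (fun _ => j) = H.overCurl j := by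
  have hinj : Function.Injective (Sum.elim (fun _ : Unit => o) (fun _ : Unit => u)) := by
    rintro (⟨⟩ | ⟨⟩) (⟨⟩ | ⟨⟩) e <;> simp_all
  have hT : siteTimes (fun _ : Unit => o) (fun _ : Unit => u) = {o, u} := by
    ext t; simp [mem_siteTimes, eq_comm]
  rw [powSum, overCurl, levelTensor_eq_sum, hT, map_sum,
    ← (Equiv.funUnique Unit (Fin H.expansion.size)).symm.sum_comp]
  refine Finset.sum_congr rfl fun i _ => ?_
  have e1 := powBeads_over (H := H) hinj (fun _ => 0) (fun _ => j) (fun _ => i) ()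
  have e2 := powBeads_under (H := H) hinj (fun _ => 0) (fun _ => j) (fun _ => i) ()
  rw [ordProd_pair h, LinearMap.mul'_apply]
  exact congrArg₂ (· * ·) (e1.trans (H.antipodePow_zero _)) e2

lemma powSum_single_under {o u : ℝ} (h : u < o) (j : ℤ) :
    H.powSum (fun _ : Unit => o) (fun _ => u) (fun _ => 0) (fun _ => j) = H.underCurl j := by
  have hinj : Function.Injective (Sum.elim (fun _ : Unit => o) (fun _ : Unit => u)) := by
    rintro (⟨⟩ | ⟨⟩) (⟨⟩ | ⟨⟩) e <;> simp_all
  have hT : siteTimes (fun _ : Unit => o) (fun _ : Unit => u) = {u, o} := by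
    ext t; simp [mem_siteTimes, eq_comm, or_comm]
  rw [powSum, underCurl, levelTensor_eq_sum, hT, map_sum, map_sum,
    ← (Equiv.funUnique Unit (Fin H.expansion.size)).symm.sum_comp]
  refine Finset.sum_congr rfl fun i _ => ?_
  have e1 := powBeads_over (H := H) hinj (fun _ => 0) (fun _ => j) (fun _ => i) ()
  have e2 := powBeads_under (H := H) hinj (fun _ => 0) (fun _ => j) (fun _ => i) ()
  rw [ordProd_pair h, TensorProduct.comm_tmul, LinearMap.mul'_apply]
  exact congrArg₂ (· * ·) e2 (e1.trans (H.antipodePow_zero _))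

/-- A state sum with a group of crossings that are met in an interval of time without others. -/
lemma powSum_split {ι ι' : Type} [Fintype ι] [DecidableEq ι] [Fintype ι'] [DecidableEq ι']
    {o u : ι → ℝ} {o' u' : ι' → ℝ}
    (h : Function.Injective (Sum.elim (Sum.elim o o') (Sum.elim u u')))
    (h₁ : Function.Injective (Sum.elim o u)) (h₂ : Function.Injective (Sum.elim o' u'))
    (p q : ι → ℤ) (p' q' : ι' → ℤ) {a b : ℝ} (hab : a ≤ b)
    (hout : ∀ t ∈ siteTimes o u, t ∉ Set.Icc a b)
    (hin : ∀ t ∈ siteTimes o' u', t ∈ Set.Icc a b) :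
    H.powSum (Sum.elim o o') (Sum.elim u u') (Sum.elim p p') (Sum.elim q q') =
      ∑ σ, ordProd ((siteTimes o u).filter (· < a)) (H.powBeads o u p q σ) *
        H.powSum o' u' p' q' *
        ordProd ((siteTimes o u).filter (b < ·)) (H.powBeads o u p q σ) := by
  rw [powSum_sum]
  refine Finset.sum_congr rfl fun σ _ => ?_
  rw [powSum, Finset.mul_sum, Finset.sum_mul]
  refine Finset.sum_congr rfl fun σ' _ => ?_
  rw [ordProd_split hout hin hab]
  congr 1
  · congr 1
    · exact ordProd_congr fun t ht => powBeads_sum_left h₁ h (Finset.mem_filter.1 ht).1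
    · exact ordProd_congr fun t ht => powBeads_sum_right h₂ h ht
  · exact ordProd_congr fun t ht => powBeads_sum_left h₁ h (Finset.mem_filter.1 ht).1

end QuasitriangularStructure

namespace RibbonStructure

variable {k A : Type*} [CommRing k] [Ring A] [HopfAlgebra k A] (H : RibbonStructure k A)

/-- `S(u)` as a unit. -/
def antipodeUUnit : Aˣ where
  val := antipode k H.u
  inv := antipode k H.uInv
  val_inv := by rw [← antipode_mul_antidistrib, H.uInv_mul_u, antipode_one]
  inv_val := by rw [← antipode_mul_antidistrib, H.u_mul_uInv, antipode_one]

/-- This is G² = u² v⁻² = u² (u S(u))⁻¹; it is the place where the ribbon relation v² = S(u)u meets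
the curls. -/
lemma balancing_sq : H.balancing ^ (2 : ℤ) = H.uUnit * H.antipodeUUnit⁻¹ := by
  have h1 : H.vUnit * H.vUnit = H.uUnit * H.antipodeUUnit :=
    Units.ext ((sq H.v).symm.trans (H.v_sq.trans H.antipode_u_mul_u))
  have h2 : H.vUnit⁻¹ * H.uUnit = H.uUnit * H.vUnit⁻¹ :=
    (Commute.inv_left (H.vUnit_mul H.uUnit)).eq
  have h3 : H.vUnit⁻¹ * H.vUnit⁻¹ = H.antipodeUUnit⁻¹ * H.uUnit⁻¹ := by
    rw [← mul_inv_rev, ← mul_inv_rev, h1]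
  have h4 : H.antipodeUUnit * H.uUnit = H.uUnit * H.antipodeUUnit :=
    Units.ext H.antipode_u_mul_u
  have h5 : H.antipodeUUnit⁻¹ * H.uUnit⁻¹ = H.uUnit⁻¹ * H.antipodeUUnit⁻¹ := by
    rw [← mul_inv_rev, ← mul_inv_rev, h4]
  rw [zpow_two, balancing, mul_assoc, ← mul_assoc H.vUnit⁻¹, h2, mul_assoc, h3, h5]
  group

/-- The curls exchanged by R1' have crossings of equal level, but one meets the over-strand first
and the other the under-strand. For the level -2 the values are S(u)⁻¹ and u⁻¹, and for the level 1
they are S(u) and u. -/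
lemma overCurl_neg_two : H.overCurl (-2) =
    H.underCurl (-2) * ((H.balancing ^ (2 : ℤ) : Aˣ) : A) := by
  rw [H.overCurl_eq, H.underCurl_neg_two, H.balancing_sq]
  have : H.antipodeUUnit⁻¹ = H.uUnit⁻¹ * (H.uUnit * H.antipodeUUnit⁻¹) := by group
  exact congrArg Units.val this

lemma underCurl_one_eq : H.underCurl 1 =
    H.overCurl 1 * ((H.balancing ^ (2 : ℤ) : Aˣ) : A) := by
  rw [H.overCurl_eq, H.underCurl_one, H.balancing_sq]
  have h4 : H.antipodeUUnit * H.uUnit = H.uUnit * H.antipodeUUnit :=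
    Units.ext H.antipode_u_mul_u
  have : H.uUnit = H.antipodeUUnit * (H.uUnit * H.antipodeUUnit⁻¹) := by
    rw [← mul_assoc, h4, mul_inv_cancel_right]
  exact congrArg Units.val this

/-- Conjugation of all factors of an ordered product. -/
lemma ordProd_conj {A : Type*} [Ring A] (g : Aˣ) (T : Finset ℝ) {b b' : ℝ → A}
    (h : ∀ t ∈ T, b' t = g * b t * ((g⁻¹ : Aˣ) : A)) :
    ordProd T b' = g * ordProd T b * ((g⁻¹ : Aˣ) : A) := by
  induction T using Finset.induction_on_min with
  | empty => simp
  | insert a s hs ih =>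
    rw [ordProd_insert_min hs, ordProd_insert_min hs, h a (Finset.mem_insert_self _ _),
      ih fun t ht => h t (Finset.mem_insert_of_mem ht)]
    simp [mul_assoc]

end RibbonStructure

end

/-! ### The move R1'. -/

noncomputable section

namespace Window

variable {W : Window} {K K' : BiframedDiagram} {a b : ℝ}

/-- The change of the number of half-turns when the direction becomes horizontal. -/
lemma turns_around (W : Window) (K : BiframedDiagram) {x m y : ℝ} (hx : 0 ≤ x) (hxm : x < m)
    (hmy : m < y) (hy : y ≤ 1) (h0 : (W.direction (K.velocity m)).im = 0)
    (h : ∀ t ∈ Set.Ico x m, (W.direction (K.velocity t)).im ≠ 0)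
    (h' : ∀ t ∈ Set.Ioc m y, (W.direction (K.velocity t)).im ≠ 0) :
    ∃ j : ℤ, (W.turns K x = j ∨ W.turns K x = j + 1) ∧
      (W.turns K y = j ∨ W.turns K y = j + 1) ∧
      ((W.direction (K.velocity m)).re < 0 ↔ Odd j) ∧
      (0 < (W.direction (K.velocity m)).re ↔ Even j) := by
  have hsub : Set.Icc x y ⊆ Set.Icc 0 1 := Set.Icc_subset_Icc hx hy
  have hsin : ∀ t ∈ Set.Icc x y, Real.sin (K.angle t - W.scale.arg) = 0 ↔
      (W.direction (K.velocity t)).im = 0 := by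
    intro t ht
    rw [W.direction_im K (hsub ht), mul_eq_zero]
    exact (or_iff_right (W.norm_div_pos K (hsub ht)).ne').symm
  have mm : m ∈ Set.Icc x y := ⟨hxm.le, hmy.le⟩
  obtain ⟨j, hj, hjx, hjy⟩ := exists_halfTurns_around (f := fun t => K.angle t - W.scale.arg) hxm
    hmy ((K.isAngle.cont.mono hsub).sub continuousOn_const) ((hsin m mm).2 h0)
    (fun t ht => (hsin t ⟨ht.1, ht.2.le.trans hmy.le⟩).not.2 (h t ht))
    (fun t ht => (hsin t ⟨hxm.le.trans ht.1.le, ht.2⟩).not.2 (h' t ht))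
  have hn := W.norm_div_pos K (hsub mm)
  refine ⟨j, hjx, hjy, ?_, ?_⟩
  · rw [W.direction_re K (hsub mm), hj, ← cos_int_mul_pi_neg_iff]
    exact ⟨fun h => by by_contra hc; exact absurd h (not_lt.2 (mul_nonneg hn.le (not_lt.1 hc))),
      fun h => mul_neg_of_pos_of_neg hn h⟩
  · rw [W.direction_re K (hsub mm), hj, ← cos_int_mul_pi_pos_iff]
    exact mul_pos_iff_of_pos_left hn

namespace IsCurl

variable {cw fo : Bool}

lemma bounds (h : W.IsCurl K a b cw fo) : 0 < a ∧ a < b ∧ b < 1 := ⟨h.1.1, h.1.2.1, h.1.2.2.1⟩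

lemma im_left_neg (h : W.IsCurl K a b cw fo) : (W.direction (K.velocity a)).im < 0 := by
  obtain ⟨-, p, q, s, t, h1, h2, h3, h4, h5, h6, -⟩ := h
  exact h6 a ⟨le_rfl, h1.trans_lt h2⟩

lemma im_right_neg (h : W.IsCurl K a b cw fo) : (W.direction (K.velocity b)).im < 0 := by
  obtain ⟨-, p, q, s, t, h1, h2, h3, h4, h5, h6, h7, h8, h9, h10, -⟩ := h
  exact h10 b ⟨h4.trans_le h5, le_rfl⟩

/-- At each of the two bends the counts before and after are in {j, j + 1}. The pieces going down
are even and the piece going up is odd, and the horizontal direction at the bend fixes the parity of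
j; so each bend contributes -1 for a clockwise curl and 1 for a counterclockwise one. -/
lemma turns_eq (h : W.IsCurl K a b cw fo) :
    W.turns K b = W.turns K a + (if cw then -2 else 2) := by
  obtain ⟨ha, -, hb⟩ := h.bounds
  obtain ⟨-, p, q, s, t, h1, h2, h3, h4, h5, h6, h7, h8, h9, h10, -, -, -, h11⟩ := h
  have hap : a < p := h1.trans_lt h2
  have hqb : q < b := h4.trans_le h5
  set m := (p + q) / 2 with hm
  have hpm : p < m := by rw [hm]; linarith
  have hmq : m < q := by rw [hm]; linarith
  have b1 : a ∈ Set.Icc (0 : ℝ) 1 := ⟨ha.le, by linarith⟩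
  have b2 : m ∈ Set.Icc (0 : ℝ) 1 := ⟨by linarith, by linarith⟩
  have b3 : b ∈ Set.Icc (0 : ℝ) 1 := ⟨by linarith, hb.le⟩
  have ia := h6 a ⟨le_rfl, hap⟩
  have im := h8 m ⟨hpm, hmq⟩
  have ib := h10 b ⟨hqb, le_rfl⟩
  have ea := (W.turns_even_iff K b1 ia.ne).2 ia
  have em := mt (W.turns_even_iff K b2 im.ne').1 im.not_gt
  have eb := (W.turns_even_iff K b3 ib.ne).2 ib
  obtain ⟨j, j1, j2, j3, j4⟩ := W.turns_around K ha.le hap hpm (by linarith) h7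
    (fun r hr => (h6 r hr).ne) (fun r hr => (h8 r ⟨hr.1, hr.2.trans_lt hmq⟩).ne')
  obtain ⟨i, i1, i2, i3, i4⟩ := W.turns_around K b2.1 hmq hqb hb.le h9
    (fun r hr => (h8 r ⟨hpm.trans_le hr.1, hr.2⟩).ne') (fun r hr => (h10 r hr).ne)
  rw [Int.even_iff] at ea em eb j4 i4
  rw [Int.odd_iff] at j3 i3
  cases cw
  · simp only [Bool.false_eq_true, if_false] at h11 ⊢
    have := j4.1 h11.1
    have := i3.1 h11.2.1
    omega
  · simp only [if_true] at h11 ⊢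
    have := j3.1 h11.1
    have := i4.1 h11.2.1
    omega

lemma even_turns (h : W.IsCurl K a b cw fo) : Even (W.turns K a) := by
  obtain ⟨ha, hab, hb⟩ := h.bounds
  exact (W.turns_even_iff K ⟨ha.le, (hab.trans hb).le⟩ h.im_left_neg.ne).2 h.im_left_neg

/-- The crossing of a curl, as the pair of the times on the over-strand and the under-strand. -/
lemma exists_crossing (h : W.IsCurl K a b cw fo) : ∃ s t : ℝ, s < t ∧
    (∀ x, (x ∈ K.crossings ∧ x.1 ∈ Set.Icc a b ∧ x.2 ∈ Set.Icc a b) ↔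
      (if fo then (s, t) else (t, s)) = x) ∧
    K.level (if fo then (s, t) else (t, s)) = if cw = fo then -2 else 1 := by
  have ht2 := h.turns_eq
  have hev := h.even_turns
  obtain ⟨ha, hab, hb⟩ := h.bounds
  obtain ⟨-, p, q, s, t, h1, h2, h3, h4, h5, h6, h7, h8, h9, h10, hst, huniq, hfo, h11⟩ := h
  have hap : a < p := h1.trans_lt h2
  have hqb : q < b := h4.trans_le h5
  have hsub : Set.Icc a b ⊆ Set.Icc (0 : ℝ) 1 := Set.Icc_subset_Icc ha.le hb.le
  have ms : s ∈ Set.Icc a b := ⟨h1, by linarith⟩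
  have mt : t ∈ Set.Icc a b := ⟨by linarith, h5⟩
  have hlt : s < t := by linarith
  have hts : W.turns K s = W.turns K a := W.turns_const K (s := Set.Ico a p) Set.ordConnected_Ico
    (fun r hr => hsub ⟨hr.1, by linarith [hr.2]⟩) (fun r hr => (h6 r hr).ne) ⟨h1, h2⟩ ⟨le_rfl, hap⟩
  have htt : W.turns K t = W.turns K b := W.turns_const K (s := Set.Ioc q b) Set.ordConnected_Ioc
    (fun r hr => hsub ⟨by linarith [hr.1], hr.2⟩) (fun r hr => (h10 r hr).ne) ⟨h4, h5⟩
    ⟨hqb, le_rfl⟩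
  have hot : K.isOver t = !fo := by
    have := K.over_under s (hsub ms) t (hsub mt) hlt.ne hst
    rw [hfo] at this
    cases fo <;> simpa using this.symm
  have hmem : (if fo then (s, t) else (t, s)) ∈ K.crossings := by
    cases fo
    · exact K.mem_crossings.2 ⟨⟨hsub mt, hsub ms, hlt.ne', hst.symm⟩, by simpa using hot⟩
    · exact K.mem_crossings.2 ⟨⟨hsub ms, hsub mt, hlt.ne, hst⟩, hfo⟩
  refine ⟨s, t, hlt, ?_, ?_⟩
  · intro x
    constructor
    · rintro ⟨hx, hx1, hx2⟩
      obtain ⟨⟨g1, g2, g3, g4⟩, g5⟩ := K.mem_crossings.1 hx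
      rcases lt_or_gt_of_ne g3 with hl | hl
      · obtain ⟨e1, e2⟩ := huniq _ hx1 _ hx2 hl g4
        have hf : fo = true := by rw [← hfo, ← e1, g5]
        rw [if_pos hf, ← e1, ← e2]
      · obtain ⟨e1, e2⟩ := huniq _ hx2 _ hx1 hl g4.symm
        have hf : ¬ fo = true := by
          rw [← hfo, ← e1, KnotoidDiagram.isOver_snd hx]; simp
        rw [if_neg hf, ← e1, ← e2]
    · rintro rfl
      refine ⟨hmem, ?_⟩
      split_ifs
      exacts [⟨ms, mt⟩, ⟨mt, ms⟩]
  · rw [BiframedDiagram.level_eq_of_frame hmem W.scale.arg]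
    have hanti : planeDet (K.velocity t) (K.velocity s) =
        -planeDet (K.velocity s) (K.velocity t) := by
      rw [planeDet, planeDet]; ring
    have p2 : (-1 : ℝ) ^ (2 : ℤ) = 1 := by norm_num
    have p3 : (-1 : ℝ) ^ (-2 : ℤ) = 1 := by norm_num
    change W.turns K _ - W.turns K _ - (if 0 < (-1 : ℝ) ^ (W.turns K _ - W.turns K _) * _
      then 0 else 1) = _
    -- From the over-strand to the under-strand the half-turns change by -2 or 2. The sign of the
    -- determinant leaves -2 as it is and lowers 2 to 1.
    cases fo <;> cases cw <;> simp only [Bool.false_eq_true, if_false, if_true, reduceCtorEq] at *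
      <;> rw [hts, htt, ht2]
    · have e : W.turns K a - (W.turns K a + 2) = -2 := by ring
      rw [e, p3, one_mul, hanti, if_pos (neg_pos.2 h11.2.2)]
      rfl
    · have e : W.turns K a - (W.turns K a + -2) = 2 := by ring
      rw [e, p2, one_mul, hanti, if_neg (by linarith [h11.2.2])]
      rfl
    · have e : W.turns K a + 2 - W.turns K a = 2 := by ring
      rw [e, p2, one_mul, if_neg (by linarith [h11.2.2])]
      rfl
    · have e : W.turns K a + -2 - W.turns K a = -2 := by ring
      rw [e, p3, one_mul, if_pos h11.2.2]
      rfl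

/-- The angles of diagrams that differ by curls with opposite directions. -/
lemma angle_eq (h : W.IsCurl K a b true fo) {fo' : Bool} (h' : W.IsCurl K' a b false fo')
    (hW : W.DifferOnlyIn (Set.Icc a b) K K') {t : ℝ} (ht : t ∈ Set.Icc (0 : ℝ) 1)
    (htJ : t ∉ Set.Icc a b) :
    K'.angle t = K.angle t + (if b < t then 4 * Real.pi else 0) := by
  obtain ⟨ha, hab, hb⟩ := h.bounds
  have hvel := fun {t} (ht : t ∈ Set.Icc (0 : ℝ) 1) htJ => hW.velocity_eq isClosed_Icc ht htJ
  have hleft : ∀ t ∈ Set.Icc 0 a, |K'.angle t - K.angle t| < Real.pi := by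
    refine K.isAngle.abs_sub_lt K'.isAngle le_rfl (hab.trans hb).le (s := 0) ⟨le_rfl, ha.le⟩ ?_ ?_
    · rw [K.angle_zero, K'.angle_zero, sub_self, abs_zero]
      exact Real.pi_pos
    · intro t ht
      have ht1 : t ∈ Set.Icc (0 : ℝ) 1 := ⟨ht.1, ht.2.trans (hab.trans hb).le⟩
      rcases eq_or_lt_of_le ht.2 with rfl | hlt
      · exact inHalfPlane_of_im_neg h.im_left_neg h'.im_left_neg
      · rw [hvel ht1 fun h => absurd h.1 (not_le.2 hlt)]
        exact InHalfPlane.refl (K.velocity_ne_zero ht1)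
  have hna : W.turns K' a = W.turns K a :=
    eq_halfTurns_of_abs_sub_lt (by rw [sub_sub_sub_cancel_right]; exact hleft a ⟨ha.le, le_rfl⟩)
      (iff_of_true h'.even_turns h.even_turns)
  have hnb : halfTurns (K'.angle b - W.scale.arg) = halfTurns (K.angle b - W.scale.arg) + 4 := by
    have e1 := h.turns_eq
    have e2 := h'.turns_eq
    simp only [if_true, Bool.false_eq_true, if_false] at e1 e2
    change W.turns K' b = W.turns K b + 4
    omega
  -- The curls contribute 2 and -2 half-turns, so behind the window the angles differ by four
  -- half-turns; subtracting 4π makes them comparable there.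
  have hang : IsAngle K'.velocity (fun t => K'.angle t - 4 * Real.pi) := by
    refine ⟨K'.isAngle.cont.sub continuousOn_const, fun t ht => ?_⟩
    have : Complex.exp ((K'.angle t - 4 * Real.pi : ℝ) * Complex.I) =
        Complex.exp (K'.angle t * Complex.I) := by
      rw [Complex.exp_eq_exp_iff_exists_int]
      exact ⟨-2, by push_cast; ring⟩
    rw [this]
    exact K'.isAngle.eq t ht
  have hb0 : |K'.angle b - 4 * Real.pi - K.angle b| < Real.pi := by
    obtain ⟨g1, g2⟩ := halfTurns_spec (K.angle b - W.scale.arg)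
    obtain ⟨g3, g4⟩ := halfTurns_spec (K'.angle b - W.scale.arg)
    rw [hnb] at g3 g4
    push_cast at g3 g4
    rw [abs_lt]
    constructor <;> nlinarith
  have hright : ∀ t ∈ Set.Icc b 1, |K'.angle t - 4 * Real.pi - K.angle t| < Real.pi := by
    refine K.isAngle.abs_sub_lt hang (ha.trans hab).le le_rfl (s := b) ⟨le_rfl, hb.le⟩ hb0 ?_
    intro t ht
    have ht1 : t ∈ Set.Icc (0 : ℝ) 1 := ⟨(ha.trans hab).le.trans ht.1, ht.2⟩
    rcases eq_or_lt_of_le ht.1 with rfl | hlt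
    · exact inHalfPlane_of_im_neg h.im_right_neg h'.im_right_neg
    · rw [hvel ht1 fun h => absurd h.2 (not_le.2 hlt)]
      exact InHalfPlane.refl (K.velocity_ne_zero ht1)
  split_ifs with hbt
  · have := K.isAngle.eq_of_abs_sub_lt hang ht (hvel ht htJ).symm (K.velocity_ne_zero ht)
      (hright t ⟨hbt.le, ht.2⟩)
    linarith
  · have hta : t ≤ a := by
      by_contra hcon
      exact htJ ⟨(not_le.1 hcon).le, not_lt.1 hbt⟩
    rw [add_zero]
    exact K.isAngle.eq_of_abs_sub_lt K'.isAngle ht (hvel ht htJ).symm (K.velocity_ne_zero ht)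
      (hleft t ⟨ht.1, hta⟩)

end IsCurl

end Window

lemma floor_div_pi_add (x : ℝ) (m : ℤ) : ⌊(x + m * Real.pi) / Real.pi⌋ = ⌊x / Real.pi⌋ + m := by
  rw [add_div, mul_div_cancel_right₀ _ Real.pi_ne_zero, Int.floor_add_intCast]

/-- If X is the product behind the curl, c and c' the values of the two curls and r the rotation,
then c X G^r is compared with c' (G² X G⁻²) G^(2 + r). These agree because c = c' G². -/
theorem RibbonStructure.value_eq_of_moveR1' {k A : Type*} [CommRing k] [Ring A] [HopfAlgebra k A]
    (H : RibbonStructure k A) {K K' : BiframedDiagram} (h : MoveR1' K K') :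
    H.value K' = H.value K := by
  classical
  obtain ⟨W, a, b, fo, hW, hc, hc'⟩ := h
  obtain ⟨ha, hab, hb⟩ := hc.bounds
  have hang := fun {t} ht htJ => hc.angle_eq hc' hW (t := t) ht htJ
  obtain ⟨s, t, hst, hcr, hlev⟩ := hc.exists_crossing
  obtain ⟨s', t', hst', hcr', hlev'⟩ := hc'.exists_crossing
  set J := Set.Icc a b with hJ
  set O := K.crossings.filter (fun c => c.1 ∉ J) with hOdef
  have hO : ∀ c, c ∈ O ↔ c ∈ K.crossings ∧ c.1 ∉ J := fun c => Finset.mem_filter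
  have hO' : ∀ c, c ∈ O ↔ c ∈ K'.crossings ∧ c.1 ∉ J := fun c => by
    rw [hO]
    exact ⟨fun hc => ⟨hW.mem_crossings hc.1 hc.2, hc.2⟩,
      fun hc => ⟨hW.symm.mem_crossings hc.1 hc.2, hc.2⟩⟩
  have htwo : ∀ L : BiframedDiagram, (∀ s ∈ Set.Icc (0 : ℝ) 1, ∀ t ∈ Set.Icc (0 : ℝ) 1,
      L.curve s = L.curve t → (s ∈ J ↔ t ∈ J)) → ∀ c ∈ L.crossings, c.1 ∈ J ↔ c.2 ∈ J := by
    intro L hL c hc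
    obtain ⟨⟨h1, h2, h3, h4⟩, h5⟩ := L.mem_crossings.1 hc
    exact hL _ h1 _ h2 h4
  have hK := htwo K (fun s hs t ht => hW.mem_iff hs ht)
  have hK' := htwo K' (fun s hs t ht => hW.symm.mem_iff hs ht)
  set x := (if fo = true then (s, t) else (t, s)) with hx
  set x' := (if (!fo) = true then (s', t') else (t', s')) with hx'
  have hxm := (hcr x).2 rfl
  have hxm' := (hcr' x').2 rfl
  have hone : ∀ x : ℝ × ℝ, Function.Injective (fun _ : Unit => x) := fun x i j _ => rfl
  obtain ⟨hinj, hsum⟩ := H.powSum_crossings K hO (fun _ : Unit => x) (hone x) (by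
    intro c
    rw [exists_const, ← hcr c]
    exact ⟨fun h => ⟨h.1, h.2, (hK c h.1).1 h.2⟩, fun h => ⟨h.1, h.2.1⟩⟩)
  obtain ⟨hinj', hsum'⟩ := H.powSum_crossings K' hO' (fun _ : Unit => x') (hone x') (by
    intro c
    rw [exists_const, ← hcr' c]
    exact ⟨fun h => ⟨h.1, h.2, (hK' c h.1).1 h.2⟩, fun h => ⟨h.1, h.2.1⟩⟩)
  have hOmem : ∀ c : O, (c.1.1 ∈ Set.Icc (0 : ℝ) 1 ∧ c.1.2 ∈ Set.Icc (0 : ℝ) 1) ∧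
      c.1.1 ∉ J ∧ c.1.2 ∉ J := by
    intro c
    obtain ⟨hcK, hcJ⟩ := (hO _).1 c.2
    obtain ⟨⟨h1, h2, h3, h4⟩, h5⟩ := K.mem_crossings.1 hcK
    exact ⟨⟨h1, h2⟩, hcJ, fun h' => hcJ ((hK _ hcK).2 h')⟩
  set o : O → ℝ := fun c => c.1.1 with ho
  set u : O → ℝ := fun c => c.1.2 with hu
  have hout : ∀ t ∈ siteTimes o u, t ∉ J := by
    intro t ht
    obtain ⟨c, rfl | rfl⟩ := mem_siteTimes.1 ht
    exacts [(hOmem c).2.1, (hOmem c).2.2]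
  have hOinj : Function.Injective (Sum.elim o u) :=
    K.injective_times_comp (x := fun c : O => c.1) Subtype.val_injective
      (fun c => ((hO _).1 c.2).1)
  have hin : ∀ t ∈ siteTimes (fun _ : Unit => x.1) (fun _ => x.2), t ∈ J := by
    intro t ht
    obtain ⟨i, rfl | rfl⟩ := mem_siteTimes.1 ht
    exacts [hxm.2.1, hxm.2.2]
  have hin' : ∀ t ∈ siteTimes (fun _ : Unit => x'.1) (fun _ => x'.2), t ∈ J := by
    intro t ht
    obtain ⟨i, rfl | rfl⟩ := mem_siteTimes.1 ht
    exacts [hxm'.2.1, hxm'.2.2]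
  set g : ℝ → ℤ := fun t => if b < t then 4 else 0 with hg
  have hangle : ∀ t ∈ Set.Icc (0 : ℝ) 1, t ∉ J → K'.angle t = K.angle t + g t * Real.pi := by
    intro t ht htJ
    rw [hang ht htJ, hg]
    simp only
    split_ifs <;> simp
  have hlevO : ∀ c : O, K'.level c.1 = K.level c.1 + g c.1.2 - g c.1.1 := by
    intro c
    obtain ⟨⟨h1, h2⟩, h3, h4⟩ := hOmem c
    have e : K.angle c.1.2 + g c.1.2 * Real.pi - (K.angle c.1.1 + g c.1.1 * Real.pi) =
        K.angle c.1.2 - K.angle c.1.1 + (g c.1.2 - g c.1.1 : ℤ) * Real.pi := by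
      push_cast
      ring
    rw [BiframedDiagram.level, hangle _ h1 h3, hangle _ h2 h4, e, floor_div_pi_add, add_sub_assoc]
    rfl
  -- The angle at the head grows by 4π, which is four half-turns and two full turns.
  have hrot : K'.rotation = 2 + K.rotation := by
    have h1 : (1 : ℝ) ∉ J := fun h => absurd h.2 (not_le.2 hb)
    have := floor_div_pi_add (K.angle 1) 4
    rw [BiframedDiagram.rotation, BiframedDiagram.rotation, hangle 1 (by simp) h1, hg]
    simp only [if_pos hb]
    rw [halfTurns, halfTurns, this]
    omega
  have hgJ : ∀ t ∉ J, t < a → g t = 0 := fun t _ hta => if_neg (by linarith)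
  rw [RibbonStructure.value, RibbonStructure.value, hsum, hsum',
    H.powSum_congr hinj' (p' := Sum.elim (fun c => g (o c)) (fun _ => 0))
      (q' := Sum.elim (fun c => g (u c) + K.level c.1) (fun _ => K'.level x')) (by
        rintro (c | i)
        · simp only [Sum.elim_inl, hlevO, ho, hu]
          ring
        · rfl),
    H.powSum_split hinj hOinj (K.injective_times_comp (hone x) fun _ => hxm.1) _ _ _ _ hab.le hout
      hin,
    H.powSum_split hinj' hOinj (K'.injective_times_comp (hone x') fun _ => hxm'.1) _ _ _ _ hab.le
      hout hin', hrot, Finset.sum_mul, Finset.sum_mul]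
  refine Finset.sum_congr rfl fun σ _ => ?_
  have hleft : ordProd ((siteTimes o u).filter (· < a))
      (H.powBeads o u (fun c => g (o c)) (fun c => g (u c) + K.level c.1) σ) =
      ordProd ((siteTimes o u).filter (· < a))
        (H.powBeads o u (fun _ => 0) (fun c => K.level c.1) σ) := by
    refine ordProd_congr fun t ht => ?_
    obtain ⟨ht, hta⟩ := Finset.mem_filter.1 ht
    have h0 := hgJ t (hout t ht) hta
    obtain ⟨c, rfl | rfl⟩ := mem_siteTimes.1 ht
    · rw [QuasitriangularStructure.powBeads_over hOinj,
        QuasitriangularStructure.powBeads_over hOinj, h0]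
    · rw [QuasitriangularStructure.powBeads_under hOinj,
        QuasitriangularStructure.powBeads_under hOinj, h0, zero_add]
  have hright : ordProd ((siteTimes o u).filter (b < ·))
      (H.powBeads o u (fun c => g (o c)) (fun c => g (u c) + K.level c.1) σ) =
      ((H.balancing ^ (2 : ℤ) : Aˣ) : A) * ordProd ((siteTimes o u).filter (b < ·))
        (H.powBeads o u (fun _ => 0) (fun c => K.level c.1) σ) *
          (((H.balancing ^ (2 : ℤ))⁻¹ : Aˣ) : A) := by
    refine RibbonStructure.ordProd_conj _ _ fun t ht => ?_
    obtain ⟨ht, hta⟩ := Finset.mem_filter.1 ht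
    -- The exponent is written as twice 2, as S⁴ is conjugation with G².
    have h4 : g t = 2 * 2 := if_pos hta
    rw [← zpow_neg, ← H.antipodePow_two_mul]
    obtain ⟨c, rfl | rfl⟩ := mem_siteTimes.1 ht
    · rw [QuasitriangularStructure.powBeads_over hOinj,
        QuasitriangularStructure.powBeads_over hOinj, h4, H.antipodePow_zero]
    · rw [QuasitriangularStructure.powBeads_under hOinj,
        QuasitriangularStructure.powBeads_under hOinj, h4, H.antipodePow_add]
  have hcurl : H.powSum (fun _ : Unit => x.1) (fun _ => x.2) (fun _ => 0) (fun _ => K.level x) =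
      H.powSum (fun _ : Unit => x'.1) (fun _ => x'.2) (fun _ => 0) (fun _ => K'.level x') *
        ((H.balancing ^ (2 : ℤ) : Aˣ) : A) := by
    rw [hlev, hlev', hx, hx']
    cases fo
    · simp only [Bool.false_eq_true, if_false, Bool.not_false, if_true, reduceCtorEq]
      rw [H.powSum_single_under hst, H.powSum_single_over hst']
      exact H.underCurl_one_eq
    · simp only [if_true, Bool.not_true, Bool.false_eq_true, if_false]
      rw [H.powSum_single_over hst, H.powSum_single_under hst']
      exact H.overCurl_neg_two
  rw [hleft, hright, hcurl, zpow_add]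
  simp only [mul_assoc, Units.val_mul, Units.inv_mul_cancel_left]

end

/-! ### Existence and uniqueness of the invariant. -/

theorem RibbonStructure.value_eq_of_equiv {k A : Type*} [CommRing k] [Ring A] [HopfAlgebra k A]
    (H : RibbonStructure k A) {K K' : BiframedDiagram} (h : K ≈ K') :
    H.value K = H.value K' := by
  induction h with
  | rel K K' h =>
    cases h with
    | isotopy h => exact (H.value_eq_of_ambientIsotopic h).symm
    | reparam h => exact (H.value_eq_of_reparametrized h).symm
    | r1' h => exact (H.value_eq_of_moveR1' h).symm
    | r2 h => exact (H.value_eq_of_moveR2 h).symm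
    | r3 h => exact (H.value_eq_of_moveR3 h).symm
  | refl K => rfl
  | symm K K' _ ih => exact ih.symm
  | trans K K' K'' _ _ ih ih' => exact ih.trans ih'

theorem mainTheorem3 (k A : Type*) [CommRing k] [Ring A] [HopfAlgebra k A]
    (H : RibbonStructure k A) :
    ∃! Q : BiframedKnotoid → A,
      ∀ (K : BiframedDiagram) (hK : K.IsDecomposed)
        (E : ∀ type : Bool, TensorExpansion (H.crossingTensor type)),
        Q (Quotient.mk biframedSetoid K) = H.evaluate E K hK := by
  refine ⟨Quotient.lift H.value fun _ _ h => H.value_eq_of_equiv h,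
    fun K hK E => (H.evaluate_eq_value E K hK).symm, fun Q hQ => ?_⟩
  funext x
  induction x using Quotient.inductionOn with
  | _ K =>
    -- For uniqueness, the class is represented by a decomposed shear of K, where the defining
    -- property prescribes the value of Q.
    obtain ⟨c, hc⟩ := K.exists_shear_isDecomposed
    have hK : Quotient.mk biframedSetoid K = Quotient.mk biframedSetoid (K.shear c) :=
      Quotient.sound (Relation.EqvGen.rel _ _ (.isotopy (K.ambientIsotopic_shear c)))
    rw [hK, hQ _ hc fun type => (TensorExpansion.nonempty _).some, H.evaluate_eq_value]
    rfl
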